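/- All rings are commutative, Noetherian and local. For a local ring $(A,\mathfrak m_A,k)$ write $\operatorname{edim}A=\dim_k \mathfrak m_A/\mathfrak m_A^2$. **Burch index.** Let $(S,\mathfrak n,k)$ be a local ring and $I\subsetneq S$ an ideal. Put $\operatorname{Burch}_S(I)=0$ if $I=0$ or $\operatorname{depth}S/I>0$, and otherwise $$\operatorname{Burch}_S(I)=\dim_k\frac{\mathfrak n}{I\mathfrak n:_S(I:_S\mathfrak n)} .$$ For a local ring $(R,\mathfrak m,k)$ of depth $0$, let $\operatorname{Burch}(R)=\operatorname{Burch}_S(I)$, where $\hat R\cong S/I$ is a minimal Cohen presentation of the $\mathfrak m$-adic completion, that is, $S$ is a complete regular local ring with $\operatorname{edim}S=\operatorname{edim}\hat R$ (the number does not depend on the presentation). If $\operatorname{depth}R>0$, let $R'=R[z]_{\mathfrak mR[z]}$ and let $\operatorname{Burch}(R)$ be the maximum of $\operatorname{Burch}(R'/\underline xR')$ over all maximal regular sequences $\underline x$ of $R'$. **Proposition 1.5.** Let $(R,\mathfrak m,k)$ be a Noetherian local ring. 1. If $R$ is not a regular local ring of positive dimension, then $\operatorname{Burch}(R)\le \operatorname{edim}R-\operatorname{depth}R$.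 2. If $R\cong S/J\mathfrak n$, where $(S,\mathfrak n)$ is a regular local ring and $J$ is an ideal with $0\ne J\subseteq\mathfrak n$, then $\operatorname{Burch}(R)=\dim S$. 3. If $R$ is Cohen–Macaulay of minimal multiplicity, i.e. its multiplicity is $e(R)=\operatorname{edim}R-\dim R+1$, and $R$ is not a regular local ring of positive dimension, then $\operatorname{Burch}(R)=\operatorname{edim}R-\operatorname{depth}R$. 4. If $R$ is a singular (i.e. non-regular) hypersurface, meaning that $\hat R\cong S/(f)$ for a regular local ring $S$ and some $f\in S$, then $\operatorname{Burch}(R)=1$. -/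

import Mathlib

open IsLocalRing Polynomial

universe u

section RelativeBurch

variable (S : Type u) [CommRing S] [IsLocalRing S]

/-- The embedding dimension `dim_k (𝔪 / 𝔪²)` of a local ring. -/
noncomputable def embDim : ℕ :=
  Module.finrank (ResidueField S) (CotangentSpace S)

/-- The Burch ideal `I𝔫 : (I : 𝔫)` of an ideal `I` of a local ring `(S, 𝔫)`. -/
noncomputable def burchIdeal (I : Ideal S) : Ideal S :=
  (I * maximalIdeal S).colon (I.colon (maximalIdeal S : Set S) : Set S)

/-- The `S`-module `𝔫 / (𝔫 ∩ (I𝔫 : (I : 𝔫)))`. -/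
abbrev BurchQuotient (I : Ideal S) : Type u :=
  (maximalIdeal S : Submodule S S) ⧸ Submodule.comap (maximalIdeal S).subtype (burchIdeal S I)

theorem mul_mem_burchIdeal (I : Ideal S) {a b : S} (ha : a ∈ maximalIdeal S)
    (hb : b ∈ maximalIdeal S) : a * b ∈ burchIdeal S I := by
  refine Submodule.mem_colon.mpr fun s hs => ?_
  have h : b * s ∈ I := by
    have := Submodule.mem_colon.mp hs b hb
    rwa [smul_eq_mul, mul_comm] at this
  have h' : b * s * a ∈ I * maximalIdeal S := Ideal.mul_mem_mul h ha
  rwa [smul_eq_mul, mul_assoc, mul_comm a]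

/-- `𝔫²` lies in the Burch ideal, so `𝔫` kills `BurchQuotient S I`. -/
theorem burchQuotient_isTorsionBySet (I : Ideal S) :
    Module.IsTorsionBySet S (BurchQuotient S I) (maximalIdeal S) := by
  rintro x ⟨a, ha⟩
  obtain ⟨y, rfl⟩ := Submodule.Quotient.mk_surjective _ x
  change Submodule.Quotient.mk (a • y) = _
  rw [Submodule.Quotient.mk_eq_zero]
  exact mul_mem_burchIdeal S I ha y.2

/-- The structure of a vector space over `k = S/𝔫` on `𝔫 / (I𝔫 : (I : 𝔫))`. -/
noncomputable instance burchQuotientModule (I : Ideal S) :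
    Module (ResidueField S) (BurchQuotient S I) :=
  (burchQuotient_isTorsionBySet S I).module

end RelativeBurch

/-- The depth of a local ring: the supremum of the lengths of its regular sequences. (A regular
sequence `x` satisfies `xA ≠ A`, so over a local ring it lies in the maximal ideal.) -/
noncomputable def ringDepth (A : Type u) [CommRing A] : ℕ∞ :=
  ⨆ (rs : List A) (_ : RingTheory.Sequence.IsRegular A rs), (rs.length : ℕ∞)

open Classical in
/-- The relative Burch index: `0` if `I = 0` or `S/I` has positive depth, and
`dim_k 𝔫 / (I𝔫 : (I : 𝔫))` otherwise. -/
noncomputable def relBurchIndex (S : Type u) [CommRing S] [IsLocalRing S] (I : Ideal S) : ℕ :=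
  if I = ⊥ ∨ 0 < ringDepth (S ⧸ I) then 0
  else Module.finrank (ResidueField S) (BurchQuotient S I)

/-- A minimal regular Cohen presentation of a (complete) local ring `A`: a surjection `S → A` from
a complete regular local ring `S` with the same embedding dimension as `A`. -/
structure MinimalCohenPresentation (A : Type u) [CommRing A] [IsLocalRing A] : Type (u + 1) where
  S : Type u
  [commRing : CommRing S]
  [isRegularLocalRing : IsRegularLocalRing S]
  [isAdicComplete : IsAdicComplete (maximalIdeal S) S]
  map : S →+* A
  surjective : Function.Surjective map
  minimal : embDim S = embDim A

attribute [instance] MinimalCohenPresentation.commRing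
  MinimalCohenPresentation.isRegularLocalRing

/-- The completion of a local ring. -/
abbrev LocalCompletion (R : Type u) [CommRing R] [IsLocalRing R] : Type u :=
  AdicCompletion (maximalIdeal R) R

/-- The Burch index of a Noetherian local ring of depth `0`: the relative Burch index of `I` for
a minimal regular Cohen presentation `S/I` of the completion. Such presentations exist and they all
have the same index, so the supremum is just that common value. -/
noncomputable def burchIndexDepthZero (R : Type u) [CommRing R] [IsLocalRing R]
    [IsNoetherianRing R] : ℕ∞ :=
  ⨆ P : MinimalCohenPresentation (LocalCompletion R),
    (relBurchIndex P.S (RingHom.ker P.map) : ℕ∞)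

/-- The local ring `R[z]` localized at the prime ideal `𝔪R[z]`. -/
abbrev GenericExtension (R : Type u) [CommRing R] [IsLocalRing R] : Type u :=
  Localization.AtPrime ((maximalIdeal R).map (C : R →+* R[X]))

instance genericExtension_isNoetherianRing (R : Type u) [CommRing R] [IsLocalRing R]
    [IsNoetherianRing R] : IsNoetherianRing (GenericExtension R) :=
  IsLocalization.isNoetherianRing
    ((maximalIdeal R).map (C : R →+* R[X])).primeCompl (GenericExtension R) inferInstance

/-- A regular sequence of a ring that cannot be extended to a longer one. -/
structure IsMaximalRegularSequence (A : Type u) [CommRing A] (rs : List A) : Prop where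
  isRegular : RingTheory.Sequence.IsRegular A rs
  maximal : ∀ r : A, ¬ RingTheory.Sequence.IsRegular A (rs ++ [r])

theorem IsMaximalRegularSequence.isLocalRing_quotient {A : Type u} [CommRing A] [IsLocalRing A]
    {rs : List A} (h : IsMaximalRegularSequence A rs) : IsLocalRing (A ⧸ Ideal.ofList rs) := by
  have hne : Ideal.ofList rs ≠ ⊤ := fun h' => h.isRegular.top_ne_smul (by simp [h'])
  have := Ideal.Quotient.nontrivial_iff.mpr hne
  exact IsLocalRing.of_surjective' (Ideal.Quotient.mk (Ideal.ofList rs))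
    Ideal.Quotient.mk_surjective

open Classical in
/-- The Burch index of a Noetherian local ring `R`. In positive depth it is the maximum of the
Burch indices of the depth zero rings `R'/xR'`, where `R' = R[z]` localized at `𝔪R[z]` and `x` runs
over the maximal regular sequences of `R'`. -/
noncomputable def burchIndex (R : Type u) [CommRing R] [IsLocalRing R] [IsNoetherianRing R] : ℕ∞ :=
  if ringDepth R = 0 then burchIndexDepthZero R
  else ⨆ (rs : List (GenericExtension R)) (h : IsMaximalRegularSequence (GenericExtension R) rs),
    haveI := h.isLocalRing_quotient
    burchIndexDepthZero (GenericExtension R ⧸ Ideal.ofList rs)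

/-- The local ring `R` of dimension `d` has (Hilbert-Samuel) multiplicity `e`:
`d! · length(R/𝔪ⁿ) / nᵈ → e`. -/
def HasMultiplicity (R : Type u) [CommRing R] [IsLocalRing R] (e : ℝ) : Prop :=
  ∃ d : ℕ, ringKrullDim R = d ∧
    Filter.Tendsto
      (fun n : ℕ =>
        (d.factorial : ℝ) * (Module.length R (R ⧸ maximalIdeal R ^ n)).toNat / (n : ℝ) ^ d)
      Filter.atTop (nhds e)

/-- A local ring is Cohen-Macaulay if its depth equals its dimension. -/
def IsCohenMacaulayLocal (R : Type u) [CommRing R] : Prop :=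
  (ringDepth R : WithBot ℕ∞) = ringKrullDim R

/-- `R` has minimal multiplicity: `e(R) = edim R - dim R + 1`. -/
def HasMinimalMultiplicity (R : Type u) [CommRing R] [IsLocalRing R] : Prop :=
  ∃ d : ℕ, ringKrullDim R = d ∧ HasMultiplicity R ((embDim R : ℝ) - d + 1)

/-- `R` is a hypersurface: its completion is a regular local ring modulo one element. -/
def IsHypersurface (R : Type u) [CommRing R] [IsLocalRing R] : Prop :=
  ∃ (S : Type u) (_ : CommRing S) (_ : IsRegularLocalRing S) (f : S),
    Nonempty (LocalCompletion R ≃+* S ⧸ Ideal.span {f})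

-- In depth zero the upper bound holds because `BurchQuotient` is a quotient of the cotangent space
-- of the presenting regular ring S, whose dimension is edim R. In positive depth let C be the
-- generic extension, with a maximal regular sequence. If no member, at its turn, lies in the square
-- of the maximal ideal, each one lowers the embedding dimension by one, and the depth-zero bound
-- for the quotient suffices. Otherwise, as regular sequences in a local ring may be permuted, the
-- quotient has the form B/xB with x a regular element of 𝔪_B², and its index is zero. The reason
-- lies in the Koszul complex: for s in the socle of B/xB the cycles s·e_k are boundaries
-- (`smul_single_mem_koszulBoundary_of_socle`), and lifted to S = S/0 → S/I this says 𝔫(I : 𝔫) ⊆ I𝔫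
-- (`relBurchIndex_eq_zero_of_ker_eq_span`). It requires 𝔪_B to be non-principal, which follows from
-- C being non-regular.
--
-- For the ideal J𝔫 one has J ⊆ J𝔫 : 𝔫, so an element a ∈ 𝔫 of the Burch ideal satisfies aJ ⊆ 𝔫²J.
-- The determinant trick makes a integral over 𝔫², and in a regular local ring this forces a ∈ 𝔫²
-- (`mem_sq_of_mul_le`). The Burch quotient is thus the whole cotangent space.
--
-- The other two equalities reduce to this case. For minimal multiplicity, superficial elements over
-- the infinite residue field of C give a maximal regular sequence whose quotient has length e(R);
-- this forces 𝔪² = 0 in the quotient, so its presenting ideal is 𝔫·𝔫. For a singular hypersurface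
-- edim = depth + 1, and a suitable regular sequence leaves a ring of depth zero and embedding
-- dimension one, whose presenting ideal is a multiple of 𝔫 because 𝔫 is principal.
--
-- The index is a supremum over presentations: upper bounds are proved for each of them, and a lower
-- bound needs just one, so independence of the presentation plays no role. Existence does matter,
-- since an empty supremum is 0. For J𝔫 the completion of S serves; the other quotients are
-- Artinian, and Cohen's structure theorem is proved for Artinian local rings. In residue
-- characteristic p a discrete valuation ring with uniformizer p is built by Zorn's lemma and mapped
-- to the ring by successive square-zero lifting; in characteristic zero formal smoothness gives a
-- coefficient field.

universe v

set_option linter.unusedSectionVars false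

/-! ### Embedding dimension and minimal generators -/

section EmbeddingDimension

theorem embDim_eq_spanFinrank (R : Type u) [CommRing R] [IsLocalRing R] [IsNoetherianRing R] :
    embDim R = (maximalIdeal R).spanFinrank :=
  (spanFinrank_maximalIdeal_eq_finrank_cotangentSpace R).symm

variable {R : Type u} [CommRing R] [IsLocalRing R] [IsNoetherianRing R]

theorem embDim_le_of_span_range_eq {n : ℕ} (x : Fin n → R)
    (h : Ideal.span (Set.range x) = maximalIdeal R) : embDim R ≤ n := by
  rw [embDim_eq_spanFinrank, ← h]
  refine (Submodule.spanFinrank_span_le_ncard_of_finite (Set.finite_range x)).trans ?_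
  rw [← Set.image_univ]
  exact (Set.ncard_image_le Set.finite_univ).trans (by simp)

variable (R) in
theorem exists_span_range_eq_maximalIdeal :
    ∃ x : Fin (embDim R) → R, Ideal.span (Set.range x) = maximalIdeal R := by
  obtain ⟨s, hs, hspan⟩ :=
    Submodule.FG.exists_span_finset_card_eq_spanFinrank (maximalIdeal R).fg_of_isNoetherianRing
  rw [← embDim_eq_spanFinrank] at hs
  refine ⟨fun i => (s.equivFinOfCardEq hs).symm i, ?_⟩
  have : Set.range (fun i => ((s.equivFinOfCardEq hs).symm i : R)) = s := by
    ext a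
    constructor
    · rintro ⟨i, rfl⟩
      exact ((s.equivFinOfCardEq hs).symm i).2
    · intro ha
      exact ⟨s.equivFinOfCardEq hs ⟨a, ha⟩, by simp⟩
  rw [this]
  exact hspan

theorem maximalIdeal_le_of_le_sup_sq {I : Ideal R} (h : maximalIdeal R ≤ I ⊔ maximalIdeal R ^ 2) :
    maximalIdeal R ≤ I := by
  refine Submodule.le_of_le_smul_of_le_jacobson_bot (I := maximalIdeal R)
    (maximalIdeal R).fg_of_isNoetherianRing (maximalIdeal_le_jacobson _) ?_
  rwa [smul_eq_mul, ← pow_two]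

/-- An element of `𝔪 \ 𝔪²` is part of a minimal system of generators of `𝔪`. -/
theorem exists_span_insert_eq_maximalIdeal {x : R} (hx : x ∈ maximalIdeal R)
    (hx2 : x ∉ maximalIdeal R ^ 2) :
    ∃ (n : ℕ) (y : Fin n → R), n + 1 = embDim R ∧
      Ideal.span (insert x (Set.range y)) = maximalIdeal R := by
  classical
  set v : CotangentSpace R := (maximalIdeal R).toCotangent ⟨x, hx⟩ with hv
  have hv0 : v ≠ 0 := by
    rw [hv, Ne, Ideal.toCotangent_eq_zero]
    exact hx2
  have hli : LinearIndepOn (ResidueField R) id ({v} : Set (CotangentSpace R)) :=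
    (LinearIndepOn.singleton (R := ResidueField R) (v := id) hv0)
  let b := Module.Basis.extend hli
  have hfin : (hli.extend (Set.subset_univ _)).Finite :=
    Module.Finite.finite_basis b
  have hspan : Submodule.span (ResidueField R) (hli.extend (Set.subset_univ _)) = ⊤ := by
    rw [← Module.Basis.range_extend hli]
    exact b.span_eq
  have hvmem : v ∈ hli.extend (Set.subset_univ _) := hli.subset_extend _ rfl
  set T := hli.extend (Set.subset_univ _)
  have hcard : T.ncard = embDim R := by
    rw [embDim, Module.finrank_eq_nat_card_basis b]
    rfl
  have hT' : (T \ {v}).ncard + 1 = embDim R := by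
    rw [Set.ncard_sdiff_singleton_add_one hvmem hfin, hcard]
  have hfin' : (T \ {v}).Finite := hfin.subset Set.sdiff_subset
  obtain ⟨n, w, hw, hwn⟩ : ∃ (n : ℕ) (w : Fin n → CotangentSpace R), Set.range w = T \ {v} ∧
      n = (T \ {v}).ncard := by
    refine ⟨hfin'.toFinset.card, fun i => hfin'.toFinset.equivFin.symm i, ?_, ?_⟩
    · ext a
      constructor
      · rintro ⟨i, rfl⟩
        exact hfin'.mem_toFinset.1 (hfin'.toFinset.equivFin.symm i).2
      · intro ha
        exact ⟨hfin'.toFinset.equivFin ⟨a, hfin'.mem_toFinset.2 ha⟩, by simp⟩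
    · rw [Set.ncard_eq_toFinset_card _ hfin']
  choose y hy using fun i => (maximalIdeal R).toCotangent_surjective (w i)
  refine ⟨n, fun i => y i, by omega, ?_⟩
  have h1 : Submodule.span (ResidueField R)
      ((maximalIdeal R).toCotangent '' (insert ⟨x, hx⟩ (Set.range y))) = ⊤ := by
    rw [Set.image_insert_eq, ← Set.range_comp]
    have : ((maximalIdeal R).toCotangent ∘ y) = w := funext hy
    rw [this, hw, ← hv, Set.insert_sdiff_singleton, Set.insert_eq_of_mem hvmem]
    exact hspan
  have h2 := congrArg (Submodule.map (maximalIdeal R).subtype)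
    (CotangentSpace.span_image_eq_top_iff.1 h1)
  rw [Submodule.map_span, Submodule.map_top, Submodule.range_subtype, Set.image_insert_eq,
    ← Set.range_comp] at h2
  exact h2

end EmbeddingDimension

/-! ### Embedding dimension along surjections -/

section Surjection

variable {S : Type u} {A : Type v} [CommRing S] [CommRing A] [IsLocalRing S] [IsLocalRing A]

theorem map_maximalIdeal_of_surjective {f : S →+* A} (hf : Function.Surjective f) :
    (maximalIdeal S).map f = maximalIdeal A := by
  have hloc : IsLocalHom f := Function.Surjective.isLocalHom f hf
  refine le_antisymm (((IsLocalRing.local_hom_TFAE f).out 0 2).1 hloc) fun a ha => ?_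
  obtain ⟨s, rfl⟩ := hf a
  exact Ideal.mem_map_of_mem f fun hs => ha (hs.map f)

theorem mem_maximalIdeal_iff_of_surjective {f : S →+* A} (hf : Function.Surjective f) {s : S} :
    f s ∈ maximalIdeal A ↔ s ∈ maximalIdeal S := by
  have hloc : IsLocalHom f := Function.Surjective.isLocalHom f hf
  rw [mem_maximalIdeal, mem_maximalIdeal, map_mem_nonunits_iff]

theorem ker_le_maximalIdeal (f : S →+* A) : RingHom.ker f ≤ maximalIdeal S :=
  le_maximalIdeal (RingHom.ker_ne_top f)

theorem maximalIdeal_pow_map_of_surjective {f : S →+* A} (hf : Function.Surjective f) (n : ℕ) :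
    (maximalIdeal S ^ n).map f = maximalIdeal A ^ n := by
  rw [Ideal.map_pow, map_maximalIdeal_of_surjective hf]

theorem mem_sup_ker_of_map_mem {f : S →+* A} (hf : Function.Surjective f) {I : Ideal S} {s : S}
    (h : f s ∈ I.map f) : s ∈ I ⊔ RingHom.ker f := by
  have := Ideal.mem_comap.2 h
  rwa [Ideal.comap_map_of_surjective' f hf] at this

variable [IsNoetherianRing S] [IsNoetherianRing A]

theorem embDim_le_of_surjective {f : S →+* A} (hf : Function.Surjective f) :
    embDim A ≤ embDim S := by
  obtain ⟨x, hx⟩ := exists_span_range_eq_maximalIdeal S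
  refine embDim_le_of_span_range_eq (f ∘ x) ?_
  rw [Set.range_comp, ← Ideal.map_span, hx, map_maximalIdeal_of_surjective hf]

/-- Lifts generate 𝔪_S up to the kernel, hence up to 𝔪_S², and Nakayama removes the square. -/
theorem span_range_eq_of_ker_le_sq {ι : Type*} {f : S →+* A} (hf : Function.Surjective f)
    (hk : RingHom.ker f ≤ maximalIdeal S ^ 2) {x : ι → S}
    (hx : Ideal.span (Set.range (f ∘ x)) = maximalIdeal A) :
    Ideal.span (Set.range x) = maximalIdeal S := by
  have hx' : (Ideal.span (Set.range x)).map f = maximalIdeal A := by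
    rw [Ideal.map_span, ← Set.range_comp, hx]
  refine le_antisymm (Ideal.span_le.2 ?_) (maximalIdeal_le_of_le_sup_sq fun s hs => ?_)
  · rintro _ ⟨i, rfl⟩
    refine (mem_maximalIdeal_iff_of_surjective hf).1 ?_
    rw [← hx]
    exact Ideal.subset_span ⟨i, rfl⟩
  · refine sup_le_sup_left hk _ (mem_sup_ker_of_map_mem hf ?_)
    rw [hx']
    exact (mem_maximalIdeal_iff_of_surjective hf).2 hs

theorem embDim_eq_of_ker_le_sq {f : S →+* A} (hf : Function.Surjective f)
    (hk : RingHom.ker f ≤ maximalIdeal S ^ 2) : embDim S = embDim A := by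
  refine le_antisymm ?_ (embDim_le_of_surjective hf)
  obtain ⟨y, hy⟩ := exists_span_range_eq_maximalIdeal A
  choose x hx using fun i => hf (y i)
  refine embDim_le_of_span_range_eq x (span_range_eq_of_ker_le_sq hf hk ?_)
  rwa [show f ∘ x = y from funext hx]

theorem embDim_lt_of_mem_ker {f : S →+* A} (hf : Function.Surjective f) {x : S}
    (hxk : f x = 0) (hx : x ∉ maximalIdeal S ^ 2) : embDim A + 1 ≤ embDim S := by
  obtain ⟨n, y, hn, hy⟩ := exists_span_insert_eq_maximalIdeal (ker_le_maximalIdeal f hxk) hx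
  have : embDim A ≤ n := by
    refine embDim_le_of_span_range_eq (f ∘ y) ?_
    rw [← map_maximalIdeal_of_surjective hf, ← hy, Ideal.map_span, Set.image_insert_eq, hxk,
      Ideal.span_insert_zero, Set.range_comp]
  omega

theorem ker_le_sq_of_embDim_eq {f : S →+* A} (hf : Function.Surjective f)
    (h : embDim S = embDim A) : RingHom.ker f ≤ maximalIdeal S ^ 2 := by
  intro x hx
  by_contra hx2
  have := embDim_lt_of_mem_ker hf hx hx2
  omega

theorem embDim_le_add_one_of_ker_eq_span {f : S →+* A} (hf : Function.Surjective f) {x : S}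
    (hk : RingHom.ker f = Ideal.span {x}) : embDim S ≤ embDim A + 1 := by
  obtain ⟨y, hy⟩ := exists_span_range_eq_maximalIdeal A
  choose z hz using fun i => hf (y i)
  refine embDim_le_of_span_range_eq (Fin.cons x z : Fin (embDim A + 1) → S) ?_
  have hle : RingHom.ker f ≤ Ideal.span (Set.range (Fin.cons x z : Fin (embDim A + 1) → S)) := by
    rw [hk, Fin.range_cons]
    exact Ideal.span_mono (by simp)
  have hmap : (Ideal.span (Set.range (Fin.cons x z : Fin (embDim A + 1) → S))).map f =
      maximalIdeal A := by
    have hx0 : f x = 0 := by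
      rw [← RingHom.mem_ker, hk]
      exact Ideal.mem_span_singleton_self x
    rw [Fin.range_cons, Ideal.map_span, Set.image_insert_eq, hx0, Ideal.span_insert_zero,
      ← Set.range_comp, show f ∘ z = y from funext hz, hy]
  ext s
  rw [← mem_maximalIdeal_iff_of_surjective hf, ← hmap]
  exact ⟨Ideal.mem_map_of_mem f, fun h => sup_le le_rfl hle (mem_sup_ker_of_map_mem hf h)⟩

theorem embDim_add_one_eq_of_ker_eq_span {f : S →+* A} (hf : Function.Surjective f) {x : S}
    (hk : RingHom.ker f = Ideal.span {x}) (hx : x ∉ maximalIdeal S ^ 2) :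
    embDim A + 1 = embDim S :=
  le_antisymm (embDim_lt_of_mem_ker hf (by rw [← RingHom.mem_ker, hk]
                                           exact Ideal.mem_span_singleton_self x) hx)
    (embDim_le_add_one_of_ker_eq_span hf hk)

theorem embDim_eq_of_ringEquiv (e : S ≃+* A) : embDim S = embDim A :=
  embDim_eq_of_ker_le_sq (f := (e : S →+* A)) e.surjective (by
    rw [(RingHom.injective_iff_ker_eq_bot (e : S →+* A)).1 e.injective]; exact bot_le)

end Surjection

/-! ### Regular sequences modulo an initial segment -/

section

open RingTheory.Sequence CategoryTheory CategoryTheory.Abelian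

section RegularSequence

variable {R : Type u} {A : Type v} [CommRing R] [CommRing A]

theorem isWeaklyRegular_append_iff_of_ker {f : R →+* A} (hf : Function.Surjective f) {rs : List R}
    (hk : RingHom.ker f = Ideal.ofList rs) (ys : List R) :
    IsWeaklyRegular R (rs ++ ys) ↔ IsWeaklyRegular R rs ∧ IsWeaklyRegular A (ys.map f) := by
  rw [isWeaklyRegular_append_iff]
  refine and_congr_right' ?_
  have hk' : (Ideal.ofList rs • ⊤ : Submodule R R) = RingHom.ker f := by
    rw [hk, smul_eq_mul, Ideal.mul_top]
  let e : (R ⧸ (Ideal.ofList rs • ⊤ : Submodule R R)) ≃+ A :=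
    (Submodule.quotEquivOfEq _ _ hk').toAddEquiv.trans
      (RingHom.quotientKerEquivOfSurjective hf).toAddEquiv
  refine e.isWeaklyRegular_congr (List.forall₂_map_right_iff.mpr (List.forall₂_same.mpr ?_))
  intro r _ x
  obtain ⟨x, rfl⟩ := Submodule.Quotient.mk_surjective _ x
  exact map_mul f r x

theorem isRegular_iff_isWeaklyRegular_and_mem [IsLocalRing R] {rs : List R} :
    IsRegular R rs ↔ IsWeaklyRegular R rs ∧ ∀ r ∈ rs, r ∈ maximalIdeal R := by
  constructor
  · intro h
    refine ⟨h.1, fun r hr => le_maximalIdeal (J := Ideal.ofList rs) ?_ (Ideal.subset_span hr)⟩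
    intro h'
    exact h.top_ne_smul (by simp [h'])
  · rintro ⟨h1, h2⟩
    exact IsRegular.of_isWeaklyRegular_of_mem_maximalIdeal R h2 h1

variable [IsLocalRing R] [IsLocalRing A]

theorem isRegular_append_iff_of_ker {f : R →+* A} (hf : Function.Surjective f) {rs : List R}
    (hk : RingHom.ker f = Ideal.ofList rs) (ys : List R) :
    IsRegular R (rs ++ ys) ↔ IsWeaklyRegular R rs ∧ IsRegular A (ys.map f) := by
  rw [isRegular_iff_isWeaklyRegular_and_mem, isRegular_iff_isWeaklyRegular_and_mem,
    isWeaklyRegular_append_iff_of_ker hf hk, and_assoc]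
  refine and_congr_right' (and_congr_right' ?_)
  have hrs : ∀ r ∈ rs, r ∈ maximalIdeal R := fun r hr =>
    ker_le_maximalIdeal f (hk ▸ Ideal.subset_span hr)
  simp only [List.mem_append, List.mem_map, forall_exists_index, and_imp,
    forall_apply_eq_imp_iff₂, mem_maximalIdeal_iff_of_surjective hf]
  exact ⟨fun h r hr => h r (Or.inr hr), fun h r hr => hr.elim (hrs r) (h r)⟩

theorem isRegular_cons_iff_of_ker {f : R →+* A} (hf : Function.Surjective f) {x : R}
    (hk : RingHom.ker f = Ideal.span {x}) (ys : List R) :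
    IsRegular R (x :: ys) ↔ IsSMulRegular R x ∧ IsRegular A (ys.map f) := by
  rw [← isWeaklyRegular_singleton_iff, ← isRegular_append_iff_of_ker hf (rs := [x])
    (by rw [hk, Ideal.ofList_singleton])]
  rfl

end RegularSequence

/-! ### Depth via Ext and socles -/

section Depth

open ModuleCat

variable {R : Type u} [CommRing R] [IsLocalRing R] [IsNoetherianRing R]

/-- Rees's argument: Hom(k, M) = 0 yields an M-regular element of 𝔪, and dividing by a regular
element costs one degree in the vanishing range of Ext. Hence the range `i ≤ rs.length`. -/
theorem exists_isSMulRegular_quotient_of_subsingleton_ext (M : ModuleCat.{u} R) [Module.Finite R M]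
    (rs : List R) (hreg : IsWeaklyRegular M rs)
    (hext : ∀ i ≤ rs.length,
      Subsingleton (Ext (ModuleCat.of R (ResidueField R)) M i)) :
    ∃ r ∈ maximalIdeal R, IsSMulRegular (M ⧸ (Ideal.ofList rs • ⊤ : Submodule R M)) r := by
  induction rs generalizing M with
  | nil =>
    have h0 : Subsingleton (ModuleCat.of R (ResidueField R) ⟶ M) :=
      Ext.addEquiv₀.subsingleton_congr.mp (hext 0 (by simp))
    have h1 : Subsingleton (ResidueField R →ₗ[R] M) :=
      (ModuleCat.homAddEquiv (M := ModuleCat.of R (ResidueField R)) (N := M)).symm.toEquiv.subsingleton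
    obtain ⟨x, hx, hx'⟩ := IsSMulRegular.subsingleton_linearMap_iff.mp h1
    refine ⟨x, ?_, ?_⟩
    · have : Module.annihilator R (ResidueField R) = maximalIdeal R := Ideal.annihilator_quotient
      rwa [← this]
    · have : (Ideal.ofList ([] : List R) • ⊤ : Submodule R M) = ⊥ := by simp
      exact ((Submodule.quotEquivOfEqBot _ this).isSMulRegular_congr x).2 hx'
  | cons a rs ih =>
    rw [isWeaklyRegular_cons_iff] at hreg
    obtain ⟨r, hr, hr'⟩ := ih (ModuleCat.of R (QuotSMulTop a M)) hreg.2 fun i hi => by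
      have zero1 := AddCommGrpCat.isZero_of_iff_subsingleton.mpr (hext i (by simp; omega))
      have zero2 := AddCommGrpCat.isZero_of_iff_subsingleton.mpr (hext (i + 1) (by simpa using hi))
      exact AddCommGrpCat.subsingleton_of_isZero <| ShortComplex.Exact.isZero_of_both_zeros
        ((Ext.covariant_sequence_exact₃' (ModuleCat.of R (ResidueField R))
          hreg.1.smulShortComplex_shortExact) i (i + 1) rfl)
        (zero1.eq_zero_of_src _) (zero2.eq_zero_of_tgt _)
    exact ⟨r, hr, ((Submodule.quotOfListConsSMulTopEquivQuotSMulTopInner M a rs).isSMulRegular_congr r).2 hr'⟩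

/-- A regular sequence shorter than another one can be extended. -/
theorem exists_isRegular_append_of_length_lt {rs ys : List R} (hrs : IsRegular R rs)
    (hys : IsRegular R ys) (hlt : rs.length < ys.length) :
    ∃ r, IsRegular R (rs ++ [r]) := by
  have hne : maximalIdeal R • (⊤ : Submodule R (ModuleCat.of R R)) < ⊤ := by
    rw [lt_top_iff_ne_top]
    change maximalIdeal R • (⊤ : Ideal R) ≠ ⊤
    rw [smul_eq_mul, Ideal.mul_top]
    exact Ideal.IsPrime.ne_top'
  -- The longer sequence makes Ext^i(k, R) vanish for all i below its length.
  have h := subsingleton_ext_of_exists_isRegular (maximalIdeal R)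
    (ModuleCat.of R (ResidueField R)) (by
      change Module.support R (R ⧸ maximalIdeal R) ⊆ _
      rw [Module.support_eq_zeroLocus, Ideal.annihilator_quotient])
    (ModuleCat.of R R) hne ys (isRegular_iff_isWeaklyRegular_and_mem.1 hys).2 hys
  obtain ⟨r, hr, hr'⟩ := exists_isSMulRegular_quotient_of_subsingleton_ext (ModuleCat.of R R) rs
    hrs.1 fun i hi => h i (by omega)
  refine ⟨r, isRegular_iff_isWeaklyRegular_and_mem.2 ⟨?_, ?_⟩⟩
  · rw [isWeaklyRegular_append_iff, isWeaklyRegular_singleton_iff]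
    exact ⟨hrs.1, hr'⟩
  · intro s hs
    rcases List.mem_append.1 hs with hs | hs
    · exact (isRegular_iff_isWeaklyRegular_and_mem.1 hrs).2 s hs
    · rwa [List.mem_singleton.1 hs]

theorem IsMaximalRegularSequence.length_le {rs ys : List R} (hrs : IsMaximalRegularSequence R rs)
    (hys : IsRegular R ys) : ys.length ≤ rs.length := by
  by_contra h
  obtain ⟨r, hr⟩ := exists_isRegular_append_of_length_lt hrs.isRegular hys (not_le.1 h)
  exact hrs.maximal r hr

theorem IsMaximalRegularSequence.ringDepth_eq {rs : List R}
    (hrs : IsMaximalRegularSequence R rs) : ringDepth R = rs.length :=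
  le_antisymm (iSup₂_le fun _ hys => Nat.cast_le.2 (hrs.length_le hys))
    (le_iSup₂_of_le rs hrs.isRegular le_rfl)

theorem length_le_ringKrullDim {rs : List R} (h : IsRegular R rs) :
    (rs.length : WithBot ℕ∞) ≤ ringKrullDim R := by
  rw [← ringKrullDim_add_length_eq_ringKrullDim_of_isRegular rs h]
  have := h.quot_ofList_smul_nontrivial ⊤
  have : Nontrivial (R ⧸ Ideal.ofList rs) := by
    rw [smul_eq_mul, Ideal.mul_top] at this
    exact this
  have h0 : (0 : WithBot ℕ∞) ≤ ringKrullDim (R ⧸ Ideal.ofList rs) := ringKrullDim_nonneg_of_nontrivial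
  calc (rs.length : WithBot ℕ∞) = 0 + rs.length := (zero_add _).symm
    _ ≤ _ := add_le_add_left h0 _

theorem ringDepth_le_ringKrullDim : (ringDepth R : WithBot ℕ∞) ≤ ringKrullDim R := by
  have hdim := ringKrullDim_nonneg_of_nontrivial (R := R)
  obtain ⟨d, hd⟩ := WithBot.ne_bot_iff_exists.1 (ne_of_gt (lt_of_lt_of_le (WithBot.bot_lt_coe _) hdim))
  rw [← hd]
  refine WithBot.coe_le_coe.2 (iSup₂_le fun rs h => ?_)
  have := length_le_ringKrullDim h
  rw [← hd] at this
  exact WithBot.coe_le_coe.1 this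

theorem exists_isMaximalRegularSequence_append {rs : List R} (h : IsRegular R rs) :
    ∃ ys, IsMaximalRegularSequence R (rs ++ ys) := by
  by_contra! hcon
  have key : ∀ n : ℕ, ∃ ys : List R, ys.length = n ∧ IsRegular R (rs ++ ys) := by
    intro n
    induction n with
    | zero => exact ⟨[], rfl, by simpa using h⟩
    | succ n ih =>
      obtain ⟨ys, hlen, hreg⟩ := ih
      have := hcon ys
      by_cases hex : ∃ r, IsRegular R ((rs ++ ys) ++ [r])
      · obtain ⟨r, hr⟩ := hex
        exact ⟨ys ++ [r], by simp [hlen], by rwa [← List.append_assoc]⟩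
      · exact absurd ⟨hreg, fun r hr => hex ⟨r, hr⟩⟩ this
  -- The length of a regular sequence is at most dim R ≤ edim R.
  obtain ⟨ys, hlen, hreg⟩ := key (embDim R + 1)
  have h1 := length_le_ringKrullDim hreg
  have h2 := ringKrullDim_le_spanFinrank_maximalIdeal R
  rw [← embDim_eq_spanFinrank] at h2
  have h3 := Nat.cast_le.1 (h1.trans h2)
  simp at h3
  omega

variable (R) in
theorem exists_isMaximalRegularSequence : ∃ rs, IsMaximalRegularSequence R rs := by
  obtain ⟨ys, h⟩ := exists_isMaximalRegularSequence_append (IsRegular.nil R R)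
  exact ⟨ys, h⟩

/-- A map k → R is determined by the image of 1, a socle element; so Hom(k, R) = 0, which produces a
regular element. -/
theorem isSMulRegular_of_socle_eq_bot
    (h : ∀ s : R, (∀ a ∈ maximalIdeal R, s * a = 0) → s = 0) :
    ∃ r ∈ maximalIdeal R, IsSMulRegular R r := by
  have h1 : Subsingleton (ResidueField R →ₗ[R] R) := by
    refine subsingleton_of_forall_eq 0 fun φ => ?_
    have h0 : φ 1 = 0 := h _ fun a ha => by
      have : a • (1 : ResidueField R) = 0 := by
        rw [Algebra.smul_def, mul_one]
        exact (residue_eq_zero_iff a).2 ha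
      rw [mul_comm, ← smul_eq_mul, ← map_smul, this, map_zero]
    ext y
    obtain ⟨y, rfl⟩ := residue_surjective y
    have : residue R y = y • (1 : ResidueField R) := by
      rw [Algebra.smul_def, mul_one]; rfl
    rw [this, map_smul, h0, smul_zero, LinearMap.zero_apply]
  obtain ⟨x, hx, hx'⟩ := IsSMulRegular.subsingleton_linearMap_iff.mp h1
  have : Module.annihilator R (ResidueField R) = maximalIdeal R := Ideal.annihilator_quotient
  exact ⟨x, by rwa [← this], hx'⟩

theorem isMaximalRegularSequence_nil_iff :
    IsMaximalRegularSequence R [] ↔ ∃ s : R, s ≠ 0 ∧ ∀ a ∈ maximalIdeal R, s * a = 0 := by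
  constructor
  · intro h
    by_contra! hcon
    obtain ⟨r, hr, hr'⟩ := isSMulRegular_of_socle_eq_bot (R := R) fun s hs => by
      by_contra h0
      obtain ⟨a, ha, ha'⟩ := hcon s h0
      exact ha' (hs a ha)
    refine h.maximal r (isRegular_iff_isWeaklyRegular_and_mem.2 ⟨?_, by simpa using hr⟩)
    exact (isWeaklyRegular_singleton_iff R r).2 hr'
  · rintro ⟨s, hs, hs'⟩
    refine ⟨IsRegular.nil R R, fun r hr => hs ?_⟩
    rw [List.nil_append, isRegular_iff_isWeaklyRegular_and_mem, isWeaklyRegular_singleton_iff] at hr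
    refine hr.1 ?_
    simp only [smul_eq_mul, mul_zero]
    rw [mul_comm]
    exact hs' r (hr.2 r (by simp))

theorem ringDepth_eq_zero_iff_isMaximalRegularSequence_nil :
    ringDepth R = 0 ↔ IsMaximalRegularSequence R [] := by
  refine ⟨fun h => ⟨IsRegular.nil R R, fun r hr => ?_⟩, fun h => by simpa using h.ringDepth_eq⟩
  have : ((([] : List R) ++ [r]).length : ℕ∞) ≤ ringDepth R := le_iSup₂_of_le _ hr le_rfl
  rw [h] at this
  simp at this

theorem ringDepth_eq_zero_iff :
    ringDepth R = 0 ↔ ∃ s : R, s ≠ 0 ∧ ∀ a ∈ maximalIdeal R, s * a = 0 := by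
  rw [ringDepth_eq_zero_iff_isMaximalRegularSequence_nil, isMaximalRegularSequence_nil_iff]

variable {A : Type v} [CommRing A] [IsLocalRing A] [IsNoetherianRing A]

theorem isMaximalRegularSequence_append_iff_of_ker {f : R →+* A} (hf : Function.Surjective f)
    {rs : List R} (hk : RingHom.ker f = Ideal.ofList rs) (ys : List R) :
    IsMaximalRegularSequence R (rs ++ ys) ↔
      IsWeaklyRegular R rs ∧ IsMaximalRegularSequence A (ys.map f) := by
  constructor
  · rintro ⟨h1, h2⟩
    rw [isRegular_append_iff_of_ker hf hk] at h1
    refine ⟨h1.1, h1.2, fun a ha => ?_⟩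
    obtain ⟨r, rfl⟩ := hf a
    refine h2 r ?_
    rw [List.append_assoc, isRegular_append_iff_of_ker hf hk]
    exact ⟨h1.1, by simpa using ha⟩
  · rintro ⟨h1, h2, h3⟩
    refine ⟨(isRegular_append_iff_of_ker hf hk ys).2 ⟨h1, h2⟩, fun r hr => h3 (f r) ?_⟩
    rw [List.append_assoc, isRegular_append_iff_of_ker hf hk] at hr
    simpa using hr.2

theorem isMaximalRegularSequence_iff_of_ker {f : R →+* A} (hf : Function.Surjective f)
    {rs : List R} (hk : RingHom.ker f = Ideal.ofList rs) (hrs : IsWeaklyRegular R rs) :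
    IsMaximalRegularSequence R rs ↔ ringDepth A = 0 := by
  have := isMaximalRegularSequence_append_iff_of_ker hf hk []
  rw [List.append_nil, List.map_nil] at this
  rw [this, ringDepth_eq_zero_iff_isMaximalRegularSequence_nil]
  exact and_iff_right hrs

theorem ringDepth_eq_add_length_of_ker {f : R →+* A} (hf : Function.Surjective f)
    {rs : List R} (hk : RingHom.ker f = Ideal.ofList rs) (hrs : IsWeaklyRegular R rs) :
    ringDepth R = ringDepth A + rs.length := by
  obtain ⟨zs, hzs⟩ := exists_isMaximalRegularSequence A
  obtain ⟨ys, rfl⟩ : ∃ ys : List R, ys.map f = zs :=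
    List.map_surjective_iff.2 hf zs
  rw [hzs.ringDepth_eq,
    ((isMaximalRegularSequence_append_iff_of_ker hf hk ys).2 ⟨hrs, hzs⟩).ringDepth_eq]
  simp [add_comm]

theorem ringDepth_eq_add_one_of_ker {f : R →+* A} (hf : Function.Surjective f)
    {x : R} (hk : RingHom.ker f = Ideal.span {x}) (hx : IsSMulRegular R x) :
    ringDepth R = ringDepth A + 1 := by
  simpa using ringDepth_eq_add_length_of_ker hf (rs := [x]) (by rw [hk, Ideal.ofList_singleton])
    ((isWeaklyRegular_singleton_iff R x).2 hx)

theorem ringDepth_eq_of_ringEquiv (e : R ≃+* A) : ringDepth R = ringDepth A := by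
  simpa using ringDepth_eq_add_length_of_ker (f := (e : R →+* A)) e.surjective (rs := []) (by
    rw [(RingHom.injective_iff_ker_eq_bot (e : R →+* A)).1 e.injective, Ideal.ofList_nil])
    (IsWeaklyRegular.nil R R)

/-- Depth is preserved by flat local extensions `R → A` with `𝔪A` the maximal ideal of `A`. -/
theorem ringDepth_eq_of_flat [Algebra R A] [Module.Flat R A]
    (hm : (maximalIdeal R).map (algebraMap R A) = maximalIdeal A) : ringDepth R = ringDepth A := by
  have hloc : IsLocalHom (algebraMap R A) :=
    ((IsLocalRing.local_hom_TFAE (algebraMap R A)).out 0 2).2 hm.le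
  have hff : Module.FaithfullyFlat R A := Module.FaithfullyFlat.of_flat_of_isLocalHom
  obtain ⟨rs, hrs⟩ := exists_isMaximalRegularSequence R
  have hreg : IsRegular A (rs.map (algebraMap R A)) := hrs.isRegular.of_faithfullyFlat
  -- Maximality persists because a nonzero socle element modulo `rs` stays one over A: nonzero by
  -- faithful flatness, in the socle because 𝔪A is the maximal ideal.
  suffices IsMaximalRegularSequence A (rs.map (algebraMap R A)) by
    rw [hrs.ringDepth_eq, this.ringDepth_eq, List.length_map]
  have h1 := hrs.isLocalRing_quotient
  have hne : Ideal.ofList (rs.map (algebraMap R A)) ≠ ⊤ := fun h =>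
    hreg.top_ne_smul (by simp [h])
  have h2 := Ideal.Quotient.nontrivial_iff.mpr hne
  have h3 : IsLocalRing (A ⧸ Ideal.ofList (rs.map (algebraMap R A))) :=
    IsLocalRing.of_surjective' (Ideal.Quotient.mk _) Ideal.Quotient.mk_surjective
  have h4 := (isMaximalRegularSequence_iff_of_ker (f := Ideal.Quotient.mk (Ideal.ofList rs))
    Ideal.Quotient.mk_surjective (Ideal.mk_ker) hrs.isRegular.1).1 hrs
  rw [ringDepth_eq_zero_iff] at h4
  obtain ⟨s, hs, hs'⟩ := h4
  obtain ⟨s, rfl⟩ := Ideal.Quotient.mk_surjective s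
  rw [isMaximalRegularSequence_iff_of_ker (Ideal.Quotient.mk_surjective) (Ideal.mk_ker) hreg.1,
    ringDepth_eq_zero_iff]
  refine ⟨Ideal.Quotient.mk _ (algebraMap R A s), ?_, ?_⟩
  · rw [Ne, Ideal.Quotient.eq_zero_iff_mem, ← Ideal.map_ofList, ← Ideal.mem_comap,
      Ideal.comap_map_eq_self_of_faithfullyFlat, ← Ideal.Quotient.eq_zero_iff_mem]
    exact hs
  · intro a ha
    obtain ⟨a, rfl⟩ := Ideal.Quotient.mk_surjective a
    rw [mem_maximalIdeal_iff_of_surjective Ideal.Quotient.mk_surjective, ← hm] at ha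
    rw [← map_mul, Ideal.Quotient.eq_zero_iff_mem, ← Ideal.map_ofList]
    have hle : (maximalIdeal R).map (algebraMap R A) ≤
        ((Ideal.ofList rs).map (algebraMap R A)).colon {algebraMap R A s} := by
      refine Ideal.map_le_iff_le_comap.2 fun b hb => ?_
      rw [Ideal.mem_comap, Submodule.mem_colon_singleton, smul_eq_mul, ← map_mul]
      refine Ideal.mem_map_of_mem _ ?_
      have := hs' (Ideal.Quotient.mk _ b)
        ((mem_maximalIdeal_iff_of_surjective Ideal.Quotient.mk_surjective).2 hb)
      rwa [← map_mul, Ideal.Quotient.eq_zero_iff_mem, mul_comm] at this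
    have := Submodule.mem_colon_singleton.1 (hle ha)
    rwa [smul_eq_mul, mul_comm] at this

end Depth

end

/-! ### Regular local rings -/

section

open RingTheory.Sequence

section RegularLocal

theorem isLocalRing_quotient_of_ne_top {R : Type u} [CommRing R] [IsLocalRing R] {I : Ideal R}
    (h : I ≠ ⊤) : IsLocalRing (R ⧸ I) :=
  have := Ideal.Quotient.nontrivial_iff.mpr h
  IsLocalRing.of_surjective' (Ideal.Quotient.mk I) Ideal.Quotient.mk_surjective

theorem isLocalRing_quotient_of_le {R : Type u} [CommRing R] [IsLocalRing R] {I : Ideal R}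
    (h : I ≤ maximalIdeal R) : IsLocalRing (R ⧸ I) :=
  isLocalRing_quotient_of_ne_top fun h' => Ideal.IsPrime.ne_top' (top_le_iff.1 (h' ▸ h))

theorem ringKrullDim_eq_embDim (S : Type u) [CommRing S] [IsRegularLocalRing S] :
    ringKrullDim S = (embDim S : WithBot ℕ∞) :=
  ((IsRegularLocalRing.iff_finrank_cotangentSpace S).1 inferInstance).symm

theorem isRegularLocalRing_of_embDim_le {S : Type u} [CommRing S] [IsLocalRing S]
    [IsNoetherianRing S] (h : (embDim S : WithBot ℕ∞) ≤ ringKrullDim S) : IsRegularLocalRing S :=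
  IsRegularLocalRing.of_spanFinrank_maximalIdeal_le S (by rwa [← embDim_eq_spanFinrank])

variable {S : Type u} [CommRing S]

/-- The embedding dimension drops by exactly one and the dimension by at most one, so edim ≤ dim
persists. -/
theorem isRegularLocalRing_of_ker_eq_span [IsRegularLocalRing S] {A : Type u} [CommRing A]
    [IsLocalRing A] [IsNoetherianRing A] {f : S →+* A} (hf : Function.Surjective f) {x : S}
    (hk : RingHom.ker f = Ideal.span {x}) (hx : x ∉ maximalIdeal S ^ 2) :
    IsRegularLocalRing A := by
  apply isRegularLocalRing_of_embDim_le
  have h1 := embDim_add_one_eq_of_ker_eq_span hf hk hx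
  have hxm : x ∈ maximalIdeal S := ker_le_maximalIdeal f (hk ▸ Ideal.mem_span_singleton_self x)
  have h2 := ringKrullDim_le_ringKrullDim_quotient_add_card ({x} : Finset S)
    (by simpa [ringJacobson_eq_maximalIdeal] using hxm)
  have h3 : Ideal.span (({x} : Finset S) : Set S) = RingHom.ker f := by simp [hk]
  rw [ringKrullDim_eq_of_ringEquiv ((Ideal.quotEquivOfEq h3).trans
    (RingHom.quotientKerEquivOfSurjective hf)), ringKrullDim_eq_embDim, ← h1,
    Finset.card_singleton] at h2
  have hdim := ringKrullDim_nonneg_of_nontrivial (R := A)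
  obtain ⟨d, hd⟩ := WithBot.ne_bot_iff_exists.1
    (ne_of_gt (lt_of_lt_of_le (WithBot.bot_lt_coe _) hdim))
  rw [← hd] at h2 ⊢
  have h2' : ((embDim A + 1 : ℕ) : ℕ∞) ≤ d + 1 := WithBot.coe_le_coe.1 h2
  push_cast at h2'
  exact WithBot.coe_le_coe.2 (by simpa using h2')

/-- Prime avoidance tolerates two non-prime members; 𝔪² occupies both exceptional places. With `T =
∅` this merely picks an element of 𝔪 outside 𝔪². -/
theorem exists_mem_notMem_sq_notMem_minimalPrimes [IsLocalRing S] [IsNoetherianRing S]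
    {T : Set (Ideal S)} (hT : T.Finite) (hp : ∀ p ∈ T, p.IsPrime) (hne : ∀ p ∈ T, p ≠ maximalIdeal S)
    (h0 : embDim S ≠ 0) :
    ∃ x ∈ maximalIdeal S, x ∉ maximalIdeal S ^ 2 ∧ ∀ p ∈ T, x ∉ p := by
  by_contra! hcon
  have hsub : (maximalIdeal S : Set S) ⊆
      ⋃ p ∈ insert (maximalIdeal S ^ 2) T, (((id : Ideal S → Ideal S) p : Ideal S) : Set S) := by
    intro x hx
    by_cases hx2 : x ∈ maximalIdeal S ^ 2
    · exact Set.mem_biUnion (Set.mem_insert _ _) hx2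
    · obtain ⟨p, hp, hxp⟩ := hcon x hx hx2
      exact Set.mem_biUnion (Set.mem_insert_of_mem _ hp) hxp
  rw [Ideal.subset_union_prime_finite (f := id) (hT.insert _) (maximalIdeal S ^ 2) (maximalIdeal S ^ 2)
    (fun p hpT h1 _ => hp p (hpT.resolve_left h1))] at hsub
  obtain ⟨p, hpT, hle⟩ := hsub
  rcases hpT with rfl | hpT
  · have h1 : maximalIdeal S ≤ ⊥ := maximalIdeal_le_of_le_sup_sq (by simpa using hle)
    apply h0
    rw [embDim_eq_spanFinrank, le_bot_iff.1 h1, Submodule.spanFinrank_bot]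
  · exact hne p hpT ((le_maximalIdeal (hp p hpT).ne_top).antisymm hle)

/-- A regular local ring is a domain. -/
theorem IsRegularLocalRing.isDomain (S : Type u) [CommRing S] [IsRegularLocalRing S] :
    IsDomain S := by
  obtain ⟨n, hn⟩ : ∃ n, embDim S = n := ⟨_, rfl⟩
  induction n generalizing S with
  | zero =>
    have : IsField S := finrank_cotangentSpace_eq_zero_iff.1 hn
    exact this.isDomain
  | succ n ih =>
    have hmin : ∀ p ∈ minimalPrimes S, p ≠ maximalIdeal S := by
      rintro p hp rfl
      have h1 : (maximalIdeal S).height = 0 := by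
        rw [Ideal.height_eq_zero_iff]
        exact hp
      have h2 := maximalIdeal_height_eq_ringKrullDim (R := S)
      rw [h1, ringKrullDim_eq_embDim, hn] at h2
      have h3 : (0 : ℕ∞) = ((n + 1 : ℕ) : ℕ∞) := WithBot.coe_injective h2
      exact absurd (Nat.cast_injective (R := ℕ∞) h3) (by omega)
    obtain ⟨x, hx, hx2, hxp⟩ := exists_mem_notMem_sq_notMem_minimalPrimes
      (minimalPrimes.finite_of_isNoetherianRing S) (fun p hp => hp.1.1) hmin (by omega)
    have hloc : IsLocalRing (S ⧸ Ideal.span {x}) :=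
      isLocalRing_quotient_of_le ((Ideal.span_singleton_le_iff_mem _).2 hx)
    have hk : RingHom.ker (Ideal.Quotient.mk (Ideal.span {x})) = Ideal.span {x} := Ideal.mk_ker
    have hreg := isRegularLocalRing_of_ker_eq_span Ideal.Quotient.mk_surjective hk hx2
    have hdim := embDim_add_one_eq_of_ker_eq_span Ideal.Quotient.mk_surjective hk hx2
    have hdom := ih (S ⧸ Ideal.span {x}) (by omega)
    have hprime : (Ideal.span {x}).IsPrime := (Ideal.Quotient.isDomain_iff_prime _).1 hdom
    obtain ⟨q, hq, hqx⟩ := Ideal.exists_minimalPrimes_le (I := (⊥ : Ideal S)) (J := Ideal.span {x})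
      bot_le
    have hqp : q.IsPrime := hq.1.1
    -- q is a prime inside (x) not containing x, so q = xq, and Nakayama gives q = 0.
    have hq0 : q ≤ ⊥ := by
      refine Submodule.le_of_le_smul_of_le_jacobson_bot (I := maximalIdeal S)
        q.fg_of_isNoetherianRing (maximalIdeal_le_jacobson _) ?_
      rw [bot_sup_eq]
      intro y hy
      obtain ⟨z, rfl⟩ := Ideal.mem_span_singleton'.1 (hqx hy)
      have hz : z ∈ q := (hqp.mem_or_mem hy).resolve_right (hxp q hq)
      rw [smul_eq_mul, mul_comm z]
      exact Ideal.mul_mem_mul hx hz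
    have hbot : (⊥ : Ideal S).IsPrime := le_bot_iff.1 hq0 ▸ hqp
    have := IsDomain.of_bot_isPrime S
    exact this

theorem exists_isRegular_length_eq_embDim (S : Type u) [CommRing S] [IsRegularLocalRing S] :
    ∃ rs : List S, IsRegular S rs ∧ rs.length = embDim S := by
  obtain ⟨n, hn⟩ : ∃ n, embDim S = n := ⟨_, rfl⟩
  induction n generalizing S with
  | zero => exact ⟨[], IsRegular.nil S S, hn.symm⟩
  | succ n ih =>
    have hd := IsRegularLocalRing.isDomain S
    obtain ⟨x, hx, hx2, -⟩ := exists_mem_notMem_sq_notMem_minimalPrimes (S := S) (T := ∅)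
      Set.finite_empty (by simp) (by simp) (by omega)
    have hloc : IsLocalRing (S ⧸ Ideal.span {x}) :=
      isLocalRing_quotient_of_le ((Ideal.span_singleton_le_iff_mem _).2 hx)
    have hk : RingHom.ker (Ideal.Quotient.mk (Ideal.span {x})) = Ideal.span {x} := Ideal.mk_ker
    have hreg := isRegularLocalRing_of_ker_eq_span Ideal.Quotient.mk_surjective hk hx2
    have hdim := embDim_add_one_eq_of_ker_eq_span Ideal.Quotient.mk_surjective hk hx2
    obtain ⟨ys, hys, hlen⟩ := ih (S ⧸ Ideal.span {x}) (by omega)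
    obtain ⟨zs, rfl⟩ := List.map_surjective_iff.2 Ideal.Quotient.mk_surjective ys
    refine ⟨x :: zs, (isRegular_cons_iff_of_ker Ideal.Quotient.mk_surjective hk zs).2 ⟨?_, hys⟩, ?_⟩
    · have hx0 : x ≠ 0 := by rintro rfl; exact hx2 (zero_mem _)
      exact isSMulRegular_iff_right_eq_zero_of_smul.2 fun y hy =>
        (mul_eq_zero.1 hy).resolve_left hx0
    · rw [List.length_map] at hlen
      simp only [List.length_cons]
      omega

theorem ringDepth_eq_embDim (S : Type u) [CommRing S] [IsRegularLocalRing S] :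
    ringDepth S = embDim S := by
  obtain ⟨rs, hrs, hlen⟩ := exists_isRegular_length_eq_embDim S
  refine le_antisymm ?_ (hlen ▸ le_iSup₂_of_le rs hrs le_rfl)
  have := ringDepth_le_ringKrullDim (R := S)
  rw [ringKrullDim_eq_embDim] at this
  exact WithBot.coe_le_coe.1 this

/-- In a regular local ring, powers of an element of order one have the expected order. -/
theorem pow_notMem_pow_succ [IsRegularLocalRing S] {x : S} (hx : x ∈ maximalIdeal S)
    (hx2 : x ∉ maximalIdeal S ^ 2) (m : ℕ) : x ^ m ∉ maximalIdeal S ^ (m + 1) := by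
  intro hm
  obtain ⟨n, y, hn, hy⟩ := exists_span_insert_eq_maximalIdeal hx hx2
  set P := Ideal.span (Set.range y) with hP
  have hPle : P ≤ maximalIdeal S := by
    rw [← hy]
    exact Ideal.span_mono (Set.subset_insert _ _)
  have hloc := isLocalRing_quotient_of_le hPle
  have hmax : maximalIdeal (S ⧸ P) = Ideal.span {Ideal.Quotient.mk P x} := by
    rw [← map_maximalIdeal_of_surjective (Ideal.Quotient.mk_surjective (I := P)), ← hy,
      Ideal.span_insert, Ideal.map_sup, ← hP, Ideal.map_quotient_self, sup_bot_eq, Ideal.map_span,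
      Set.image_singleton]
  -- Modulo the other generators 𝔪 is generated by x, so x^m ∈ 𝔪^(m+1) forces 𝔪^m = 𝔪^(m+1), which
  -- is 0 by Nakayama. Then n = edim S - 1 elements cut S down to dimension zero, contradicting dim
  -- S = edim S.
  have hpow : maximalIdeal (S ⧸ P) ^ m = ⊥ := by
    refine Submodule.eq_bot_of_le_smul_of_le_jacobson_bot (maximalIdeal (S ⧸ P)) _
      (IsNoetherian.noetherian _) ?_ (maximalIdeal_le_jacobson _)
    rw [smul_eq_mul, ← pow_succ']
    have : Ideal.Quotient.mk P (x ^ m) ∈ maximalIdeal (S ⧸ P) ^ (m + 1) := by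
      rw [← maximalIdeal_pow_map_of_surjective (Ideal.Quotient.mk_surjective (I := P))]
      exact Ideal.mem_map_of_mem _ hm
    nth_rewrite 1 [hmax]
    rwa [Ideal.span_singleton_pow, Ideal.span_singleton_le_iff_mem, ← map_pow]
  have hart : IsArtinianRing (S ⧸ P) :=
    (isArtinianRing_iff_isNilpotent_maximalIdeal _).2 ⟨m, hpow⟩
  have h0 : ringKrullDim (S ⧸ P) ≤ 0 := by
    have := isArtinianRing_iff_krullDimLE_zero.1 hart
    rwa [Ring.KrullDimLE, Order.krullDimLE_iff] at this
  classical
  have h1 := ringKrullDim_le_ringKrullDim_quotient_add_card (Finset.univ.image y) (by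
    rw [ringJacobson_eq_maximalIdeal, Finset.coe_image, Finset.coe_univ, Set.image_univ]
    exact Ideal.span_le.1 hPle)
  rw [Finset.coe_image, Finset.coe_univ, Set.image_univ, ← hP] at h1
  replace h1 := h1.trans (add_le_add_left h0 _)
  rw [zero_add, ringKrullDim_eq_embDim] at h1
  have h2 : (Finset.univ.image y).card ≤ n := Finset.card_image_le.trans (by simp)
  have h3 := Nat.cast_le.1 h1
  omega

/-- Determinant trick: x acts on J through 𝔫², and since S is a domain and J ≠ 0, x itself satisfies
a monic equation of some degree m with k-th coefficient in 𝔫^(2(m-k)). All lower terms lie in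
𝔫^(m+1), hence so does x^m, against `pow_notMem_pow_succ` if x ∉ 𝔫². -/
theorem mem_sq_of_mul_le [IsRegularLocalRing S] {J : Ideal S} (hJ : J ≠ ⊥) {x : S}
    (hx : x ∈ maximalIdeal S) (h : ∀ j ∈ J, x * j ∈ maximalIdeal S ^ 2 * J) :
    x ∈ maximalIdeal S ^ 2 := by
  by_contra hx2
  have hd := IsRegularLocalRing.isDomain S
  obtain ⟨p, hmonic, -, hcoeff, hp⟩ :=
    LinearMap.exists_monic_and_natDegree_eq_and_coeff_mem_pow_and_aeval_eq_zero
    S (LinearMap.lsmul S J x) (maximalIdeal S ^ 2) (by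
      rintro _ ⟨j, rfl⟩
      rw [Submodule.mem_smul_top_iff]
      exact h j j.2)
  obtain ⟨j, hj, hj0⟩ := Submodule.exists_mem_ne_zero_of_ne_bot hJ
  have heval : p.eval x = 0 := by
    have h1 : Polynomial.aeval (algebraMap S (Module.End S J) x) p ⟨j, hj⟩ = 0 := by
      have : algebraMap S (Module.End S J) x = LinearMap.lsmul S J x := rfl
      rw [this, hp, LinearMap.zero_apply]
    rw [Polynomial.aeval_algebraMap_apply] at h1
    have h2 := congrArg Subtype.val h1
    exact (mul_eq_zero.1 h2).resolve_right hj0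
  refine pow_notMem_pow_succ hx hx2 p.natDegree ?_
  rw [Polynomial.eval_eq_sum_range, Finset.sum_range_succ, hmonic.coeff_natDegree, one_mul] at heval
  rw [eq_neg_of_add_eq_zero_right heval]
  refine neg_mem (sum_mem fun k hk => ?_)
  have hk' := Finset.mem_range.1 hk
  have h3 : p.coeff k * x ^ k ∈ (maximalIdeal S ^ 2) ^ (p.natDegree - k) * maximalIdeal S ^ k :=
    Ideal.mul_mem_mul (hcoeff k) (Ideal.pow_mem_pow hx k)
  rw [← pow_mul, ← pow_add] at h3
  exact Ideal.pow_le_pow_right (by omega) h3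

end RegularLocal

/-! ### The relative Burch index -/

section RelativeBurchIndex

variable {S : Type u} [CommRing S] [IsLocalRing S]

theorem mem_burchIdeal_iff {I : Ideal S} {a : S} :
    a ∈ burchIdeal S I ↔
      ∀ s, (∀ b ∈ maximalIdeal S, s * b ∈ I) → a * s ∈ I * maximalIdeal S := by
  rw [burchIdeal, Submodule.mem_colon]
  refine forall_congr' fun s => ?_
  rw [SetLike.mem_coe, Submodule.mem_colon]
  rfl

theorem residueField_smul_burchQuotient (I : Ideal S) (r : S) (x : BurchQuotient S I) :
    residue S r • x = r • x := by
  obtain ⟨y, rfl⟩ := Submodule.Quotient.mk_surjective _ x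
  rfl

instance isScalarTower_burchQuotient (I : Ideal S) :
    IsScalarTower S (ResidueField S) (BurchQuotient S I) where
  smul_assoc r k x := by
    obtain ⟨k, rfl⟩ := residue_surjective k
    have : r • residue S k = residue S (r * k) := by rw [Algebra.smul_def, map_mul]; rfl
    rw [this, residueField_smul_burchQuotient, residueField_smul_burchQuotient, mul_smul]

/-- The canonical surjection from the cotangent space onto `BurchQuotient S I`. -/
noncomputable def cotangentToBurchQuotient (I : Ideal S) :
    CotangentSpace S →ₗ[ResidueField S] BurchQuotient S I :=
  LinearMap.extendScalarsOfSurjective (R := S) residue_surjective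
    (Ideal.Cotangent.lift (Submodule.mkQ _) fun x y => by
      rw [Submodule.mkQ_apply, Submodule.Quotient.mk_eq_zero]
      exact mul_mem_burchIdeal S I x.2 y.2)

theorem cotangentToBurchQuotient_apply (I : Ideal S) (x : maximalIdeal S) :
    cotangentToBurchQuotient I ((maximalIdeal S).toCotangent x) = Submodule.Quotient.mk x := rfl

theorem cotangentToBurchQuotient_surjective (I : Ideal S) :
    Function.Surjective (cotangentToBurchQuotient I) := by
  intro y
  obtain ⟨x, rfl⟩ := Submodule.Quotient.mk_surjective _ y
  exact ⟨_, cotangentToBurchQuotient_apply I x⟩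

theorem finrank_burchQuotient_le [IsNoetherianRing S] (I : Ideal S) :
    Module.finrank (ResidueField S) (BurchQuotient S I) ≤ embDim S :=
  LinearMap.finrank_le_finrank_of_surjective (cotangentToBurchQuotient_surjective I)

theorem finrank_burchQuotient_eq [IsNoetherianRing S] {I : Ideal S}
    (h : ∀ a ∈ maximalIdeal S, a ∈ burchIdeal S I → a ∈ maximalIdeal S ^ 2) :
    Module.finrank (ResidueField S) (BurchQuotient S I) = embDim S := by
  refine (LinearEquiv.finrank_eq (LinearEquiv.ofBijective (cotangentToBurchQuotient I)
    ⟨?_, cotangentToBurchQuotient_surjective I⟩)).symm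
  rw [← LinearMap.ker_eq_bot, LinearMap.ker_eq_bot']
  intro x hx
  obtain ⟨x, rfl⟩ := (maximalIdeal S).toCotangent_surjective x
  rw [cotangentToBurchQuotient_apply, Submodule.Quotient.mk_eq_zero] at hx
  exact (Ideal.toCotangent_eq_zero _ _).2 (h x x.2 hx)

theorem relBurchIndex_le_embDim [IsNoetherianRing S] (I : Ideal S) :
    relBurchIndex S I ≤ embDim S := by
  unfold relBurchIndex
  split_ifs
  · exact Nat.zero_le _
  · exact finrank_burchQuotient_le I

theorem relBurchIndex_eq_zero {I : Ideal S} (h : maximalIdeal S ≤ burchIdeal S I) :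
    relBurchIndex S I = 0 := by
  unfold relBurchIndex
  split_ifs
  · rfl
  · have : Subsingleton (BurchQuotient S I) :=
      Submodule.Quotient.subsingleton_iff.2 (eq_top_iff.2 fun x _ => h x.2)
    exact Module.finrank_zero_of_subsingleton

/-- Nakayama. The element found maps to a nonzero socle element of S/J𝔫, which shows that this ring
has depth zero. -/
theorem mul_maximalIdeal_ne [IsNoetherianRing S] {J : Ideal S} (hJ : J ≠ ⊥) :
    ∃ j ∈ J, j ∉ J * maximalIdeal S := by
  by_contra! h
  refine hJ (Submodule.eq_bot_of_le_smul_of_le_jacobson_bot (maximalIdeal S) _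
      (IsNoetherian.noetherian J) ?_ (maximalIdeal_le_jacobson _))
  rw [smul_eq_mul, mul_comm]
  exact h

/-- If `J ≠ 0` then the relative Burch index of `J𝔫` is maximal. -/
theorem relBurchIndex_mul_maximalIdeal {S : Type u} [CommRing S] [IsRegularLocalRing S]
    {J : Ideal S} (hJ : J ≠ ⊥) (hJm : J ≤ maximalIdeal S) :
    relBurchIndex S (J * maximalIdeal S) = embDim S := by
  have hd := IsRegularLocalRing.isDomain S
  have hm : maximalIdeal S ≠ ⊥ := fun h => hJ (le_bot_iff.1 (h ▸ hJm))
  obtain ⟨j, hj, hj'⟩ := mul_maximalIdeal_ne hJ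
  have hloc : IsLocalRing (S ⧸ J * maximalIdeal S) := isLocalRing_quotient_of_le Ideal.mul_le_right
  have hdepth : ringDepth (S ⧸ J * maximalIdeal S) = 0 := by
    refine ringDepth_eq_zero_iff.2 ⟨Ideal.Quotient.mk _ j, ?_, fun a ha => ?_⟩
    · rwa [Ne, Ideal.Quotient.eq_zero_iff_mem]
    · obtain ⟨a, rfl⟩ := Ideal.Quotient.mk_surjective a
      rw [mem_maximalIdeal_iff_of_surjective Ideal.Quotient.mk_surjective] at ha
      rw [← map_mul, Ideal.Quotient.eq_zero_iff_mem]
      exact Ideal.mul_mem_mul hj ha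
  have hcond : ¬ (J * maximalIdeal S = ⊥ ∨ 0 < ringDepth (S ⧸ J * maximalIdeal S)) := by
    rw [hdepth, Ideal.mul_eq_bot]
    simp [hJ, hm]
  rw [relBurchIndex, if_neg hcond]
  refine finrank_burchQuotient_eq fun a ha hab => mem_sq_of_mul_le hJ ha fun i hi => ?_
  -- J lies in J𝔫 : 𝔫, so the Burch ideal multiplies J into J𝔫².
  have := mem_burchIdeal_iff.1 hab i fun b hb => Ideal.mul_mem_mul hi hb
  rwa [mul_assoc, ← pow_two, mul_comm J] at this

end RelativeBurchIndex

end

/-! ### Koszul boundaries of degree one -/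

section Koszul

variable {R : Type u} [CommRing R] {ι : Type*} [Fintype ι] [DecidableEq ι]

/-- The module of boundaries of degree one in the Koszul complex of a family `a`. -/
def koszulBoundary (a : ι → R) : Submodule R (ι → R) :=
  Submodule.span R (Set.range fun p : ι × ι => a p.1 • Pi.single p.2 1 - a p.2 • Pi.single p.1 1)

theorem koszulBoundary_mem (a : ι → R) (i j : ι) :
    a i • Pi.single j 1 - a j • Pi.single i 1 ∈ koszulBoundary a :=
  Submodule.subset_span ⟨(i, j), rfl⟩

theorem sum_mul_eq_zero_of_mem_koszulBoundary {a w : ι → R} (hw : w ∈ koszulBoundary a) :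
    ∑ i, w i * a i = 0 := by
  let φ : (ι → R) →ₗ[R] R := Fintype.linearCombination R a
  have hφ : ∀ w, φ w = ∑ i, w i * a i := fun w => by
    simp [φ, Fintype.linearCombination_apply]
  have : koszulBoundary a ≤ LinearMap.ker φ := by
    refine Submodule.span_le.2 ?_
    rintro _ ⟨⟨i, j⟩, rfl⟩
    simp only [SetLike.mem_coe, LinearMap.mem_ker, hφ]
    simp [Pi.single_apply, mul_sub, Finset.sum_sub_distrib, mul_comm]
  rw [← hφ]
  exact this hw

/-- The ideal (a) annihilates first Koszul homology: if Σ wᵢaᵢ = 0 then a_l·w = Σ wᵢ(a_l·eᵢ -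
aᵢ·e_l). -/
theorem smul_mem_koszulBoundary_of_cycle {a w : ι → R} (hw : ∑ i, w i * a i = 0) {c : R}
    (hc : c ∈ Ideal.span (Set.range a)) : c • w ∈ koszulBoundary a := by
  have hle : Ideal.span (Set.range a) ≤
      (koszulBoundary a).comap (LinearMap.toSpanSingleton R (ι → R) w) := by
    refine Ideal.span_le.2 ?_
    rintro _ ⟨l, rfl⟩
    change a l • w ∈ koszulBoundary a
    have : a l • w = ∑ i, w i • (a l • Pi.single i (1 : R) - a i • Pi.single l 1) := by
      simp only [smul_sub, Finset.sum_sub_distrib]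
      have h1 : ∑ i, w i • a i • (Pi.single l 1 : ι → R) = 0 := by
        simp only [← smul_assoc, smul_eq_mul, ← Finset.sum_smul, hw, zero_smul]
      rw [h1, sub_zero]
      ext j
      simp [Finset.sum_apply, Pi.single_apply, mul_comm]
    rw [this]
    exact sum_mem fun i _ => Submodule.smul_mem _ _ (koszulBoundary_mem a l i)
  exact hle hc

variable {A : Type v} [CommRing A]

theorem comp_mem_koszulBoundary (f : R →+* A) {a w : ι → R} (hw : w ∈ koszulBoundary a) :
    f ∘ w ∈ koszulBoundary (f ∘ a) := by
  induction hw using Submodule.span_induction with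
  | mem x hx =>
    obtain ⟨⟨i, j⟩, rfl⟩ := hx
    convert koszulBoundary_mem (f ∘ a) i j using 1
    ext k
    simp [Pi.single_apply, apply_ite f]
  | zero => convert zero_mem (koszulBoundary (f ∘ a)); ext; simp
  | add x y _ _ hx hy => convert add_mem hx hy; ext; simp
  | smul c x _ hx => convert Submodule.smul_mem _ (f c) hx; ext; simp

theorem exists_mem_koszulBoundary_comp_eq {f : R →+* A} (hf : Function.Surjective f) {a : ι → R}
    {w : ι → A} (hw : w ∈ koszulBoundary (f ∘ a)) : ∃ v ∈ koszulBoundary a, f ∘ v = w := by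
  induction hw using Submodule.span_induction with
  | mem x hx =>
    obtain ⟨⟨i, j⟩, rfl⟩ := hx
    refine ⟨_, koszulBoundary_mem a i j, ?_⟩
    ext k
    simp [Pi.single_apply, apply_ite f]
  | zero => exact ⟨0, zero_mem _, by ext; simp⟩
  | add x y _ _ hx hy =>
    obtain ⟨v, hv, rfl⟩ := hx
    obtain ⟨w, hw, rfl⟩ := hy
    exact ⟨v + w, add_mem hv hw, by ext; simp⟩
  | smul c x _ hx =>
    obtain ⟨v, hv, rfl⟩ := hx
    obtain ⟨c, rfl⟩ := hf c
    exact ⟨c • v, Submodule.smul_mem _ _ hv, by ext; simp⟩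

/-- Let `x ∈ 𝔪²` be a regular element of a local ring `B` whose maximal ideal is not principal.
If `s` is an element of the socle of `B/xB`, then the Koszul cycles `s • eₖ` of `B/xB` are
boundaries. -/
theorem smul_single_mem_koszulBoundary_of_socle {B : Type u} [CommRing B] [IsLocalRing B]
    {g : B →+* A} {x : B} (hk : RingHom.ker g = Ideal.span {x})
    (hx : x ∈ maximalIdeal B ^ 2) (hreg : IsSMulRegular B x)
    (hnp : ∀ m : B, maximalIdeal B ≠ Ideal.span {m}) {a : ι → B}
    (ha : Ideal.span (Set.range a) = maximalIdeal B) {s : B}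
    (hs : ∀ b ∈ maximalIdeal B, s * b ∈ Ideal.span {x}) (k : ι) :
    g s • Pi.single k 1 ∈ koszulBoundary (g ∘ a) := by
  have ham : ∀ i, a i ∈ maximalIdeal B := fun i => ha ▸ Ideal.subset_span ⟨i, rfl⟩
  choose c hc using fun i => Ideal.mem_span_singleton'.1 (hs (a i) (ham i))
  have hcancel : ∀ y z : B, x * y = x * z → y = z := fun y z h => hreg h
  -- If c i had an inverse u, then x = u·s·(a i) and therefore a l = u·(c l)·(a i) for all l, making
  -- 𝔪 principal.
  have hcm : ∀ i, c i ∈ maximalIdeal B := by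
    intro i
    by_contra hi
    obtain ⟨u, hu⟩ := isUnit_iff_exists_inv.1 (not_not.1 fun h => hi ((mem_maximalIdeal _).2 h))
    refine hnp (a i) (le_antisymm ?_ ((Ideal.span_singleton_le_iff_mem _).2 (ham i)))
    rw [← ha, Ideal.span_le]
    rintro _ ⟨l, rfl⟩
    refine Ideal.mem_span_singleton'.2 ⟨u * c l, ?_⟩
    apply hcancel
    have h1 := hc i
    have h2 := hc l
    linear_combination (a i * u) * h2 + a l * x * hu - (a l * u) * h1
  -- As x ∈ 𝔪², it is a combination of the a i with coefficients b i in 𝔪.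
  rw [pow_two, ← smul_eq_mul] at hx
  nth_rewrite 2 [← ha] at hx
  obtain ⟨b, hbm, hb⟩ := (Submodule.mem_ideal_smul_span_iff_exists_sum (maximalIdeal B) a x).1 hx
  have hb' : x = ∑ i, b i * a i := by
    rw [← hb, Finsupp.sum_fintype _ _ (by simp)]
    simp
  have hca : ∀ i j, a i * c j = a j * c i := fun i j => by
    apply hcancel
    linear_combination a i * hc j - a j * hc i
  have hsum : s = ∑ i, b i * c i := by
    apply hcancel
    rw [Finset.mul_sum]
    calc x * s = ∑ i, (b i * a i) * s := by rw [← Finset.sum_mul, ← hb']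
      _ = _ := Finset.sum_congr rfl fun i _ => by linear_combination - b i * hc i
  have hgx : g x = 0 := by
    rw [← RingHom.mem_ker, hk]
    exact Ideal.mem_span_singleton_self x
  have hspan : Ideal.span (Set.range (g ∘ a)) = (maximalIdeal B).map g := by
    rw [← ha, Ideal.map_span, Set.range_comp]
  -- c_i·e_k - c_k·e_i is a cycle already over B by `hca`, and b i ∈ 𝔪 turns it into a boundary.
  have h1 : ∀ i, g (b i) • (g ∘ (c i • Pi.single k 1 - c k • Pi.single i 1 : ι → B)) ∈
      koszulBoundary (g ∘ a) := fun i => by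
    refine smul_mem_koszulBoundary_of_cycle ?_ ?_
    · have : ∑ j, (c i • Pi.single k 1 - c k • Pi.single i 1 : ι → B) j * a j = 0 := by
        simp only [Pi.sub_apply, Pi.smul_apply, smul_eq_mul, Pi.single_apply, sub_mul,
          Finset.sum_sub_distrib, mul_ite, mul_one, mul_zero, ite_mul, zero_mul,
          Finset.sum_ite_eq', Finset.mem_univ, if_true]
        linear_combination hca k i
      have h := congrArg g this
      simpa only [Function.comp_apply, map_sum, map_mul, map_zero] using h
    · rw [hspan]
      exact Ideal.mem_map_of_mem g (hbm i)
  -- b is a cycle only modulo x, since Σ bᵢaᵢ = x. Adding c_k·b restores the terms b_i·c_k·e_i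
  -- subtracted in `h1`.
  have h2 : g (c k) • (g ∘ b) ∈ koszulBoundary (g ∘ a) := by
    refine smul_mem_koszulBoundary_of_cycle ?_ ?_
    · have h := congrArg g hb'
      rw [hgx] at h
      simpa only [Function.comp_apply, map_sum, map_mul] using h.symm
    · rw [hspan]
      exact Ideal.mem_map_of_mem g (hcm k)
  have h3 : g s • (Pi.single k 1 : ι → A) =
      ∑ i, g (b i) • (g ∘ (c i • Pi.single k 1 - c k • Pi.single i 1 : ι → B)) +
        g (c k) • (g ∘ b) := by
    ext j
    rw [hsum]
    simp only [Pi.smul_apply, Pi.add_apply, Finset.sum_apply, Function.comp_apply, Pi.sub_apply,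
      smul_eq_mul, map_sub, map_mul, map_sum, mul_sub, Finset.sum_sub_distrib]
    have h4 : ∑ i, g (b i) * (g (c k) * g ((Pi.single i 1 : ι → B) j)) = g (c k) * g (b j) := by
      rw [Finset.sum_eq_single j]
      · simp [mul_comm]
      · intro i _ hij
        simp [hij.symm]
      · simp
    have h5 : g ((Pi.single k 1 : ι → B) j) = (Pi.single k 1 : ι → A) j := by
      simp [Pi.single_apply, apply_ite g]
    rw [h4, sub_add_cancel, Finset.sum_mul]
    exact Finset.sum_congr rfl fun i _ => by rw [h5, mul_assoc]
  rw [h3]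
  exact add_mem (sum_mem fun i _ => h1 i) h2

end Koszul

/-- Annihilators of finitely many elements commute with flat base change. -/
theorem mem_span_of_flat_of_mul_eq_zero {A : Type u} {C : Type v} [CommRing A] [CommRing C]
    [Algebra A C] [Module.Flat A C] {ι : Type} [Finite ι] (a : ι → A) {s : C}
    (hs : ∀ i, s * algebraMap A C (a i) = 0) :
    s ∈ Ideal.span (algebraMap A C '' {t | ∀ i, t * a i = 0}) := by
  classical
  have := Fintype.ofFinite ι
  -- Equational criterion of flatness: 1 ↦ s factors through a finite free module by a vector whose
  -- entries already annihilate every a i.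
  obtain ⟨k, y, z, h1, h2⟩ := Module.Flat.exists_factorization_of_comp_eq_zero_of_free
    (R := A) (M := C) (K := ι → A) (N := A) (f := Fintype.linearCombination A a)
    (x := LinearMap.toSpanSingleton A C s) (by
      ext i
      simpa [Fintype.linearCombination_apply_single, Algebra.smul_def, mul_comm] using hs i)
  have hs' : s = ∑ j, algebraMap A C (y 1 j) * z (Finsupp.single j 1) := by
    have := LinearMap.congr_fun h1 1
    rw [LinearMap.toSpanSingleton_apply, one_smul, LinearMap.comp_apply] at this
    rw [this]
    conv_lhs => rw [← Finsupp.univ_sum_single (y 1)]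
    rw [map_sum]
    refine Finset.sum_congr rfl fun j _ => ?_
    rw [← Algebra.smul_def, ← map_smul, Finsupp.smul_single, smul_eq_mul, mul_one]
  rw [hs']
  refine sum_mem fun j _ => Ideal.mul_mem_right _ _ (Ideal.subset_span ⟨_, fun i => ?_, rfl⟩)
  have := LinearMap.congr_fun h2 (Pi.single i 1)
  rw [LinearMap.comp_apply, Fintype.linearCombination_apply_single, one_smul,
    ← mul_one (a i), ← smul_eq_mul, map_smul] at this
  have h3 := DFunLike.congr_fun this j
  simpa [mul_comm] using h3

/-! ### Burch index of minimal Cohen presentations -/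

section Presentation

theorem embDim_completion (A : Type u) [CommRing A] [IsLocalRing A] [IsNoetherianRing A]
    [IsNoetherianRing (LocalCompletion A)] : embDim (LocalCompletion A) = embDim A := by
  rw [embDim_eq_spanFinrank, embDim_eq_spanFinrank, AdicCompletion.spanFinrank_maximalIdeal_eq]

variable {A : Type u} [CommRing A] [IsLocalRing A] [IsNoetherianRing A]

theorem MinimalCohenPresentation.isNoetherianRing
    (P : MinimalCohenPresentation (LocalCompletion A)) : IsNoetherianRing (LocalCompletion A) :=
  isNoetherianRing_of_surjective _ _ P.map P.surjective

theorem MinimalCohenPresentation.embDim_eq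
    (P : MinimalCohenPresentation (LocalCompletion A)) : embDim P.S = embDim A := by
  have := P.isNoetherianRing
  rw [P.minimal, embDim_completion]

theorem MinimalCohenPresentation.ker_le
    (P : MinimalCohenPresentation (LocalCompletion A)) :
    RingHom.ker P.map ≤ maximalIdeal P.S ^ 2 := by
  have := P.isNoetherianRing
  exact ker_le_sq_of_embDim_eq P.surjective P.minimal

theorem burchIndexDepthZero_le_embDim (A : Type u) [CommRing A] [IsLocalRing A]
    [IsNoetherianRing A] : burchIndexDepthZero A ≤ embDim A :=
  iSup_le fun P => by
    rw [← P.embDim_eq]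
    exact Nat.cast_le.2 (relBurchIndex_le_embDim _)

/-- An element s of I : 𝔫 maps to the socle of the completion, which by flatness is generated by the
socle of A. So s·e_k becomes a Koszul boundary, which lifts to a boundary v over the presenting
ring. The entries of s·e_k - v lie in I, and the Koszul differential, which kills v, gives y_k·s ∈
I𝔫. -/
theorem relBurchIndex_eq_zero_of_ker_eq_span {B : Type u} [CommRing B] [IsLocalRing B]
    [IsNoetherianRing B] {g : B →+* A} (hg : Function.Surjective g) {x : B}
    (hk : RingHom.ker g = Ideal.span {x})
    (hx : x ∈ maximalIdeal B ^ 2) (hreg : IsSMulRegular B x)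
    (hnp : ∀ m : B, maximalIdeal B ≠ Ideal.span {m})
    (P : MinimalCohenPresentation (LocalCompletion A)) :
    relBurchIndex P.S (RingHom.ker P.map) = 0 := by
  have hN := P.isNoetherianRing
  obtain ⟨a, ha⟩ := exists_span_range_eq_maximalIdeal B
  choose y hy using fun i => P.surjective (algebraMap A (LocalCompletion A) (g (a i)))
  have hga : Ideal.span (Set.range (g ∘ a)) = maximalIdeal A := by
    rw [Set.range_comp, ← Ideal.map_span, ha, map_maximalIdeal_of_surjective hg]
  have hcomp : P.map ∘ y = algebraMap A (LocalCompletion A) ∘ (g ∘ a) := funext hy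
  have hyspan : Ideal.span (Set.range y) = maximalIdeal P.S := by
    refine span_range_eq_of_ker_le_sq P.surjective P.ker_le ?_
    rw [hcomp, Set.range_comp, ← Ideal.map_span, hga, AdicCompletion.maximalIdeal_eq_map]
  refine relBurchIndex_eq_zero ?_
  rw [← hyspan, Ideal.span_le]
  rintro _ ⟨k, rfl⟩
  refine mem_burchIdeal_iff.2 fun s hs => ?_
  have hsoc : P.map s ∈ Ideal.span (algebraMap A (LocalCompletion A) ''
      {t | ∀ i, t * (g ∘ a) i = 0}) := by
    refine mem_span_of_flat_of_mul_eq_zero _ fun i => ?_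
    rw [Function.comp_apply, ← hy, ← map_mul]
    exact hs _ (hyspan ▸ Ideal.subset_span ⟨i, rfl⟩)
  have hle : Ideal.span (algebraMap A (LocalCompletion A) '' {t | ∀ i, t * (g ∘ a) i = 0}) ≤
      (koszulBoundary (P.map ∘ y)).comap
        (LinearMap.toSpanSingleton (LocalCompletion A) _ (Pi.single k 1)) := by
    refine Ideal.span_le.2 ?_
    rintro _ ⟨t, ht, rfl⟩
    obtain ⟨t, rfl⟩ := hg t
    have h1 := smul_single_mem_koszulBoundary_of_socle (s := t) hk hx hreg hnp ha (fun b hb => by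
      rw [← hk, RingHom.mem_ker]
      have hle' : maximalIdeal B ≤ Submodule.comap (LinearMap.mulLeft B t) (RingHom.ker g) := by
        rw [← ha, Ideal.span_le]
        rintro _ ⟨i, rfl⟩
        change g (t * a i) = 0
        rw [map_mul]
        exact ht i
      exact hle' hb) k
    have h2 := comp_mem_koszulBoundary (algebraMap A (LocalCompletion A)) h1
    rw [hcomp]
    rw [SetLike.mem_coe, Submodule.mem_comap, LinearMap.toSpanSingleton_apply]
    have h6 : algebraMap A (LocalCompletion A) (g t) •
        (Pi.single k 1 : Fin (embDim B) → LocalCompletion A) =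
          algebraMap A (LocalCompletion A) ∘ (g t • Pi.single k 1) := by
      ext1 j
      by_cases hj : j = k
      · subst hj; simp
      · simp [hj]
    rwa [h6]
  obtain ⟨v, hv, hv'⟩ := exists_mem_koszulBoundary_comp_eq P.surjective (hle hsoc)
  have h3 := sum_mul_eq_zero_of_mem_koszulBoundary hv
  have h4 : y k * s = ∑ i, (s * (Pi.single k 1 : Fin _ → P.S) i - v i) * y i := by
    simp only [sub_mul, Finset.sum_sub_distrib, h3, sub_zero]
    simp [Pi.single_apply, mul_comm]
  rw [h4]
  refine sum_mem fun i _ => Ideal.mul_mem_mul ?_ (hyspan ▸ Ideal.subset_span ⟨i, rfl⟩)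
  have h5 := congrFun hv' i
  rw [RingHom.mem_ker, map_sub, sub_eq_zero, map_mul]
  simp only [Function.comp_apply, LinearMap.toSpanSingleton_apply, Pi.smul_apply, smul_eq_mul] at h5
  rw [h5]
  simp [Pi.single_apply, apply_ite P.map]

end Presentation

/-! ### Completions: Noetherianity, induced maps, regularity -/

/-- A ring `C` which is complete for the `J`-adic topology is Noetherian as soon as `C/xC` is
Noetherian for some `x ∈ J`. -/
theorem isNoetherianRing_of_isAdicComplete_of_quotient_span_singleton {C : Type u} [CommRing C]
    {J : Ideal C} [IsAdicComplete J C] {x : C} (hx : x ∈ J)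
    [IsNoetherianRing (C ⧸ Ideal.span {x})] : IsNoetherianRing C := by
  -- By Cohen's theorem primes suffice. Generators of P modulo x are lifted to `p`; they generate P
  -- together with x if x ∈ P, and on their own otherwise.
  refine IsNoetherianRing.of_prime fun P hP => ?_
  obtain ⟨s, hs, hspan⟩ := (Submodule.fg_iff_exists_fin_generating_family.1
    (IsNoetherian.noetherian (P.map (Ideal.Quotient.mk (Ideal.span {x})))))
  have hs' : ∀ i, ∃ p ∈ P, Ideal.Quotient.mk (Ideal.span {x}) p = hs i := fun i =>
    (Ideal.mem_map_iff_of_surjective _ Ideal.Quotient.mk_surjective).1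
      (hspan ▸ Submodule.subset_span ⟨i, rfl⟩)
  choose p hpP hp using hs'
  have hrep : ∀ q ∈ P, ∃ (a : Fin s → C) (c : C), q = ∑ i, a i * p i + x * c := by
    intro q hq
    have h1 : Ideal.Quotient.mk (Ideal.span {x}) q ∈ Submodule.span _ (Set.range hs) :=
      hspan ▸ Ideal.mem_map_of_mem _ hq
    obtain ⟨a, ha⟩ := (Submodule.mem_span_range_iff_exists_fun _).1 h1
    choose b hb using fun i => Ideal.Quotient.mk_surjective (a i)
    have h2 : Ideal.Quotient.mk (Ideal.span {x}) (q - ∑ i, b i * p i) = 0 := by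
      rw [map_sub, map_sum, ← ha]
      simp [hb, hp]
    obtain ⟨c, hc⟩ := Ideal.mem_span_singleton'.1 (Ideal.Quotient.eq_zero_iff_mem.1 h2)
    exact ⟨b, c, by rw [mul_comm x, hc]; ring⟩
  have hpsum : ∀ a : Fin s → C, ∑ i, a i * p i ∈ Ideal.span (Set.range p) := fun a =>
    sum_mem fun i _ => Ideal.mul_mem_left _ _ (Ideal.subset_span ⟨i, rfl⟩)
  have hple : Ideal.span (Set.range p) ≤ P := Ideal.span_le.2 (by rintro _ ⟨i, rfl⟩; exact hpP i)
  by_cases hxP : x ∈ P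
  · have : P = Ideal.span (insert x (Set.range p)) := by
      refine le_antisymm (fun q hq => ?_) ?_
      · obtain ⟨a, c, rfl⟩ := hrep q hq
        refine add_mem (Ideal.span_mono (Set.subset_insert _ _) (hpsum a))
          (Ideal.mul_mem_right _ _ (Ideal.subset_span (Set.mem_insert _ _)))
      · rw [Ideal.span_le]
        rintro _ (rfl | ⟨i, rfl⟩)
        exacts [hxP, hpP i]
    rw [this]
    exact Submodule.fg_span ((Set.finite_range p).insert x)
  · have : P = Ideal.span (Set.range p) := by
      refine le_antisymm (fun q hq => ?_) hple
      -- Since x ∉ P, the cofactor of x is again in P, so the representation can be iterated; the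
      -- coefficients converge by completeness.
      have hrep' : ∀ q : P, ∃ (a : Fin s → C) (c : P), (q : C) = ∑ i, a i * p i + x * c := by
        rintro ⟨q, hq⟩
        obtain ⟨a, c, h⟩ := hrep q hq
        refine ⟨a, ⟨c, ?_⟩, h⟩
        have : x * c ∈ P := by
          rw [eq_sub_of_add_eq' h.symm]
          exact sub_mem hq (hple (hpsum a))
        exact (hP.mem_or_mem this).resolve_left hxP
      choose a c hac using hrep'
      let r : ℕ → P := fun n => c^[n] ⟨q, hq⟩
      have hr : ∀ n, r (n + 1) = c (r n) := fun n => Function.iterate_succ_apply' c n _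
      let A : ℕ → Fin s → C := fun n i => ∑ k ∈ Finset.range n, x ^ k * a (r k) i
      have hA : ∀ n, q = ∑ i, A n i * p i + x ^ n * r n := by
        intro n
        induction n with
        | zero => simp [A, r]
        | succ n ih =>
          rw [hr]
          have h1 : ∑ i, A (n + 1) i * p i =
              ∑ i, A n i * p i + x ^ n * ∑ i, a (r n) i * p i := by
            rw [Finset.mul_sum, ← Finset.sum_add_distrib]
            refine Finset.sum_congr rfl fun i _ => ?_
            simp only [A, Finset.sum_range_succ]
            ring
          rw [h1]
          nth_rewrite 1 [ih]
          rw [hac (r n)]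
          ring
      have hlim : ∀ i, ∃ L : C, ∀ n, A n i ≡ L [SMOD (J ^ n • ⊤ : Submodule C C)] := by
        intro i
        refine IsPrecomplete.prec (I := J) inferInstance fun {m n} hmn => ?_
        rw [SModEq.sub_mem, ← neg_mem_iff, neg_sub, smul_eq_mul, Ideal.mul_top]
        simp only [A]
        rw [← Finset.sum_range_add_sum_Ico _ hmn, add_sub_cancel_left]
        refine sum_mem fun k hk => Ideal.mul_mem_right _ _ ?_
        exact Ideal.pow_le_pow_right (Finset.mem_Ico.1 hk).1 (Ideal.pow_mem_pow hx k)
      choose L hL using hlim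
      have : q = ∑ i, L i * p i := by
        refine sub_eq_zero.1 (IsHausdorff.haus (I := J) inferInstance _ fun n => ?_)
        rw [SModEq.zero, smul_eq_mul, Ideal.mul_top]
        nth_rewrite 1 [hA n]
        have : ∑ i, A n i * p i + x ^ n * r n - ∑ i, L i * p i =
            ∑ i, (A n i - L i) * p i + x ^ n * r n := by
          simp only [sub_mul, Finset.sum_sub_distrib]
          ring
        rw [this]
        refine add_mem (sum_mem fun i _ => Ideal.mul_mem_right _ _ ?_)
          (Ideal.mul_mem_right _ _ (Ideal.pow_mem_pow hx n))
        have := hL i n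
        rwa [SModEq.sub_mem, smul_eq_mul, Ideal.mul_top] at this
      rw [this]
      exact hpsum L
    rw [this]
    exact Submodule.fg_span (Set.finite_range p)

section CompletionMap

variable {S A : Type u} [CommRing S] [IsLocalRing S] [CommRing A] [IsLocalRing A]

theorem pow_maximalIdeal_le_comap {f : S →+* A} (hf : Function.Surjective f) (n : ℕ) :
    maximalIdeal S ^ n ≤ (maximalIdeal A ^ n).comap f := by
  rw [← Ideal.map_le_iff_le_comap, Ideal.map_pow, map_maximalIdeal_of_surjective hf]

theorem factorPow_comp_quotientMap_comp_evalₐ {f : S →+* A} (hf : Function.Surjective f) {m n : ℕ}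
    (hmn : m ≤ n) : (Ideal.Quotient.factorPow (maximalIdeal A) hmn).comp
      ((Ideal.quotientMap (maximalIdeal A ^ n) f (pow_maximalIdeal_le_comap hf n)).comp
        (AdicCompletion.evalₐ (maximalIdeal S) n : LocalCompletion S →+* _)) =
      (Ideal.quotientMap (maximalIdeal A ^ m) f (pow_maximalIdeal_le_comap hf m)).comp
        (AdicCompletion.evalₐ (maximalIdeal S) m : LocalCompletion S →+* _) := by
  ext b
  obtain ⟨b, rfl⟩ := AdicCompletion.mk_surjective _ _ b
  simp only [RingHom.comp_apply, RingHom.coe_coe, AdicCompletion.evalₐ_mk, Ideal.quotientMap_mk]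
  have h1 := congrArg (Ideal.quotientMap (maximalIdeal A ^ m) f (pow_maximalIdeal_le_comap hf m))
    (AdicCompletion.Ideal.mk_eq_mk _ hmn b)
  rwa [Ideal.quotientMap_mk, Ideal.quotientMap_mk] at h1

/-- The map on completions induced by a surjective homomorphism of local rings. -/
noncomputable def completionMap (f : S →+* A) (hf : Function.Surjective f) :
    LocalCompletion S →+* LocalCompletion A :=
  AdicCompletion.liftRingHom (maximalIdeal A)
    (fun n => (Ideal.quotientMap (maximalIdeal A ^ n) f (pow_maximalIdeal_le_comap hf n)).comp
        (AdicCompletion.evalₐ (maximalIdeal S) n : LocalCompletion S →+* _))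
    (factorPow_comp_quotientMap_comp_evalₐ hf)

variable {f : S →+* A} (hf : Function.Surjective f)

theorem evalₐ_completionMap (n : ℕ) (b : LocalCompletion S) :
    AdicCompletion.evalₐ (maximalIdeal A) n (completionMap f hf b) =
      Ideal.quotientMap (maximalIdeal A ^ n) f (pow_maximalIdeal_le_comap hf n)
        (AdicCompletion.evalₐ (maximalIdeal S) n b) :=
  AdicCompletion.evalₐ_liftRingHom _ _ (factorPow_comp_quotientMap_comp_evalₐ hf) _ _

theorem completionMap_algebraMap (s : S) :
    completionMap f hf (algebraMap S (LocalCompletion S) s) =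
      algebraMap A (LocalCompletion A) (f s) := by
  refine AdicCompletion.ext_evalₐ fun n => ?_
  rw [evalₐ_completionMap]
  simp [AdicCompletion.algebraMap_apply]

variable [IsNoetherianRing S] [IsNoetherianRing A]

/-- The source is complete and the target separated, so surjectivity can be tested modulo the
maximal ideal, where the elements coming from S suffice. -/
theorem completionMap_surjective : Function.Surjective (completionMap f hf) := by
  have hmap : (maximalIdeal (LocalCompletion S)).map (completionMap f hf) =
      maximalIdeal (LocalCompletion A) := by
    rw [AdicCompletion.maximalIdeal_eq_map, AdicCompletion.maximalIdeal_eq_map]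
    conv_rhs => arg 2; rw [← map_maximalIdeal_of_surjective hf]
    rw [Ideal.map_map, Ideal.map_map]
    exact congrArg (Ideal.map · _) (RingHom.ext (completionMap_algebraMap hf))
  have : IsHausdorff ((maximalIdeal (LocalCompletion S)).map (completionMap f hf))
      (LocalCompletion A) := by
    rw [hmap]; infer_instance
  refine surjective_of_mk_map_comp_surjective (I := maximalIdeal (LocalCompletion S)) _ fun y => ?_
  obtain ⟨y, rfl⟩ := Ideal.Quotient.mk_surjective y
  obtain ⟨a, ha⟩ := (AdicCompletion.residueField_map_bijective A).2 (residue _ y)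
  obtain ⟨a, rfl⟩ := residue_surjective a
  obtain ⟨s, rfl⟩ := hf a
  rw [ResidueField.map_residue, ← sub_eq_zero, ← map_sub, residue_eq_zero_iff] at ha
  refine ⟨algebraMap S _ s, ?_⟩
  rw [RingHom.comp_apply, completionMap_algebraMap, Ideal.Quotient.mk_eq_mk_iff_sub_mem, hmap]
  exact ha

/-- Completion is exact on finite modules, so the kernel is the completion of `ker f`, a quotient of
Ŝ ⊗ ker f. -/
theorem ker_completionMap : RingHom.ker (completionMap f hf) =
    (RingHom.ker f).map (algebraMap S (LocalCompletion S)) := by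
  refine le_antisymm (fun b hb => ?_) ?_
  · have hex := AdicCompletion.map_exact (I := maximalIdeal S)
      (f := (RingHom.ker f).subtype) (g := (RingHom.ker f).mkQ)
      (Submodule.subtype_injective _)
      (LinearMap.exact_subtype_mkQ _) (Submodule.mkQ_surjective _)
    obtain ⟨c, rfl⟩ := (hex b).1 (by
      ext n
      obtain ⟨b, rfl⟩ := AdicCompletion.mk_surjective _ _ b
      have h1 : AdicCompletion.evalₐ (maximalIdeal A) n (completionMap f hf
        (AdicCompletion.mk _ _ b)) = 0 := by rw [RingHom.mem_ker.1 hb, map_zero]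
      rw [evalₐ_completionMap, AdicCompletion.evalₐ_mk, Ideal.quotientMap_mk,
        Ideal.Quotient.eq_zero_iff_mem] at h1
      obtain ⟨u, hu, k, hk, huk⟩ := Submodule.mem_sup.1
        (mem_sup_ker_of_map_mem hf (maximalIdeal_pow_map_of_surjective hf n ▸ h1))
      change Submodule.Quotient.mk ((RingHom.ker f).mkQ (b n)) = 0
      rw [Submodule.Quotient.mk_eq_zero, ← huk, map_add,
        show (RingHom.ker f).mkQ k = 0 from (Submodule.Quotient.mk_eq_zero _).2 hk, add_zero, ← mul_one u,
        ← smul_eq_mul, map_smul]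
      exact Submodule.smul_mem_smul hu trivial)
    obtain ⟨t, rfl⟩ := AdicCompletion.ofTensorProduct_surjective_of_finite (maximalIdeal S)
      (RingHom.ker f) c
    clear hb
    induction t with
    | zero => simp
    | add x y hx hy =>
      rw [map_add, map_add]
      exact add_mem hx hy
    | tmul r k =>
      rw [AdicCompletion.ofTensorProduct_tmul, map_smul, smul_eq_mul, AdicCompletion.map_of]
      exact Ideal.mul_mem_left _ _ (Ideal.mem_map_of_mem _ k.2)
  · rw [Ideal.map_le_iff_le_comap]
    intro s hs
    rw [Ideal.mem_comap, RingHom.mem_ker, completionMap_algebraMap, RingHom.mem_ker.1 hs, map_zero]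

end CompletionMap

/-- Induction on the embedding dimension: for x ∈ 𝔪 outside 𝔪², the completion of A/x is Â/x by
`ker_completionMap`, and completeness lifts Noetherianity from Â/x to Â. -/
instance isNoetherianRing_localCompletion (A : Type u) [CommRing A] [IsLocalRing A]
    [IsNoetherianRing A] : IsNoetherianRing (LocalCompletion A) := by
  obtain ⟨n, hn⟩ : ∃ n, embDim A = n := ⟨_, rfl⟩
  induction n generalizing A with
  | zero =>
    have hA : IsField A := finrank_cotangentSpace_eq_zero_iff.1 hn
    have hA' : maximalIdeal (LocalCompletion A) = ⊥ := by
      rw [eq_bot_iff, AdicCompletion.maximalIdeal_eq_map, Ideal.map_le_iff_le_comap]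
      intro a ha
      rw [isField_iff_maximalIdeal_eq.1 hA] at ha
      simp [(Submodule.mem_bot A).1 ha]
    let := (isField_iff_maximalIdeal_eq.2 hA').toField
    infer_instance
  | succ n ih =>
    obtain ⟨x, hxm, hx2, -⟩ := exists_mem_notMem_sq_notMem_minimalPrimes
      (S := A) (T := ∅) Set.finite_empty (by simp) (by simp) (by lia)
    have hloc : IsLocalRing (A ⧸ Ideal.span {x}) :=
      isLocalRing_quotient_of_le ((Ideal.span_singleton_le_iff_mem _).2 hxm)
    have hf := Ideal.Quotient.mk_surjective (I := Ideal.span {x})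
    have hk : RingHom.ker (Ideal.Quotient.mk (Ideal.span {x})) = Ideal.span {x} := Ideal.mk_ker
    have hN := ih (A ⧸ Ideal.span {x}) (by
      have := embDim_add_one_eq_of_ker_eq_span hf hk hx2
      lia)
    have hker := ker_completionMap hf
    rw [hk, Ideal.map_span, Set.image_singleton] at hker
    have e := RingHom.quotientKerEquivOfSurjective (completionMap_surjective hf)
    have := isNoetherianRing_of_ringEquiv _ ((Ideal.quotEquivOfEq hker.symm).trans e).symm
    refine isNoetherianRing_of_isAdicComplete_of_quotient_span_singleton
      (J := maximalIdeal (LocalCompletion A)) (x := algebraMap A (LocalCompletion A) x) ?_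
    rw [AdicCompletion.maximalIdeal_eq_map]
    exact Ideal.mem_map_of_mem _ hxm

theorem ringDepth_localCompletion (A : Type u) [CommRing A] [IsLocalRing A]
    [IsNoetherianRing A] : ringDepth (LocalCompletion A) = ringDepth A :=
  (ringDepth_eq_of_flat (R := A) AdicCompletion.maximalIdeal_eq_map.symm).symm

/-- dim ≥ depth = edim, as completion changes neither depth nor embedding dimension. -/
instance isRegularLocalRing_localCompletion (S : Type u) [CommRing S] [IsRegularLocalRing S] :
    IsRegularLocalRing (LocalCompletion S) := by
  apply isRegularLocalRing_of_embDim_le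
  rw [embDim_completion]
  have h1 := ringDepth_le_ringKrullDim (R := LocalCompletion S)
  rwa [ringDepth_localCompletion, ringDepth_eq_embDim] at h1

/-- A surjection from a regular local ring of the same embedding dimension induces a minimal Cohen
presentation of the completion. -/
noncomputable def minimalCohenPresentationOfSurjective {S A : Type u} [CommRing S]
    [IsRegularLocalRing S] [CommRing A] [IsLocalRing A] [IsNoetherianRing A] {f : S →+* A}
    (hf : Function.Surjective f) (h : embDim S = embDim A) :
    MinimalCohenPresentation (LocalCompletion A) where
  S := LocalCompletion S
  map := completionMap f hf
  surjective := completionMap_surjective hf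
  minimal := by rw [embDim_completion, embDim_completion, h]

/-- A quotient of a regular local ring is a quotient of a regular local ring of the same embedding
dimension. -/
theorem exists_isRegularLocalRing_surjective_embDim_eq {S A : Type u} [CommRing S]
    [IsRegularLocalRing S] [CommRing A] [IsLocalRing A] [IsNoetherianRing A] {f : S →+* A}
    (hf : Function.Surjective f) :
    ∃ (T : Type u) (_ : CommRing T) (_ : IsRegularLocalRing T) (g : T →+* A),
      Function.Surjective g ∧ embDim T = embDim A := by
  obtain ⟨n, hn⟩ : ∃ n, embDim S = n := ⟨_, rfl⟩
  induction n generalizing S with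
  | zero => exact ⟨S, _, ‹_›, f, hf, le_antisymm (by lia) (embDim_le_of_surjective hf)⟩
  | succ n ih =>
    by_cases h : RingHom.ker f ≤ maximalIdeal S ^ 2
    · exact ⟨S, _, ‹_›, f, hf, embDim_eq_of_ker_le_sq hf h⟩
    · obtain ⟨x, hxk, hx2⟩ := SetLike.not_le_iff_exists.1 h
      have hle : Ideal.span {x} ≤ RingHom.ker f := (Ideal.span_singleton_le_iff_mem _).2 hxk
      have hloc : IsLocalRing (S ⧸ Ideal.span {x}) :=
        isLocalRing_quotient_of_le (hle.trans (ker_le_maximalIdeal f))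
      have hk : RingHom.ker (Ideal.Quotient.mk (Ideal.span {x})) = Ideal.span {x} := Ideal.mk_ker
      have hreg := isRegularLocalRing_of_ker_eq_span Ideal.Quotient.mk_surjective hk hx2
      refine ih (f := Ideal.Quotient.lift (Ideal.span {x}) f fun a ha => hle ha)
        (Ideal.Quotient.lift_surjective_of_surjective _ _ hf) ?_
      have := embDim_add_one_eq_of_ker_eq_span Ideal.Quotient.mk_surjective hk hx2
      lia

/-! ### Coefficient fields and lifting along square-zero extensions -/

section SquareZeroLifting

/-- Let `q : E → k` be a surjection from a ring of characteristic `p` onto a field whose kernel has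
square zero. Then `E` contains a coefficient field. -/
theorem exists_subring_bijective_of_charP {E k : Type*} [CommRing E] [Field k] {p : ℕ}
    [hp : Fact p.Prime] [CharP E p] (q : E →+* k) (hq : Function.Surjective q)
    (h2 : ∀ a b, q a = 0 → q b = 0 → a * b = 0) :
    ∃ L : Subring E, Function.Bijective (q.comp L.subtype) := by
  have hpk : CharP k p := (CharP.charP_iff_prime_eq_zero hp.out).2
    (by rw [← map_natCast q, CharP.cast_eq_zero, map_zero])
  let L₀ : Subring E := (frobenius E p).range
  let T : Set (Subring E) := {L | L₀ ≤ L ∧ ∀ a ∈ L, q a = 0 → a = 0}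
  -- The p-th powers meet the kernel trivially: q(e^p) = 0 gives q(e) = 0, so e² = 0, and p ≥ 2.
  have hL₀ : L₀ ∈ T := by
    refine ⟨le_rfl, ?_⟩
    rintro _ ⟨e, rfl⟩ he
    rw [frobenius_def, map_pow] at he
    have he' : q e = 0 := pow_eq_zero_iff hp.out.ne_zero |>.1 he
    have h := h2 e e he' he'
    rw [frobenius_def, ← Nat.add_sub_cancel' hp.out.two_le, pow_add, pow_two, h, zero_mul]
  obtain ⟨L, hL₀L, hLT, hmax⟩ := zorn_le_nonempty₀ T (fun c hc hchain y hy => by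
    have hdir := hchain.directedOn
    refine ⟨sSup c, ⟨(hc hy).1.trans (le_sSup hy), fun a ha => ?_⟩, fun z hz => le_sSup hz⟩
    obtain ⟨s, hs, has⟩ := (Subring.mem_sSup_of_directedOn ⟨y, hy⟩ hdir).1 ha
    exact (hc hs).2 a has) L₀ hL₀
  have hinj : Function.Injective (q.comp L.subtype) := by
    rw [injective_iff_map_eq_zero]
    rintro ⟨a, ha⟩ h
    exact Subtype.ext (hLT.2 a ha h)
  refine ⟨L, hinj, ?_⟩
  have hpow : ∀ e : E, e ^ p ∈ L := fun e => hL₀L ⟨e, rfl⟩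
  -- The image of L is a field, since 1/l = l^(p-1)·(1/l)^p and L contains all p-th powers.
  let M : Subfield k :=
    { (q.comp L.subtype).range with
      inv_mem' := by
        rintro _ ⟨l, rfl⟩
        obtain ⟨e, he⟩ := hq (q l)⁻¹
        refine ⟨l ^ (p - 1) * ⟨e ^ p, hpow e⟩, ?_⟩
        by_cases h0 : q l = 0
        · have : l = 0 := hinj (by simpa using h0)
          simp [this, (Nat.sub_pos_of_lt hp.out.one_lt).ne']
        · have h3 : q l ^ p = q l ^ (p - 1) * q l := by
            rw [← pow_succ, Nat.sub_add_cancel hp.out.one_le]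
          simp only [RingHom.comp_apply, Subring.subtype_apply, map_mul, map_pow, he]
          simp
          field_simp
          exact h3.symm }
  have hM : ∀ l : L, q l ∈ M := fun l => ⟨l, rfl⟩
  let qM : L →+* M := (q.comp L.subtype).codRestrict M hM
  have : Nontrivial L := (q.comp L.subtype).domain_nontrivial
  intro y
  by_contra hy
  obtain ⟨θ, rfl⟩ := hq y
  -- θ^p has no p-th root in M, so X^p - θ^p is the minimal polynomial, and adjoining θ to L still
  -- avoids the kernel.
  have hθ : ∀ b : M, b ^ p ≠ qM ⟨θ ^ p, hpow θ⟩ := by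
    intro b hb
    have h3 : (b : k) ^ p = q θ ^ p := by
      have h3' := congrArg (Subtype.val : M → k) hb
      change (b : k) ^ p = q (θ ^ p) at h3'
      rw [h3', map_pow]
    have h4 : (b : k) = q θ := frobenius_inj k p h3
    obtain ⟨l, hl⟩ := b.2
    exact hy ⟨l, hl.trans h4⟩
  have hirr := X_pow_sub_C_irreducible_of_prime hp.out hθ
  have hdeg : (minpoly M (q θ)) = X ^ p - C (qM ⟨θ ^ p, hpow θ⟩) := by
    refine (minpoly.eq_of_irreducible_of_monic hirr ?_ (monic_X_pow_sub_C _ hp.out.ne_zero)).symm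
    rw [map_sub, map_pow, aeval_X, aeval_C, sub_eq_zero, ← map_pow]
    rfl
  let L' : Subring E := (eval₂RingHom L.subtype θ).range
  have hLL' : L ≤ L' := fun l hl => ⟨C ⟨l, hl⟩, by simp⟩
  have hL' : L' ∈ T := by
    refine ⟨hL₀L.trans hLL', ?_⟩
    rintro _ ⟨G, rfl⟩ hG
    have hmon : (X ^ p - C (⟨θ ^ p, hpow θ⟩ : L)).Monic := monic_X_pow_sub_C _ hp.out.ne_zero
    set G' := G %ₘ (X ^ p - C (⟨θ ^ p, hpow θ⟩ : L)) with hG'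
    have heval : eval₂ L.subtype θ G = eval₂ L.subtype θ G' := by
      conv_lhs => rw [← modByMonic_add_div G (X ^ p - C (⟨θ ^ p, hpow θ⟩ : L))]
      simp [eval₂_add, eval₂_mul, ← hG']
    rw [coe_eval₂RingHom, heval] at hG ⊢
    have h5 : aeval (q θ) (G'.map qM) = 0 := by
      rw [aeval_def, eval₂_map]
      rw [Polynomial.hom_eval₂] at hG
      exact hG
    have h6 : G'.map qM = 0 := by
      by_contra h
      have h7 := minpoly.degree_le_of_ne_zero M (q θ) h h5
      rw [hdeg, degree_X_pow_sub_C hp.out.pos] at h7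
      have h8 := (degree_map_le (f := qM) (p := G')).trans_lt
        (degree_modByMonic_lt G hmon)
      rw [degree_X_pow_sub_C hp.out.pos] at h8
      exact absurd (h7.trans_lt h8) (lt_irrefl _)
    have hqM : Function.Injective qM := fun a b hab => hinj (congrArg (Subtype.val : M → k) hab)
    rw [(Polynomial.map_eq_zero_iff hqM).1 h6, eval₂_zero]
  exact hy ⟨⟨θ, hmax hL' hLL' ⟨X, by simp⟩⟩, rfl⟩

/-- Let `V` be a `p`-torsion free ring such that `V/pV` is a field. Then ring homomorphisms from
`V` lift along square zero surjections whose kernel is killed by `p`. -/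
theorem exists_lift_of_torsionFree {V A B : Type*} [CommRing V] [CommRing A] [CommRing B] {p : ℕ}
    [hp : Fact p.Prime] (hV : ∀ v : V, (p : V) * v = 0 → v = 0)
    (hmax : (Ideal.span {(p : V)}).IsMaximal) {π : A →+* B} (hπ : Function.Surjective π)
    (h2 : ∀ a b, π a = 0 → π b = 0 → a * b = 0) (hpk : ∀ a, π a = 0 → (p : A) * a = 0)
    (g : V →+* B) : ∃ g' : V →+* A, π.comp g' = g := by
  -- The fibre product V ×_B A; a section of its projection to V is a lift of g.
  let E : Subring (V × A) := (g.comp (RingHom.fst V A)).eqLocus (π.comp (RingHom.snd V A))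
  have hE : ∀ e : E, g (e : V × A).1 = π (e : V × A).2 := fun e => e.2
  let fE : E →+* V := (RingHom.fst V A).comp E.subtype
  have hfE : Function.Surjective fE := fun v => by
    obtain ⟨a, ha⟩ := hπ (g v)
    exact ⟨⟨(v, a), ha.symm⟩, rfl⟩
  let := Ideal.Quotient.field (Ideal.span {(p : V)})
  let q : E ⧸ Ideal.span {(p : E)} →+* V ⧸ Ideal.span {(p : V)} :=
    Ideal.quotientMap _ fE (by
      rw [Ideal.span_singleton_le_iff_mem, Ideal.mem_comap, map_natCast]
      exact Ideal.mem_span_singleton_self _)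
  have hq : Function.Surjective q := Ideal.quotientMap_surjective hfE
  have hpE : ((p : ℕ) : E ⧸ Ideal.span {(p : E)}) = 0 := by
    rw [← map_natCast (Ideal.Quotient.mk _), Ideal.Quotient.eq_zero_iff_mem]
    exact Ideal.mem_span_singleton_self _
  have : Nontrivial (E ⧸ Ideal.span {(p : E)}) := q.domain_nontrivial
  have : CharP (E ⧸ Ideal.span {(p : E)}) p := (CharP.charP_iff_prime_eq_zero hp.out).2 hpE
  have hkey : ∀ e : E, q (Ideal.Quotient.mk _ e) = 0 → ∃ (n : E) (e' : E), fE n = 0 ∧ e = n + p * e' := by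
    intro e he
    rw [Ideal.quotientMap_mk, Ideal.Quotient.eq_zero_iff_mem] at he
    obtain ⟨v, hv⟩ := Ideal.mem_span_singleton'.1 he
    obtain ⟨e', rfl⟩ := hfE v
    exact ⟨e - p * e', e', by rw [map_sub, map_mul, map_natCast, ← hv]; ring, by ring⟩
  have hsq : ∀ m n : E, fE m = 0 → fE n = 0 → m * n = 0 := by
    intro m n hm hn
    have hm' : π (m : V × A).2 = 0 := by rw [← hE, show (m : V × A).1 = 0 from hm, map_zero]
    have hn' : π (n : V × A).2 = 0 := by rw [← hE, show (n : V × A).1 = 0 from hn, map_zero]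
    refine Subtype.ext (Prod.ext ?_ (h2 _ _ hm' hn'))
    change (m : V × A).1 * (n : V × A).1 = 0
    rw [show (m : V × A).1 = 0 from hm, zero_mul]
  -- E/pE has characteristic p and maps onto V/pV with square-zero kernel.
  obtain ⟨L, hLinj, hLsurj⟩ := exists_subring_bijective_of_charP (p := p) q hq (by
    intro a b ha hb
    obtain ⟨a, rfl⟩ := Ideal.Quotient.mk_surjective a
    obtain ⟨b, rfl⟩ := Ideal.Quotient.mk_surjective b
    obtain ⟨m, m', hm, rfl⟩ := hkey a ha
    obtain ⟨n, n', hn, rfl⟩ := hkey b hb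
    rw [map_add, map_add, map_mul, map_mul, map_natCast, hpE, zero_mul, zero_mul, add_zero,
      add_zero, ← map_mul, hsq m n hm hn, map_zero])
  -- The preimage of the coefficient field maps isomorphically to V: injectively because V has no
  -- p-torsion and p kills ker π, surjectively because it contains pE.
  let V' : Subring E := L.comap (Ideal.Quotient.mk (Ideal.span {(p : E)}))
  have hpV' : ∀ e : E, (p : E) * e ∈ V' := fun e => by
    rw [Subring.mem_comap, map_mul, map_natCast, hpE, zero_mul]
    exact L.zero_mem
  have hbij : Function.Bijective (fE.comp V'.subtype) := by
    constructor
    · rw [injective_iff_map_eq_zero]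
      rintro ⟨e, he⟩ h0
      have h0' : fE e = 0 := h0
      have h3 : (⟨Ideal.Quotient.mk _ e, he⟩ : L) = 0 := hLinj (by
        change q (Ideal.Quotient.mk _ e) = q 0
        rw [Ideal.quotientMap_mk, h0', map_zero, map_zero])
      obtain ⟨e', he'⟩ := Ideal.mem_span_singleton'.1
        (Ideal.Quotient.eq_zero_iff_mem.1 (congrArg Subtype.val h3))
      have h4 : fE e' = 0 := hV _ (by rw [← h0', ← he', map_mul, map_natCast, mul_comm])
      have h5 : π (e' : V × A).2 = 0 := by rw [← hE, show (e' : V × A).1 = 0 from h4, map_zero]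
      refine Subtype.ext (Subtype.ext (Prod.ext h0' ?_))
      change (e : V × A).2 = 0
      have h6 := congrArg (fun z : E => (z : V × A).2) he'
      change (e' : V × A).2 * (p : A) = _ at h6
      rw [← h6, mul_comm, hpk _ h5]
    · intro v
      obtain ⟨⟨l, hl⟩, hlv⟩ := hLsurj (Ideal.Quotient.mk _ v)
      obtain ⟨e, rfl⟩ := Ideal.Quotient.mk_surjective l
      have h3 : Ideal.Quotient.mk (Ideal.span {(p : V)}) (v - fE e) = 0 := by
        rw [map_sub, sub_eq_zero, ← hlv]
        rfl
      obtain ⟨w, hw⟩ := Ideal.mem_span_singleton'.1 (Ideal.Quotient.eq_zero_iff_mem.1 h3)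
      obtain ⟨w, rfl⟩ := hfE w
      refine ⟨⟨e, hl⟩ + ⟨p * w, hpV' w⟩, ?_⟩
      change fE (e + p * w) = v
      rw [map_add, map_mul, map_natCast, mul_comm, hw]
      ring
  let e := RingEquiv.ofBijective _ hbij
  refine ⟨((RingHom.snd V A).comp (E.subtype.comp V'.subtype)).comp e.symm.toRingHom, ?_⟩
  ext v
  obtain ⟨w, rfl⟩ := e.surjective v
  have h3 := hE w
  simp only [RingHom.comp_apply, RingEquiv.toRingHom_eq_coe, RingHom.coe_coe,
    RingEquiv.symm_apply_apply]
  exact h3.symm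

end SquareZeroLifting

/-! ### Discrete valuation rings with uniformizer p and given residue field -/

section DiscreteValuationRing

/-- Every nonzero element is a power of `p` times a unit. -/
def IsPowMulUnit (p : ℕ) (V : Type*) [CommRing V] : Prop :=
  ∀ z : V, z ≠ 0 → ∃ (n : ℕ) (u : V), IsUnit u ∧ z = p ^ n * u

theorem IsPowMulUnit.of_surjective {p : ℕ} {V W : Type*} [CommRing V] [CommRing W]
    (h : IsPowMulUnit p V) {f : V →+* W} (hf : Function.Surjective f) : IsPowMulUnit p W := by
  intro z hz
  obtain ⟨z, rfl⟩ := hf z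
  obtain ⟨n, u, hu, rfl⟩ := h z (fun h0 => hz (by rw [h0, map_zero]))
  exact ⟨n, f u, hu.map f, by rw [map_mul, map_pow, map_natCast]⟩

theorem IsPowMulUnit.isUnit_of_ne_zero {p : ℕ} {V k : Type*} [CommRing V] [Field k] [CharP k p]
    (h : IsPowMulUnit p V) (π : V →+* k) {z : V} (hz : π z ≠ 0) : IsUnit z := by
  obtain ⟨n, u, hu, rfl⟩ := h z (fun h0 => hz (by rw [h0, map_zero]))
  cases n with
  | zero => simpa using hu
  | succ n => exact absurd (by simp) hz

theorem IsPowMulUnit.isMaximal_ker {p : ℕ} {V k : Type*} [CommRing V] [Field k] [CharP k p]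
    (h : IsPowMulUnit p V) (π : V →+* k) : (RingHom.ker π).IsMaximal :=
  Ideal.isMaximal_iff.2 ⟨by simp, fun J x _ hx hxJ => by
    rw [Ideal.eq_top_of_isUnit_mem J hxJ (h.isUnit_of_ne_zero π hx)]
    exact trivial⟩

theorem IsPowMulUnit.exists_eq_mul {p : ℕ} {V k : Type*} [CommRing V] [Field k]
    (h : IsPowMulUnit p V) (π : V →+* k) {z : V} (hz : π z = 0) : ∃ w, z = p * w := by
  by_cases h0 : z = 0
  · exact ⟨0, by simp [h0]⟩
  obtain ⟨n, u, hu, rfl⟩ := h z h0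
  cases n with
  | zero => exact absurd hz (by simpa using (hu.map π).ne_zero)
  | succ n => exact ⟨p ^ n * u, by ring⟩

theorem IsPowMulUnit.injective {p : ℕ} {V Ω : Type*} [CommRing V] [Field Ω] [CharZero Ω]
    [hp : Fact p.Prime] (h : IsPowMulUnit p V) (ι : V →+* Ω) : Function.Injective ι := by
  rw [injective_iff_map_eq_zero]
  intro z hz
  by_contra h0
  obtain ⟨n, u, hu, rfl⟩ := h z h0
  rw [map_mul, map_pow, map_natCast, mul_eq_zero] at hz
  rcases hz with hz | hz
  · exact pow_ne_zero n (Nat.cast_ne_zero.2 hp.out.ne_zero) hz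
  · exact (hu.map ι).ne_zero hz

theorem IsPowMulUnit.exists_eq_C_pow_mul {p : ℕ} {V : Type*} [CommRing V] [IsDomain V]
    (h : IsPowMulUnit p V) (hp0 : (p : V) ≠ 0) {G : V[X]} (hG : G ≠ 0) :
    ∃ (n : ℕ) (G₁ : V[X]), G = C ((p : V) ^ n) * G₁ ∧ ∃ i, IsUnit (G₁.coeff i) := by
  choose n u hu hnu using h
  obtain ⟨i₀, hi₀, hmin⟩ := G.support.attach.exists_min_image
    (fun i => n (G.coeff i) (mem_support_iff.1 i.2)) (by simpa using hG)
  have hdvd : C ((p : V) ^ n (G.coeff i₀) (mem_support_iff.1 i₀.2)) ∣ G := by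
    rw [C_dvd_iff_dvd_coeff]
    intro i
    by_cases hi : G.coeff i = 0
    · rw [hi]
      exact dvd_zero _
    · conv_rhs => rw [hnu _ hi]
      exact (pow_dvd_pow _ (hmin ⟨i, mem_support_iff.2 hi⟩ (Finset.mem_attach _ _))).mul_right _
  obtain ⟨G₁, hG₁⟩ := hdvd
  refine ⟨_, G₁, hG₁, i₀, ?_⟩
  have h1 := congrArg (fun P : V[X] => P.coeff i₀) hG₁
  simp only [coeff_C_mul] at h1
  rw [show G₁.coeff i₀ = _ from mul_left_cancel₀ (pow_ne_zero _ hp0)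
    (h1.symm.trans (hnu _ (mem_support_iff.1 i₀.2)))]
  exact hu _ _

theorem eval₂_prod {V Ω k : Type*} [CommRing V] [CommRing Ω] [CommRing k] (ι : V →+* Ω)
    (π : V →+* k) (x : Ω) (θ : k) (G : V[X]) :
    eval₂ (ι.prod π) (x, θ) G = (eval₂ ι x G, eval₂ π θ G) :=
  Prod.ext (hom_eval₂ G (ι.prod π) (RingHom.fst Ω k) (x, θ))
    (hom_eval₂ G (ι.prod π) (RingHom.snd Ω k) (x, θ))

/-- Let `F` be a lift to `V` of the minimal polynomial of `θ ∈ k` and `x` a root of `F` in a field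
of characteristic zero. Then `V[(x, θ)]` inherits the property `IsPowMulUnit p` from `V`. -/
theorem IsPowMulUnit.range_eval₂ {p : ℕ} {Ω k V : Type*} [Field Ω] [CharZero Ω] [Field k]
    [hp : Fact p.Prime] [CharP k p] [CommRing V] (h : IsPowMulUnit p V) (ι : V →+* Ω)
    (π : V →+* k) {F : V[X]} (hF : F.Monic) {x : Ω} {θ : k} (hx : eval₂ ι x F = 0)
    (hθ : eval₂ π θ F = 0)
    (hmin : ∀ G : V[X], G.degree < F.degree → eval₂ π θ G = 0 → ∀ i, π (G.coeff i) = 0) :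
    IsPowMulUnit p (eval₂RingHom (ι.prod π) (x, θ)).range := by
  have hinj := h.injective ι
  have hdom : IsDomain V := hinj.isDomain ι
  have hp0 : (p : V) ≠ 0 := fun h0 => hp.out.ne_zero (Nat.cast_injective (R := Ω) (by
    rw [← map_natCast ι, h0, map_zero, Nat.cast_zero]))
  set Γ := (eval₂RingHom (ι.prod π) (x, θ)).range with hΓ
  let Φ : V[X] →+* Γ := (eval₂RingHom (ι.prod π) (x, θ)).rangeRestrict
  have hΦ : Function.Surjective Φ := RingHom.rangeRestrict_surjective _
  let σ : Γ →+* k := (RingHom.snd Ω k).comp Γ.subtype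
  have hΦval : ∀ G, (Φ G : Ω × k) = (eval₂ ι x G, eval₂ π θ G) := eval₂_prod ι π x θ
  have hσΦ : ∀ G, σ (Φ G) = eval₂ π θ G := fun G => congrArg Prod.snd (hΦval G)
  have hΦF : Φ F = 0 := Subtype.ext (by rw [hΦval, hx, hθ]; rfl)
  have hmod : ∀ G, Φ G = Φ (G %ₘ F) := fun G => by
    conv_lhs => rw [← modByMonic_add_div G F, map_add, map_mul, hΦF, zero_mul, add_zero]
  let : Algebra V Γ := (Φ.comp C).toAlgebra
  have hint : Algebra.IsIntegral V Γ := by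
    refine ⟨fun z => ?_⟩
    obtain ⟨G, rfl⟩ := hΦ z
    have hX : IsIntegral V (Φ X) := ⟨F, hF, by
      rw [← hΦF]
      change eval₂ (Φ.comp C) (Φ X) F = Φ F
      rw [← hom_eval₂, eval₂_C_X]⟩
    have : Φ G = aeval (Φ X) G := by
      change _ = eval₂ (Φ.comp C) (Φ X) G
      rw [← hom_eval₂, eval₂_C_X]
    rw [this, aeval_eq_sum_range]
    exact IsIntegral.sum _ fun i _ => (hX.pow i).smul _
  -- After division by F the degree is below deg F, where vanishing at θ forces all coefficients
  -- into pV.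
  have hker : ∀ z : Γ, σ z = 0 → ∃ w, z = p * w := by
    intro z hz
    obtain ⟨G, rfl⟩ := hΦ z
    rw [hmod] at hz ⊢
    rw [hσΦ] at hz
    have h1 : C (p : V) ∣ G %ₘ F := by
      rw [C_dvd_iff_dvd_coeff]
      exact fun i => h.exists_eq_mul π (hmin _ (degree_modByMonic_lt G hF) hz i)
    obtain ⟨G₁, hG₁⟩ := h1
    refine ⟨Φ G₁, ?_⟩
    rw [hG₁, map_mul, map_natCast, map_natCast]
  have hmaxV := h.isMaximal_ker π
  have hmaxσ : (RingHom.ker σ).IsMaximal := by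
    have : (RingHom.ker σ).IsPrime := RingHom.ker_isPrime σ
    refine Ideal.isMaximal_of_isIntegral_of_isMaximal_comap (R := V) _ ?_
    convert hmaxV using 1
    ext v
    rw [Ideal.mem_comap, RingHom.mem_ker, RingHom.mem_ker]
    change σ (Φ (C v)) = 0 ↔ _
    rw [hσΦ, eval₂_C]
  -- Γ is integral over the local ring V, so each maximal ideal contains p, hence ker σ; thus Γ is
  -- local.
  have hunit : ∀ w : Γ, σ w ≠ 0 → IsUnit w := by
    intro w hw
    by_contra hnu
    obtain ⟨M, hM, hwM⟩ := exists_max_ideal_of_mem_nonunits hnu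
    have hN := Ideal.isMaximal_comap_of_isIntegral_of_isMaximal (R := V) M
    have hpN : (p : V) ∈ M.comap (algebraMap V Γ) := by
      by_contra hpN
      obtain ⟨a, b, hb, hab⟩ := hN.exists_inv hpN
      have : π b = 1 := by
        rw [← map_one π, ← hab, map_add, map_mul, map_natCast, CharP.cast_eq_zero, mul_zero,
          zero_add]
      exact hN.ne_top (Ideal.eq_top_of_isUnit_mem _ hb
        (h.isUnit_of_ne_zero π (by rw [this]; exact one_ne_zero)))
    rw [Ideal.mem_comap, map_natCast] at hpN
    have hle : RingHom.ker σ ≤ M := fun z hz => by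
      obtain ⟨w, rfl⟩ := hker z hz
      exact M.mul_mem_right _ hpN
    rw [← hmaxσ.eq_of_le hM.ne_top hle] at hwM
    exact hw hwM
  intro z hz
  obtain ⟨G, rfl⟩ := hΦ z
  rw [hmod] at hz ⊢
  have hG0 : G %ₘ F ≠ 0 := fun h0 => hz (by rw [h0, map_zero])
  obtain ⟨n, G₁, hG₁, i, hi⟩ := h.exists_eq_C_pow_mul hp0 hG0
  refine ⟨n, Φ G₁, hunit _ ?_, ?_⟩
  · intro h0
    rw [hσΦ] at h0
    refine (hi.map π).ne_zero (hmin G₁ ?_ h0 i)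
    have h1 := degree_modByMonic_lt G hF
    rwa [hG₁, degree_C_mul (pow_ne_zero _ hp0)] at h1
  · rw [hG₁, map_mul, map_pow, map_pow, map_natCast, map_natCast]

/-- V is ℤ[s] localized at (p) and Ω an algebraic closure of its fraction field. Independence of s
over 𝔽_p makes evaluation in k nonzero outside (p), so that it extends to V. -/
theorem exists_isPowMulUnit_of_algebraicIndependent (k : Type u) [Field k] (p : ℕ)
    [hp : Fact p.Prime] [CharP k p] [Algebra (ZMod p) k] {s : Set k}
    (hs : AlgebraicIndependent (ZMod p) ((↑) : s → k)) :
    ∃ (V : Type u) (_ : CommRing V) (Ω : Type u) (_ : Field Ω) (_ : CharZero Ω)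
      (_ : IsAlgClosed Ω) (_ : V →+* Ω) (π : V →+* k), IsPowMulUnit p V ∧
        ∀ a ∈ s, ∃ v, π v = a := by
  let D := MvPolynomial s ℤ
  have hpD : Prime (p : D) := by
    rw [← map_natCast (MvPolynomial.C : ℤ →+* D)]
    exact (MvPolynomial.prime_C_iff s).2 (Nat.prime_iff_prime_int.1 hp.out)
  have hprime : (Ideal.span {(p : D)}).IsPrime :=
    (Ideal.span_singleton_prime hpD.ne_zero).2 hpD
  let Ω := AlgebraicClosure (FractionRing D)
  have hinjΩ : Function.Injective (algebraMap D Ω) := by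
    rw [IsScalarTower.algebraMap_eq D (FractionRing D) Ω]
    exact (algebraMap (FractionRing D) Ω).injective.comp (IsFractionRing.injective D _)
  have hzero : CharZero Ω := charZero_of_injective_algebraMap hinjΩ
  let V := Localization.AtPrime (Ideal.span {(p : D)})
  let ev : D →+* k := (MvPolynomial.aeval ((↑) : s → k)).toRingHom
  have hev : ∀ y : (Ideal.span {(p : D)}).primeCompl, IsUnit (ev y) := by
    rintro ⟨y, hy⟩
    rw [isUnit_iff_ne_zero]
    intro h0
    apply hy
    have h1 : MvPolynomial.aeval ((↑) : s → k) (MvPolynomial.map (Int.castRingHom (ZMod p)) y)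
        = 0 := by
      rw [← h0]
      change _ = MvPolynomial.aeval ((↑) : s → k) y
      rw [MvPolynomial.aeval_def, MvPolynomial.eval₂_map, MvPolynomial.aeval_def]
      congr 1
      exact RingHom.ext_int _ _
    have h2 := hs (h1.trans (map_zero _).symm)
    have h3 := (MvPolynomial.C_dvd_iff_map_hom_eq_zero (Int.castRingHom (ZMod p)) (p : ℤ)
      (fun r => ZMod.intCast_zmod_eq_zero_iff_dvd r p) y).2 h2
    rw [map_natCast] at h3
    exact Ideal.mem_span_singleton.2 h3
  have hι : ∀ y : (Ideal.span {(p : D)}).primeCompl, IsUnit (algebraMap D Ω y) := by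
    rintro ⟨y, hy⟩
    rw [isUnit_iff_ne_zero]
    intro h0
    have h1 : y = 0 := (map_eq_zero_iff _ hinjΩ).1 h0
    rw [h1] at hy
    exact hy (zero_mem (Ideal.span {(p : D)}))
  refine ⟨V, inferInstance, Ω, inferInstance, hzero, inferInstance,
    IsLocalization.lift (S := V) hι, IsLocalization.lift (S := V) hev, ?_, ?_⟩
  · intro z hz
    obtain ⟨f, t, rfl⟩ := IsLocalization.exists_mk'_eq (Ideal.span {(p : D)}).primeCompl z
    have hf : f ≠ 0 := by
      rintro rfl
      exact hz (IsLocalization.mk'_zero _)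
    obtain ⟨g, hg, hdvd⟩ :=
      (FiniteMultiplicity.of_prime_left hpD hf).exists_eq_pow_mul_and_not_dvd
    generalize multiplicity (p : D) f = n at hg
    subst hg
    have hg' : g ∈ (Ideal.span {(p : D)}).primeCompl := fun h =>
      hdvd (Ideal.mem_span_singleton.1 h)
    refine ⟨n, IsLocalization.mk' V g t, ?_, ?_⟩
    · have := IsLocalization.mk'_mul_mk'_eq_one (S := V)
        (⟨g, hg'⟩ : (Ideal.span {(p : D)}).primeCompl) t
      exact IsUnit.of_mul_eq_one _ this
    · rw [← IsLocalization.mul_mk'_eq_mk'_of_mul, map_pow, map_natCast]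
  · intro a ha
    refine ⟨algebraMap D V (MvPolynomial.X ⟨a, ha⟩), ?_⟩
    rw [IsLocalization.lift_eq]
    exact MvPolynomial.aeval_X _ _

/-- Zorn's lemma on subrings of Ω × k, where the first coordinate keeps characteristic zero and the
second records residues. If a maximal one missed θ ∈ k, then θ is algebraic over its residue field
κ; lift the minimal polynomial, take a root in Ω and adjoin the pair by `IsPowMulUnit.range_eval₂`.
-/
theorem exists_isPowMulUnit (k : Type u) [Field k] (p : ℕ) [hp : Fact p.Prime] [CharP k p] :
    ∃ (V : Type u) (_ : CommRing V) (Ω : Type u) (_ : Field Ω) (_ : CharZero Ω) (_ : V →+* Ω)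
      (π : V →+* k), IsPowMulUnit p V ∧ Function.Surjective π := by
  let := ZMod.algebra k p
  obtain ⟨s, hs⟩ := exists_isTranscendenceBasis (ZMod p) k
  obtain ⟨_, _, Ω, _, _, _, ι, π, hV₀, hπs⟩ := exists_isPowMulUnit_of_algebraicIndependent k p hs.1
  let Γ₀ : Subring (Ω × k) := (ι.prod π).range
  let T : Set (Subring (Ω × k)) := {Γ | Γ₀ ≤ Γ ∧ IsPowMulUnit p Γ}
  have hΓ₀ : Γ₀ ∈ T := ⟨le_rfl, hV₀.of_surjective (RingHom.rangeRestrict_surjective _)⟩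
  obtain ⟨Γ, hΓ₀Γ, hΓT, hmax⟩ := zorn_le_nonempty₀ T (fun c hc hchain y hy => by
    have hdir := hchain.directedOn
    refine ⟨sSup c, ⟨(hc hy).1.trans (le_sSup hy), ?_⟩, fun z hz => le_sSup hz⟩
    rintro ⟨a, ha⟩ h0
    obtain ⟨Δ, hΔ, haΔ⟩ := (Subring.mem_sSup_of_directedOn ⟨y, hy⟩ hdir).1 ha
    obtain ⟨n, w, hw, hnw⟩ := (hc hΔ).2 ⟨a, haΔ⟩ (fun h =>
      h0 (Subtype.ext (show a = 0 from congrArg Subtype.val h)))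
    refine ⟨n, Subring.inclusion (le_sSup hΔ) w, hw.map _, ?_⟩
    have := congrArg (Subring.inclusion (le_sSup hΔ)) hnw
    rw [map_mul, map_pow, map_natCast] at this
    exact this) Γ₀ hΓ₀
  have hΓ := hΓT.2
  let ι' : Γ →+* Ω := (RingHom.fst Ω k).comp Γ.subtype
  let π' : Γ →+* k := (RingHom.snd Ω k).comp Γ.subtype
  refine ⟨Γ, inferInstance, Ω, inferInstance, inferInstance, ι', π', hΓ, fun θ => ?_⟩
  let κ : Subfield k :=
    { π'.range with
      inv_mem' := by
        rintro _ ⟨z, rfl⟩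
        by_cases hz : π' z = 0
        · exact ⟨0, by simp [hz]⟩
        · obtain ⟨w, hw⟩ := isUnit_iff_exists_inv.1 (hΓ.isUnit_of_ne_zero π' hz)
          exact ⟨w, eq_inv_of_mul_eq_one_right (by rw [← map_mul, hw, map_one])⟩ }
  have hκ : ∀ z, π' z ∈ κ := fun z => ⟨z, rfl⟩
  let πκ : Γ →+* κ := π'.codRestrict κ hκ
  have hπκ : Function.Surjective πκ := by
    rintro ⟨_, z, rfl⟩
    exact ⟨z, rfl⟩
  have halg : IsIntegral κ θ := by
    have hA : ∀ z : Algebra.adjoin (ZMod p) (Set.range ((↑) : s → k)), (z : k) ∈ κ := by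
      rintro ⟨z, hz⟩
      change z ∈ κ
      induction hz using Algebra.adjoin_induction with
      | mem x hx =>
        obtain ⟨⟨a, ha⟩, rfl⟩ := hx
        obtain ⟨v, rfl⟩ := hπs a ha
        exact ⟨⟨(ι v, π v), hΓ₀Γ ⟨v, rfl⟩⟩, rfl⟩
      | algebraMap r =>
        obtain ⟨n, rfl⟩ := ZMod.intCast_surjective r
        rw [map_intCast]
        exact intCast_mem κ n
      | add x y _ _ hx hy => exact add_mem hx hy
      | mul x y _ _ hx hy => exact mul_mem hx hy
    obtain ⟨P, hP0, hP⟩ := hs.isAlgebraic.isAlgebraic θ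
    let j : Algebra.adjoin (ZMod p) (Set.range ((↑) : s → k)) →+* κ :=
      (algebraMap _ k).codRestrict κ hA
    have hj : Function.Injective j := fun a b hab =>
      Subtype.ext (congrArg (Subtype.val : κ → k) hab)
    refine IsAlgebraic.isIntegral ⟨P.map j, (Polynomial.map_ne_zero_iff hj).2 hP0, ?_⟩
    rw [aeval_def, eval₂_map]
    exact hP
  obtain ⟨F, hFmap, hFdeg, hF⟩ := lifts_and_natDegree_eq_and_monic
    ((mem_lifts _).2 (map_surjective πκ hπκ (minpoly κ θ))) (minpoly.monic halg)
  have hev : ∀ G : Γ[X], eval₂ π' θ G = aeval θ (G.map πκ) := fun G => by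
    rw [aeval_def, eval₂_map]
    rfl
  have hFdeg' : F.degree = (minpoly κ θ).degree := by
    rw [degree_eq_natDegree hF.ne_zero, hFdeg, degree_eq_natDegree (minpoly.ne_zero halg)]
  obtain ⟨x, hx⟩ := IsAlgClosed.exists_eval₂_eq_zero_of_injective ι' (hΓ.injective ι') F
    (by rw [hFdeg']; exact (minpoly.degree_pos halg).ne')
  have hΓ' := hΓ.range_eval₂ ι' π' hF (x := x) (θ := θ) hx
    (by rw [hev, hFmap, minpoly.aeval]) (fun G hG h0 i => by
      have h1 : G.map πκ = 0 := by
        by_contra h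
        rw [hev] at h0
        have h2 := minpoly.degree_le_of_ne_zero κ θ h h0
        rw [← hFdeg'] at h2
        exact absurd (h2.trans_lt (degree_map_le.trans_lt hG)) (lt_irrefl _)
      have h3 := congrArg (fun P : κ[X] => ((P.coeff i : κ) : k)) h1
      simpa [πκ] using h3)
  have hle : Γ ≤ (eval₂RingHom (ι'.prod π') (x, θ)).range := fun z hz => ⟨C ⟨z, hz⟩, by
    rw [coe_eval₂RingHom, eval₂_C]
    rfl⟩
  have hmem := hmax ⟨hΓ₀Γ.trans hle, hΓ'⟩ hle
  exact ⟨⟨(x, θ), hmem ⟨X, by simp⟩⟩, rfl⟩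

theorem exists_isDiscreteValuationRing (k : Type u) [Field k] (p : ℕ) [hp : Fact p.Prime]
    [CharP k p] :
    ∃ (V : Type u) (_ : CommRing V) (_ : IsDomain V) (_ : IsDiscreteValuationRing V)
      (π : V →+* k), Function.Surjective π ∧ RingHom.ker π = Ideal.span {(p : V)} ∧
        ∀ v : V, (p : V) * v = 0 → v = 0 := by
  obtain ⟨V, _, Ω, _, _, ι, π, h, hπ⟩ := exists_isPowMulUnit k p
  have hinj := h.injective ι
  have hdom : IsDomain V := hinj.isDomain ι
  have hp0 : (p : V) ≠ 0 := fun h0 => hp.out.ne_zero (Nat.cast_injective (R := Ω) (by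
    rw [← map_natCast ι, h0, map_zero, Nat.cast_zero]))
  have hpu : ¬ IsUnit (p : V) := fun hu => (hu.map π).ne_zero (by simp)
  have hirr : Irreducible (p : V) := by
    refine ⟨hpu, fun a b hab => ?_⟩
    by_contra! hcon
    have hna : π a = 0 := by_contra fun h0 => hcon.1 (h.isUnit_of_ne_zero π h0)
    have hnb : π b = 0 := by_contra fun h0 => hcon.2 (h.isUnit_of_ne_zero π h0)
    obtain ⟨a, rfl⟩ := h.exists_eq_mul π hna
    obtain ⟨b, rfl⟩ := h.exists_eq_mul π hnb
    refine hpu (IsUnit.of_mul_eq_one (a * b) (mul_left_cancel₀ hp0 ?_))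
    rw [mul_one]
    nth_rewrite 3 [hab]
    ring
  have hdvr : IsDiscreteValuationRing V :=
    IsDiscreteValuationRing.ofHasUnitMulPowIrreducibleFactorization ⟨p, hirr, fun {x} hx => by
      obtain ⟨n, u, hu, rfl⟩ := h x hx
      exact ⟨n, associated_mul_unit_right _ _ hu⟩⟩
  refine ⟨V, _, hdom, hdvr, π, hπ, ?_, fun v hv => (mul_eq_zero.1 hv).resolve_left hp0⟩
  ext z
  rw [RingHom.mem_ker, Ideal.mem_span_singleton']
  constructor
  · intro hz
    obtain ⟨w, rfl⟩ := h.exists_eq_mul π hz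
    exact ⟨w, mul_comm _ _⟩
  · rintro ⟨w, rfl⟩
    simp

end DiscreteValuationRing

/-! ### Cohen presentations of Artinian local rings -/

section Artinian

variable {A : Type u} [CommRing A] [IsLocalRing A]

/-- A local Artinian ring is a quotient of a regular local ring if there is a homomorphism from a
regular ring `V` to `A` which is surjective modulo the maximal ideal. -/
theorem exists_isRegularLocalRing_surjective_of_residue [IsArtinianRing A] {V : Type u}
    [CommRing V] [IsRegularRing V] (φ : V →+* A)
    (hφ : Function.Surjective ((residue A).comp φ)) :
    ∃ (S : Type u) (_ : CommRing S) (_ : IsRegularLocalRing S) (f : S →+* A),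
      Function.Surjective f := by
  obtain ⟨x, hx⟩ := exists_span_range_eq_maximalIdeal A
  let ψ : MvPolynomial (Fin (embDim A)) V →+* A := MvPolynomial.eval₂Hom φ x
  have h1 : ∀ a : A, ∃ (b : V) (c : Fin (embDim A) → A), a = φ b + ∑ i, c i * x i := by
    intro a
    obtain ⟨b, hb⟩ := hφ (residue A a)
    have : a - φ b ∈ Ideal.span (Set.range x) := by
      rw [hx, ← residue_eq_zero_iff, map_sub, sub_eq_zero]
      exact hb.symm
    obtain ⟨c, hc⟩ := (Submodule.mem_span_range_iff_exists_fun _).1 this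
    exact ⟨b, c, by simp only [smul_eq_mul] at hc; rw [hc]; ring⟩
  -- Successive approximation by polynomials in generators of 𝔪; it terminates because 𝔪 is
  -- nilpotent.
  have h2 : ∀ (n : ℕ) (a : A), ∃ P, a - ψ P ∈ maximalIdeal A ^ n := by
    intro n
    induction n with
    | zero => exact fun a => ⟨0, by simp⟩
    | succ n ih =>
      intro a
      obtain ⟨b, c, rfl⟩ := h1 a
      choose P hP using fun i => ih (c i)
      refine ⟨MvPolynomial.C b + ∑ i, P i * MvPolynomial.X i, ?_⟩
      have : φ b + ∑ i, c i * x i - ψ (MvPolynomial.C b + ∑ i, P i * MvPolynomial.X i) =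
          ∑ i, (c i - ψ (P i)) * x i := by
        simp only [ψ, map_add, map_sum, map_mul, MvPolynomial.eval₂Hom_X', MvPolynomial.eval₂Hom_C,
          sub_mul, Finset.sum_sub_distrib]
        ring
      rw [this, pow_succ]
      exact sum_mem fun i _ => Ideal.mul_mem_mul (hP i) (hx ▸ Ideal.subset_span ⟨i, rfl⟩)
  have hψ : Function.Surjective ψ := by
    intro a
    obtain ⟨n, hn⟩ := IsArtinianRing.isNilpotent_jacobson_bot (R := A)
    rw [jacobson_eq_maximalIdeal ⊥ bot_ne_top] at hn
    obtain ⟨P, hP⟩ := h2 n a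
    rw [hn] at hP
    exact ⟨P, (sub_eq_zero.1 hP).symm⟩
  let 𝔭 := (maximalIdeal A).comap ψ
  have hunit : ∀ y : 𝔭.primeCompl, IsUnit (ψ y) := fun y => by
    by_contra h
    exact y.2 ((mem_maximalIdeal _).2 h)
  refine ⟨Localization.AtPrime 𝔭, inferInstance, inferInstance, IsLocalization.lift hunit, ?_⟩
  intro a
  obtain ⟨P, rfl⟩ := hψ a
  exact ⟨algebraMap _ _ P, IsLocalization.lift_eq _ _⟩

/-- A homomorphism from a `p`-torsion free ring `V` with `V/pV` a field to the residue field of a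
local Artinian ring of residue characteristic `p` lifts. -/
theorem exists_lift_residue_of_charP [IsArtinianRing A] {p : ℕ} [hp : Fact p.Prime]
    [CharP (ResidueField A) p] {V : Type u} [CommRing V] (hV : ∀ v : V, (p : V) * v = 0 → v = 0)
    (hmax : (Ideal.span {(p : V)}).IsMaximal) (π : V →+* ResidueField A) :
    ∃ φ : V →+* A, (residue A).comp φ = π := by
  have hpm : (p : A) ∈ maximalIdeal A := by
    rw [← residue_eq_zero_iff, map_natCast, CharP.cast_eq_zero]
  -- Lift from A/𝔪^(n+1) to A/𝔪^(n+2). Compatibility with π is phrased through representatives in A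
  -- so that it passes unchanged to the next stage.
  have key : ∀ n : ℕ, ∃ g : V →+* A ⧸ maximalIdeal A ^ (n + 1),
      ∀ v a, g v = Ideal.Quotient.mk _ a → residue A a = π v := by
    intro n
    induction n with
    | zero =>
      have h1 : maximalIdeal A = maximalIdeal A ^ (0 + 1) := by rw [zero_add, pow_one]
      refine ⟨(Ideal.quotEquivOfEq h1).toRingHom.comp π, fun v a h => ?_⟩
      obtain ⟨b, hb⟩ := residue_surjective (π v)
      change Ideal.quotEquivOfEq h1 (π v) = _ at h
      rw [← hb] at h ⊢
      have h' : Ideal.Quotient.mk (maximalIdeal A ^ (0 + 1)) b = Ideal.Quotient.mk _ a := h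
      rw [Ideal.Quotient.mk_eq_mk_iff_sub_mem, zero_add, pow_one] at h'
      exact ((Ideal.Quotient.mk_eq_mk_iff_sub_mem _ _).2 h').symm
    | succ n ih =>
      obtain ⟨g, hg⟩ := ih
      have hmem : ∀ a, Ideal.Quotient.factorPow (maximalIdeal A) (Nat.le_succ (n + 1)) a = 0 →
          ∃ b ∈ maximalIdeal A ^ (n + 1), Ideal.Quotient.mk _ b = a := by
        intro a ha
        obtain ⟨b, rfl⟩ := Ideal.Quotient.mk_surjective a
        exact ⟨b, Ideal.Quotient.eq_zero_iff_mem.1 ha, rfl⟩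
      obtain ⟨g', hg'⟩ := exists_lift_of_torsionFree hV hmax
        (π := Ideal.Quotient.factorPow (maximalIdeal A) (Nat.le_succ (n + 1)))
        (Ideal.Quotient.factor_surjective _) (by
          intro a b ha hb
          obtain ⟨a, ha', rfl⟩ := hmem a ha
          obtain ⟨b, hb', rfl⟩ := hmem b hb
          rw [← map_mul, Ideal.Quotient.eq_zero_iff_mem]
          have := Ideal.mul_mem_mul ha' hb'
          rw [← pow_add] at this
          exact Ideal.pow_le_pow_right (by lia) this) (by
          intro a ha
          obtain ⟨a, ha', rfl⟩ := hmem a ha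
          rw [← map_natCast (Ideal.Quotient.mk _), ← map_mul, Ideal.Quotient.eq_zero_iff_mem,
            pow_succ' _ (n + 1)]
          exact Ideal.mul_mem_mul hpm ha') g
      refine ⟨g', fun v a h => hg v a ?_⟩
      rw [← hg', RingHom.comp_apply, h]
      rfl
  obtain ⟨n, hn⟩ := IsArtinianRing.isNilpotent_jacobson_bot (R := A)
  rw [jacobson_eq_maximalIdeal ⊥ bot_ne_top] at hn
  have hn' : maximalIdeal A ^ (n + 1) = ⊥ := by
    rw [pow_succ, hn]
    exact Submodule.bot_smul _
  obtain ⟨g, hg⟩ := key n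
  have hbij : Function.Bijective (Ideal.Quotient.mk (maximalIdeal A ^ (n + 1))) := by
    refine ⟨?_, Ideal.Quotient.mk_surjective⟩
    rw [RingHom.injective_iff_ker_eq_bot, Ideal.mk_ker, hn']
  refine ⟨(RingEquiv.ofBijective _ hbij).symm.toRingHom.comp g, ?_⟩
  ext v
  refine hg v _ ?_
  exact ((RingEquiv.ofBijective _ hbij).apply_symm_apply (g v)).symm

/-- Nonzero integers are units, so A is a ℚ-algebra. The residue field is separable algebraic over a
purely transcendental extension of ℚ, hence formally smooth, and its identity lifts along the
nilpotent ideal 𝔪. -/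
theorem exists_section_residue_of_charZero [IsArtinianRing A] [CharZero (ResidueField A)] :
    ∃ φ : ResidueField A →+* A, (residue A).comp φ = RingHom.id _ := by
  have hunit : ∀ y : nonZeroDivisors ℤ, IsUnit (Int.castRingHom A y) := by
    rintro ⟨y, hy⟩
    by_contra h
    have h1 := (residue_eq_zero_iff _).2 ((mem_maximalIdeal _).2 h)
    rw [eq_intCast, map_intCast, Int.cast_eq_zero] at h1
    exact nonZeroDivisors.ne_zero hy h1
  let : Algebra ℚ A := (IsLocalization.lift hunit : ℚ →+* A).toAlgebra
  let : Algebra ℚ (ResidueField A) := DivisionRing.toRatAlgebra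
  obtain ⟨s, hs⟩ := exists_isTranscendenceBasis ℚ (ResidueField A)
  have halg := hs.isAlgebraic_field
  have hsmooth : Algebra.FormallySmooth ℚ (ResidueField A) :=
    Algebra.FormallySmooth.of_algebraicIndependent_of_isSeparable hs.1
  obtain ⟨n, hn⟩ := IsArtinianRing.isNilpotent_jacobson_bot (R := A)
  rw [jacobson_eq_maximalIdeal ⊥ bot_ne_top] at hn
  let g : A →ₐ[ℚ] ResidueField A := (residue A).toRatAlgHom
  refine ⟨(Algebra.FormallySmooth.liftOfSurjective (AlgHom.id ℚ (ResidueField A)) g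
    residue_surjective ⟨n, ?_⟩).toRingHom, ?_⟩
  · rw [← hn]
    congr 1
    exact ker_residue
  · ext a
    exact Algebra.FormallySmooth.liftOfSurjective_apply (AlgHom.id ℚ (ResidueField A)) g _ _ a

/-- A local Artinian ring is a quotient of a regular local ring. -/
theorem exists_isRegularLocalRing_surjective (A : Type u) [CommRing A] [IsLocalRing A]
    [IsArtinianRing A] :
    ∃ (S : Type u) (_ : CommRing S) (_ : IsRegularLocalRing S) (f : S →+* A),
      Function.Surjective f := by
  obtain ⟨p, hp⟩ := CharP.exists (ResidueField A)
  rcases CharP.char_is_prime_or_zero (ResidueField A) p with hprime | rfl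
  · have : Fact p.Prime := ⟨hprime⟩
    obtain ⟨V, _, _, _, π, hπ, hker, htf⟩ := exists_isDiscreteValuationRing (ResidueField A) p
    obtain ⟨φ, hφ⟩ := exists_lift_residue_of_charP htf
      (hker ▸ RingHom.ker_isMaximal_of_surjective π hπ) π
    exact exists_isRegularLocalRing_surjective_of_residue φ (hφ ▸ hπ)
  · have : CharZero (ResidueField A) := CharP.charP_to_charZero _
    obtain ⟨φ, hφ⟩ := exists_section_residue_of_charZero (A := A)
    exact exists_isRegularLocalRing_surjective_of_residue φ (hφ ▸ Function.surjective_id)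

/-- Keeps the supremum in `burchIndexDepthZero` from being empty, which every lower bound for
Artinian quotients depends on. -/
theorem nonempty_minimalCohenPresentation (A : Type u) [CommRing A] [IsLocalRing A]
    [IsArtinianRing A] : Nonempty (MinimalCohenPresentation (LocalCompletion A)) := by
  obtain ⟨S, _, _, f, hf⟩ := exists_isRegularLocalRing_surjective A
  obtain ⟨T, _, _, g, hg, hT⟩ := exists_isRegularLocalRing_surjective_embDim_eq hf
  exact ⟨minimalCohenPresentationOfSurjective hg hT⟩

end Artinian

/-! ### Lengths -/

section Length

theorem length_quotient_maximalIdeal (A : Type u) [CommRing A] [IsLocalRing A] :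
    Module.length A (A ⧸ maximalIdeal A) = 1 :=
  have : IsSimpleModule A (A ⧸ maximalIdeal A) :=
    isSimpleModule_iff_quot_maximal.2 ⟨_, inferInstance, ⟨LinearEquiv.refl _ _⟩⟩
  Module.length_eq_one _ _

/-- `length (A / 𝔪²) = edim A + 1`. -/
theorem length_quotient_maximalIdeal_sq (A : Type u) [CommRing A] [IsLocalRing A]
    [IsNoetherianRing A] :
    Module.length A (A ⧸ maximalIdeal A ^ 2) = embDim A + 1 := by
  have hle : maximalIdeal A ^ 2 ≤ maximalIdeal A := Ideal.pow_le_self two_ne_zero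
  rw [Module.length_eq_add_of_exact (maximalIdeal A).cotangentToQuotientSquare
    (Submodule.factor hle) (maximalIdeal A).cotangentToQuotientSquare_injective
    (Submodule.factor_surjective hle) ?_]
  · congr 1
    · rw [Module.length_eq_of_surjective (R := ResidueField A) (M := CotangentSpace A)
        residue_surjective, Module.length_eq_finrank]
      rfl
    · exact length_quotient_maximalIdeal A
  · intro y
    constructor
    · intro hy
      obtain ⟨x, rfl⟩ := Submodule.Quotient.mk_surjective _ y
      have hx : x ∈ maximalIdeal A := (Submodule.Quotient.mk_eq_zero _).1 hy
      exact ⟨(maximalIdeal A).toCotangent ⟨x, hx⟩, rfl⟩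
    · rintro ⟨z, rfl⟩
      obtain ⟨w, rfl⟩ := (maximalIdeal A).toCotangent_surjective z
      exact (Submodule.Quotient.mk_eq_zero _).2 w.2

/-- Flat base change multiplies length by the length of the closed fibre C/𝔪C, here a field. -/
theorem length_quotient_map_eq {A : Type u} {C : Type v} [CommRing A] [IsLocalRing A] [CommRing C]
    [IsLocalRing C] [Algebra A C] [Module.Flat A C]
    (hm : (maximalIdeal A).map (algebraMap A C) = maximalIdeal C) (I : Ideal A) :
    Module.length C (C ⧸ I.map (algebraMap A C)) = Module.length A (A ⧸ I) := by
  have hloc : IsLocalHom (algebraMap A C) :=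
    ((IsLocalRing.local_hom_TFAE (algebraMap A C)).out 0 2).2 hm.le
  rw [(Algebra.TensorProduct.quotIdealMapEquivTensorQuot C I).toLinearEquiv.length_eq,
    IsLocalRing.length_baseChange, hm, length_quotient_maximalIdeal, mul_one]

end Length

/-! ### Invariants of the generic extension -/

section GenericExtension

variable (R : Type u) [CommRing R] [IsLocalRing R]

theorem map_maximalIdeal_genericExtension :
    (maximalIdeal R).map (algebraMap R (GenericExtension R)) =
      maximalIdeal (GenericExtension R) := by
  rw [← Localization.AtPrime.map_eq_maximalIdeal, IsScalarTower.algebraMap_eq R R[X], ← Ideal.map_map]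
  rfl

instance flat_genericExtension : Module.Flat R (GenericExtension R) :=
  have : Module.Flat R[X] (GenericExtension R) :=
    IsLocalization.flat _ ((maximalIdeal R).map (C : R →+* R[X])).primeCompl
  Module.Flat.trans R R[X] _

instance infinite_residueField_genericExtension :
    Infinite (ResidueField (GenericExtension R)) := by
  refine Infinite.of_injective
    (fun n : ℕ => residue _ (algebraMap R[X] (GenericExtension R) (X ^ n))) ?_
  intro m n hmn
  by_contra hne
  have h1 : algebraMap R[X] (GenericExtension R) (X ^ m - X ^ n) ∈
      maximalIdeal (GenericExtension R) := by
    rw [← residue_eq_zero_iff, map_sub, map_sub, sub_eq_zero]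
    exact hmn
  rw [IsLocalization.AtPrime.to_map_mem_maximal_iff (GenericExtension R)
    ((maximalIdeal R).map (C : R →+* R[X])), Ideal.mem_map_C_iff] at h1
  have h2 := h1 m
  rw [coeff_sub, coeff_X_pow_self, coeff_X_pow, if_neg hne, sub_zero] at h2
  exact (Ideal.ne_top_iff_one _).1 (Ideal.IsPrime.ne_top') h2

theorem ringDepth_genericExtension [IsNoetherianRing R] :
    ringDepth (GenericExtension R) = ringDepth R :=
  (ringDepth_eq_of_flat (map_maximalIdeal_genericExtension R)).symm

theorem ringKrullDim_genericExtension [IsNoetherianRing R] :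
    ringKrullDim (GenericExtension R) = ringKrullDim R := by
  rw [IsLocalization.AtPrime.ringKrullDim_eq_height ((maximalIdeal R).map (C : R →+* R[X])),
    height_map_C, IsLocalRing.maximalIdeal_height_eq_ringKrullDim]

theorem length_genericExtension_quotient_pow (n : ℕ) :
    Module.length (GenericExtension R) (GenericExtension R ⧸ maximalIdeal (GenericExtension R) ^ n) =
      Module.length R (R ⧸ maximalIdeal R ^ n) := by
  rw [← length_quotient_map_eq (map_maximalIdeal_genericExtension R), Ideal.map_pow,
    map_maximalIdeal_genericExtension]

/-- Read off from length(R/𝔪²) = edim R + 1. -/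
theorem embDim_genericExtension [IsNoetherianRing R] :
    embDim (GenericExtension R) = embDim R := by
  have h := length_genericExtension_quotient_pow R 2
  rw [length_quotient_maximalIdeal_sq, length_quotient_maximalIdeal_sq] at h
  exact Nat.add_right_cancel (by exact_mod_cast h)

end GenericExtension

/-! ### Superficial elements via the Rees algebra -/

section Superficial

variable {C : Type u} [CommRing C] [IsLocalRing C] [IsNoetherianRing C]

/-- Over an infinite residue field, the maximal ideal is not covered by finitely many ideals
unless one of them contains it. -/
theorem exists_mem_maximalIdeal_forall_notMem [Infinite (ResidueField C)] (W : Finset (Ideal C))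
    (hW : ∀ I ∈ W, ¬ maximalIdeal C ≤ I) : ∃ x ∈ maximalIdeal C, ∀ I ∈ W, x ∉ I := by
  classical
  let V (I : Ideal C) : Submodule C (CotangentSpace C) :=
    (Submodule.comap (maximalIdeal C).subtype I).map (maximalIdeal C).toCotangent
  have hV (I : Ideal C) (a : ResidueField C) (v : CotangentSpace C) (hv : v ∈ V I) :
      a • v ∈ V I := by
    obtain ⟨r, rfl⟩ := residue_surjective a
    exact (V I).smul_mem r hv
  let V' (I : Ideal C) : Subspace (ResidueField C) (CotangentSpace C) :=
    { V I with smul_mem' := fun a v hv => hV I a v hv }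
  have htop : ⊤ ∉ W.image V' := by
    intro h
    obtain ⟨I, hI, hIt⟩ := Finset.mem_image.1 h
    refine hW I hI (maximalIdeal_le_of_le_sup_sq ?_)
    intro m hm
    have h1 : (maximalIdeal C).toCotangent ⟨m, hm⟩ ∈ V I :=
      show _ ∈ V' I from hIt ▸ Submodule.mem_top
    obtain ⟨w, hw, hwm⟩ := h1
    have h2 := (Ideal.toCotangent_eq (maximalIdeal C)).1 hwm.symm
    have : m = w.1 + (m - w.1) := by ring
    rw [this]
    exact Ideal.add_mem _ (Ideal.mem_sup_left hw) (Ideal.mem_sup_right h2)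
  -- A vector space over an infinite field is no finite union of proper subspaces; thus the ideals
  -- in `W` need not be prime.
  have hne := Subspace.biUnion_ne_univ_of_top_notMem htop
  obtain ⟨v, hv⟩ := (Set.ne_univ_iff_exists_notMem _).1 hne
  obtain ⟨x, rfl⟩ := (maximalIdeal C).toCotangent_surjective v
  refine ⟨x, x.2, fun I hI hx => hv ?_⟩
  simp only [Set.mem_iUnion]
  exact ⟨V' I, Finset.mem_image_of_mem _ hI,
    show (maximalIdeal C).toCotangent x ∈ V I from ⟨x, hx, rfl⟩⟩

/-- Take the associated primes of A/L. If t avoids those not containing 𝔞, the kernel of t on A/L is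
killed by a power of 𝔞, and Artin-Rees shows that it meets high powers of 𝔞 in zero. -/
theorem exists_finset_isPrime_forall_mul_mem {A : Type v} [CommRing A] [IsNoetherianRing A]
    (𝔞 L : Ideal A) : ∃ s : Finset (Ideal A), ∀ t, (∀ P ∈ s, t ∈ P → 𝔞 ≤ P) →
      ∃ c, ∀ j ≥ c, ∀ y ∈ 𝔞 ^ j, t * y ∈ L → y ∈ L := by
  classical
  have hfin := associatedPrimes.finite A (A ⧸ L)
  refine ⟨hfin.toFinset, fun t ht => ?_⟩
  let K : Submodule A (A ⧸ L) := LinearMap.ker (LinearMap.lsmul A (A ⧸ L) t)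
  have hrad : 𝔞 ≤ (Module.annihilator A K).radical := by
    rw [← Ideal.sInf_minimalPrimes]
    refine le_sInf fun P hP => ?_
    have hass := Module.associatedPrimes.minimalPrimes_annihilator_subset_associatedPrimes A K hP
    refine ht P (hfin.mem_toFinset.2 (associatedPrimes.subset_of_injective
      K.injective_subtype hass)) (hP.1.2 (Module.mem_annihilator.2 fun k => ?_))
    exact Subtype.ext (LinearMap.mem_ker.1 k.2)
  obtain ⟨c, hc⟩ := Ideal.exists_pow_le_of_le_radical_of_fg hrad (IsNoetherian.noetherian 𝔞)
  obtain ⟨k, hk⟩ := Ideal.exists_pow_inf_eq_pow_smul 𝔞 K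
  refine ⟨k + c, fun j hj y hy hty => ?_⟩
  rw [← Ideal.Quotient.eq_zero_iff_mem]
  have hyK : (Ideal.Quotient.mk L y : A ⧸ L) ∈ K :=
    show Ideal.Quotient.mk L (t * y) = 0 from Ideal.Quotient.eq_zero_iff_mem.2 hty
  have hya : (Ideal.Quotient.mk L y : A ⧸ L) ∈ (𝔞 ^ j • ⊤ : Submodule A (A ⧸ L)) := by
    have : (Ideal.Quotient.mk L y : A ⧸ L) = y • (Ideal.Quotient.mk L 1 : A ⧸ L) := by
      change _ = Ideal.Quotient.mk L (y * 1)
      rw [mul_one]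
    rw [this]
    exact Submodule.smul_mem_smul hy trivial
  have hmem : (Ideal.Quotient.mk L y : A ⧸ L) ∈ 𝔞 ^ (j - k) • (𝔞 ^ k • ⊤ ⊓ K) :=
    hk j (by omega) ▸ ⟨hya, hyK⟩
  have hle : 𝔞 ^ (j - k) • (𝔞 ^ k • ⊤ ⊓ K) ≤ ⊥ := by
    refine Submodule.smul_le.2 fun r hr m hm => ?_
    have h1 := Module.mem_annihilator.1 (hc (Ideal.pow_le_pow_right (by omega) hr)) ⟨m, hm.2⟩
    exact congrArg Subtype.val h1
  exact hle hmem

/-- Converts degree in the Rees algebra into membership in a power of the ideal generated in degree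
one, as `exists_finset_isPrime_forall_mul_mem` requires. -/
theorem monomial_mem_pow_span_reesAlgebra (I : Ideal C) (n : ℕ) {y : C} (hy : y ∈ I ^ n) :
    (⟨monomial n y, reesAlgebra.monomial_mem.2 hy⟩ : reesAlgebra I) ∈
      Ideal.span {f : reesAlgebra I | ∃ m ∈ I, (f : C[X]) = monomial 1 m} ^ n := by
  induction n generalizing y with
  | zero => simp
  | succ n ih =>
    rw [pow_succ] at hy
    refine Submodule.mul_induction_on' (C := fun y hy => (⟨monomial (n + 1) y,
      reesAlgebra.monomial_mem.2 (by rwa [pow_succ])⟩ : reesAlgebra I) ∈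
      Ideal.span {f : reesAlgebra I | ∃ m ∈ I, (f : C[X]) = monomial 1 m} ^ (n + 1)) ?_ ?_ hy
    · intro a ha b hb
      have h1 := ih ha
      have h2 : (⟨monomial 1 b, reesAlgebra.monomial_mem.2 (by simpa using hb)⟩ : reesAlgebra I) ∈
        Ideal.span {f : reesAlgebra I | ∃ m ∈ I, (f : C[X]) = monomial 1 m} :=
        Ideal.subset_span ⟨b, hb, rfl⟩
      rw [pow_succ]
      convert Ideal.mul_mem_mul h1 h2 using 1
      ext1
      simp [monomial_mul_monomial]
    · intro a ha b hb h1 h2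
      convert Ideal.add_mem _ h1 h2 using 1
      ext1
      simp

/-- The ideal of the Rees algebra whose quotient is the associated graded ring. -/
def reesAlgebraShift (I : Ideal C) : Ideal (reesAlgebra I) where
  carrier := {f | ∀ i, (f : C[X]).coeff i ∈ I ^ (i + 1)}
  add_mem' ha hb i := by
    simpa using Ideal.add_mem _ (ha i) (hb i)
  zero_mem' i := by simp
  smul_mem' f g hg i := by
    change ((f : C[X]) * (g : C[X])).coeff i ∈ _
    rw [coeff_mul]
    refine Ideal.sum_mem _ fun p hp => ?_
    have h1 := Ideal.mul_mem_mul ((mem_reesAlgebra_iff I f.1).1 f.2 p.1) (hg p.2)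
    rwa [← pow_add, ← add_assoc, Finset.HasAntidiagonal.mem_antidiagonal.1 hp] at h1

theorem mem_reesAlgebraShift_monomial_iff (I : Ideal C) {n : ℕ} {y : C} (hy : y ∈ I ^ n) :
    (⟨monomial n y, reesAlgebra.monomial_mem.2 hy⟩ : reesAlgebra I) ∈ reesAlgebraShift I ↔
      y ∈ I ^ (n + 1) := by
  constructor
  · intro h
    simpa using h n
  · intro h i
    change (monomial n y).coeff i ∈ _
    rw [coeff_monomial]
    split_ifs with hi
    · exact hi ▸ h
    · exact zero_mem _

/-- A regular superficial element: multiplication by `x` is strict for the `𝔪`-adic filtration in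
high degrees. -/
theorem exists_superficial [Infinite (ResidueField C)] (hdepth : ringDepth C ≠ 0) :
    ∃ x ∈ maximalIdeal C, IsSMulRegular C x ∧ x ∉ maximalIdeal C ^ 2 ∧
      ∃ N, ∀ n ≥ N, ∀ y, x * y ∈ maximalIdeal C ^ (n + 1) → y ∈ maximalIdeal C ^ n := by
  classical
  set 𝔪 := maximalIdeal C with h𝔪
  let Rs := reesAlgebra 𝔪
  let 𝔞 : Ideal Rs := Ideal.span {f : Rs | ∃ m ∈ 𝔪, (f : C[X]) = monomial 1 m}
  let T (m : C) (hm : m ∈ 𝔪) : Rs :=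
    ⟨monomial 1 m, reesAlgebra.monomial_mem.2 (by simpa using hm)⟩
  let W (P : Ideal Rs) : Ideal C :=
    { carrier := {m | ∃ hm : m ∈ 𝔪, T m hm ∈ P}
      add_mem' := by
        rintro a b ⟨ha, ha'⟩ ⟨hb, hb'⟩
        refine ⟨Ideal.add_mem _ ha hb, ?_⟩
        convert Ideal.add_mem _ ha' hb' using 1
        ext1
        simp [T]
      zero_mem' := ⟨zero_mem _, by
        convert P.zero_mem using 1
        ext1
        simp [T]⟩
      smul_mem' := by
        rintro c a ⟨ha, ha'⟩
        refine ⟨Ideal.mul_mem_left _ _ ha, ?_⟩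
        convert P.mul_mem_left (algebraMap C Rs c) ha' using 1
        ext1
        simp [T, Algebra.algebraMap_eq_smul_one, smul_monomial] }
  obtain ⟨s, hs⟩ := exists_finset_isPrime_forall_mul_mem 𝔞 (reesAlgebraShift 𝔪)
  have hfin' := (associatedPrimes.finite C C)
  -- To be avoided: 𝔪², the associated primes of C (for regularity), and the degree-one traces `W P`
  -- of the members P of `s` that do not contain 𝔞.
  let F : Finset (Ideal C) :=
    insert (𝔪 ^ 2) (((s.filter fun P => ¬ 𝔞 ≤ P).image W) ∪ hfin'.toFinset)
  have h0 : ¬ ∃ s : C, s ≠ 0 ∧ ∀ a ∈ 𝔪, s * a = 0 := fun h => hdepth (ringDepth_eq_zero_iff.2 h)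
  obtain ⟨x, hx, hxF⟩ := exists_mem_maximalIdeal_forall_notMem F (by
    intro I hI hle
    rcases Finset.mem_insert.1 hI with rfl | hI
    · have h1 : 𝔪 ≤ ⊥ := maximalIdeal_le_of_le_sup_sq (by simpa using hle)
      refine h0 ⟨1, one_ne_zero, fun a ha => ?_⟩
      simpa using h1 ha
    rcases Finset.mem_union.1 hI with hI | hI
    · obtain ⟨P, hP, rfl⟩ := Finset.mem_image.1 hI
      refine (Finset.mem_filter.1 hP).2 (Ideal.span_le.2 ?_)
      rintro f ⟨m, hm, hf⟩
      obtain ⟨hm', h⟩ := hle hm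
      have : f = T m hm' := Subtype.ext hf
      exact this ▸ h
    · obtain ⟨hp, z, hz⟩ := isAssociatedPrime_iff.1 (hfin'.mem_toFinset.1 hI)
      refine h0 ⟨z, ?_, fun a ha => ?_⟩
      · rintro rfl
        refine hp.ne_top (hz ▸ ?_)
        simp
      · have := hle ha
        rw [hz] at this
        simpa [mul_comm] using this)
  have hx2 : x ∉ 𝔪 ^ 2 := hxF _ (Finset.mem_insert_self _ _)
  have hxreg : IsSMulRegular C x := by
    have h1 : x ∈ nonZeroDivisors C := by
      by_contra hcon
      have : x ∈ ((nonZeroDivisors C : Set C)ᶜ) := hcon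
      rw [← biUnion_associatedPrimes_eq_compl_nonZeroDivisors] at this
      simp only [Set.mem_iUnion] at this
      obtain ⟨p, hp, hxp⟩ := this
      exact hxF p (Finset.mem_insert_of_mem (Finset.mem_union_right _
        (hfin'.mem_toFinset.2 hp))) hxp
    exact (isRegular_iff_mem_nonZeroDivisors.2 h1).left.isSMulRegular
  refine ⟨x, hx, hxreg, hx2, ?_⟩
  obtain ⟨c, hc⟩ := hs (T x hx) (fun P hP hxP => by
    by_contra hnP
    exact hxF (W P) (Finset.mem_insert_of_mem (Finset.mem_union_left _
      (Finset.mem_image_of_mem _ (Finset.mem_filter.2 ⟨hP, hnP⟩)))) ⟨hx, hxP⟩)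
  -- In the associated graded ring the degree-one form of x kills no nonzero form of degree j ≥ c.
  have hstep : ∀ j ≥ c, ∀ y ∈ 𝔪 ^ j, x * y ∈ 𝔪 ^ (j + 2) → y ∈ 𝔪 ^ (j + 1) := by
    intro j hj y hy hxy
    rw [← mem_reesAlgebraShift_monomial_iff 𝔪 hy]
    refine hc j hj _ (monomial_mem_pow_span_reesAlgebra 𝔪 j hy) ?_
    have hmem : x * y ∈ 𝔪 ^ (j + 1) := Ideal.pow_le_pow_right (by omega) hxy
    convert (mem_reesAlgebraShift_monomial_iff 𝔪 hmem).2 hxy using 1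
    ext1
    simp [T, monomial_mul_monomial, add_comm]
  -- Artin-Rees for (x) gives a first estimate for y, weaker by a constant; `hstep` then improves it
  -- one power at a time.
  obtain ⟨k', hk'⟩ := Ideal.exists_pow_inf_eq_pow_smul 𝔪 (Ideal.span {x})
  refine ⟨c + k', fun n hn y hxy => ?_⟩
  have hbase : y ∈ 𝔪 ^ (n + 1 - k') := by
    have h1 : x * y ∈ 𝔪 ^ (n + 1 - k') • (𝔪 ^ k' • ⊤ ⊓ Ideal.span {x}) := by
      rw [← hk' (n + 1) (by omega)]
      exact ⟨by simpa using hxy, Ideal.mem_span_singleton.2 (dvd_mul_right _ _)⟩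
    have h2 : x * y ∈ 𝔪 ^ (n + 1 - k') * Ideal.span {x} :=
      Submodule.smul_mono le_rfl inf_le_right h1
    obtain ⟨z, hz, hzy⟩ := Ideal.mem_mul_span_singleton.1 h2
    have : z = y := hxreg (by simpa [mul_comm] using hzy)
    exact this ▸ hz
  have hclimb : ∀ i, n + 1 - k' + i ≤ n → y ∈ 𝔪 ^ (n + 1 - k' + i) := by
    intro i
    induction i with
    | zero => exact fun _ => hbase
    | succ i ih =>
      intro hi
      rw [← add_assoc] at hi ⊢
      exact hstep _ (by omega) y (ih (by omega)) (Ideal.pow_le_pow_right (by omega) hxy)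
  by_cases h : n + 1 - k' ≤ n
  · have := hclimb (n - (n + 1 - k')) (by omega)
    rwa [Nat.add_sub_cancel' h] at this
  · exact Ideal.pow_le_pow_right (by omega) hbase

end Superficial

/-! ### Asymptotics of partial sums -/

section Summation

open Asymptotics Filter Topology

theorem tendsto_natCast_choose_mul_factorial_div_pow (d : ℕ) :
    Tendsto (fun n : ℕ => (n.choose d : ℝ) / ((n : ℝ) ^ d / d.factorial)) atTop (𝓝 1) := by
  refine (isEquivalent_iff_tendsto_one ?_).1 (isEquivalent_choose d)
  filter_upwards [eventually_gt_atTop 0] with n hn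
  positivity

/-- If the increments of `H` grow like `L nᵈ / d!` then `H` grows like `L nᵈ⁺¹ / (d+1)!`. -/
theorem tendsto_factorial_mul_div_pow_succ {h H : ℕ → ℝ} {d N : ℕ} {L : ℝ}
    (hH : ∀ n ≥ N, H (n + 1) = H n + h (n + 1))
    (hL : Tendsto (fun n : ℕ => d.factorial * h n / (n : ℝ) ^ d) atTop (𝓝 L)) :
    Tendsto (fun n : ℕ => (d + 1).factorial * H n / (n : ℝ) ^ (d + 1)) atTop (𝓝 L) := by
  -- Binomial coefficients are the comparison sequence because their partial sums are binomial
  -- coefficients again.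
  set g : ℕ → ℝ := fun i => (i.choose d : ℝ) with hg
  have hsum (n : ℕ) : ∑ i ∈ Finset.range n, g i = (n.choose (d + 1) : ℝ) := by
    induction n with
    | zero => simp
    | succ n ih =>
      rw [Finset.sum_range_succ, ih, Nat.choose_succ_succ, Nat.cast_add, add_comm]
  have hgpos : ∀ᶠ i in atTop, 0 < g i := by
    filter_upwards [eventually_ge_atTop d] with i hi
    exact Nat.cast_pos.2 (Nat.choose_pos hi)
  have hchoose := tendsto_natCast_choose_mul_factorial_div_pow d
  have hshift : Tendsto (fun n : ℕ => ((n : ℝ) + 1) / n) atTop (𝓝 1) := by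
    have h1 : Tendsto (fun n : ℕ => 1 + (1 : ℝ) / n) atTop (𝓝 (1 + 0)) :=
      tendsto_const_nhds.add tendsto_one_div_atTop_nhds_zero_nat
    rw [add_zero] at h1
    refine h1.congr' ?_
    filter_upwards [eventually_gt_atTop 0] with n hn
    field_simp
  have hinc : Tendsto (fun i => h (i + 1) / g i) atTop (𝓝 L) := by
    have h1 := (hL.comp (tendsto_add_atTop_nat 1)).mul ((hshift.pow d).mul (hchoose.inv₀ one_ne_zero))
    rw [inv_one, one_pow, mul_one, mul_one] at h1
    refine h1.congr' ?_
    filter_upwards [eventually_gt_atTop 0, hgpos] with n hn hgn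
    have h2 : (n.choose d : ℝ) ≠ 0 := hgn.ne'
    have h3 : (d.factorial : ℝ) ≠ 0 := by positivity
    simp only [Function.comp, hg, Nat.cast_add, Nat.cast_one, div_pow]
    field_simp
  -- A little-o relation to g survives summation because the partial sums of g diverge.
  have hlittle : (fun i => H (i + 1) - H i - L * g i) =o[atTop] g := by
    rw [isLittleO_iff_tendsto' (hgpos.mono fun i hi h0 => absurd h0 hi.ne')]
    have h1 := hinc.sub_const L
    rw [sub_self] at h1
    refine h1.congr' ?_
    filter_upwards [eventually_ge_atTop N, hgpos] with n hn hgn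
    rw [hH n hn]
    field_simp
    ring
  have hchoose' := tendsto_natCast_choose_mul_factorial_div_pow (d + 1)
  have hpow : Tendsto (fun n : ℕ => (n : ℝ) ^ (d + 1) / (d + 1).factorial) atTop atTop :=
    ((tendsto_pow_atTop d.succ_ne_zero).comp tendsto_natCast_atTop_atTop).atTop_div_const
      (by positivity)
  have htop : Tendsto (fun n => ∑ i ∈ Finset.range n, g i) atTop atTop := by
    simp only [hsum]
    refine (hchoose'.pos_mul_atTop one_pos hpow).congr' ?_
    filter_upwards [eventually_gt_atTop 0] with n hn
    field_simp
  have hs := hlittle.sum_range (fun i => by positivity) htop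
  have hlim : Tendsto (fun n : ℕ => H n / (n.choose (d + 1) : ℝ)) atTop (𝓝 L) := by
    have hsum' (n : ℕ) : ∑ i ∈ Finset.range n, (H (i + 1) - H i - L * g i) =
        H n - H 0 - L * (n.choose (d + 1) : ℝ) := by
      rw [Finset.sum_sub_distrib, Finset.sum_range_sub, ← Finset.mul_sum, hsum]
    have h1 := hs.tendsto_div_nhds_zero
    simp only [hsum', hsum] at h1 htop
    have h2 : Tendsto (fun n : ℕ => H 0 / (n.choose (d + 1) : ℝ)) atTop (𝓝 0) :=
      htop.const_div_atTop _
    have h3 := (h1.add h2).add_const L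
    rw [add_zero, zero_add] at h3
    refine h3.congr' ?_
    filter_upwards [eventually_ge_atTop (d + 1)] with n hn
    have : (n.choose (d + 1) : ℝ) ≠ 0 := by exact_mod_cast (Nat.choose_pos hn).ne'
    field_simp
    ring
  have h4 := hlim.mul hchoose'
  rw [mul_one] at h4
  refine h4.congr' ?_
  filter_upwards [eventually_ge_atTop (d + 1)] with n hn
  have : (n.choose (d + 1) : ℝ) ≠ 0 := by exact_mod_cast (Nat.choose_pos hn).ne'
  have : (n : ℝ) ≠ 0 := by
    have : 0 < n := by omega
    positivity
  field_simp

end Summation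

/-! ### Multiplicity as the length of a quotient -/

section Multiplicity

theorem length_quotient_eq_of_surjective {C : Type u} {A : Type v} [CommRing C] [CommRing A]
    {f : C →+* A} (hf : Function.Surjective f) {I : Ideal C} (hI : RingHom.ker f ≤ I) :
    Module.length C (C ⧸ I) = Module.length A (A ⧸ I.map f) := by
  algebraize [f]
  rw [← Module.length_eq_of_surjective (S := C) (R := A) (M := A ⧸ I.map f) hf]
  have hcomap : I = (I.map f).comap f := by
    rw [Ideal.comap_map_of_surjective f hf, ← RingHom.ker_eq_comap_bot, sup_eq_left.2 hI]
  let φ : C →ₗ[C] (A ⧸ I.map f) := Algebra.linearMap C (A ⧸ I.map f)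
  have hφ : Function.Surjective φ := by
    intro y
    obtain ⟨a, rfl⟩ := Ideal.Quotient.mk_surjective y
    obtain ⟨c, rfl⟩ := hf a
    exact ⟨c, rfl⟩
  have hker : LinearMap.ker φ = I := by
    ext c
    rw [LinearMap.mem_ker]
    change Ideal.Quotient.mk (I.map f) (f c) = 0 ↔ _
    rw [Ideal.Quotient.eq_zero_iff_mem]
    conv_rhs => rw [hcomap]
    rfl
  rw [← (φ.quotKerEquivOfSurjective hφ).length_eq, hker]

variable {C : Type u} [CommRing C] [IsLocalRing C] [IsNoetherianRing C]

theorem length_quotient_pow_ne_top (n : ℕ) :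
    Module.length C (C ⧸ maximalIdeal C ^ n) ≠ ⊤ := by
  rcases eq_or_ne n 0 with rfl | hn
  · have : Subsingleton (C ⧸ maximalIdeal C ^ 0) := by
      rw [pow_zero, Ideal.one_eq_top]
      infer_instance
    rw [Module.length_eq_zero]
    simp
  have hne : maximalIdeal C ^ n ≤ maximalIdeal C := Ideal.pow_le_self hn
  have : IsLocalRing (C ⧸ maximalIdeal C ^ n) := isLocalRing_quotient_of_le hne
  have hart : IsArtinianRing (C ⧸ maximalIdeal C ^ n) := by
    rw [isArtinianRing_iff_isNilpotent_maximalIdeal]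
    refine ⟨n, ?_⟩
    rw [← maximalIdeal_pow_map_of_surjective (Ideal.Quotient.mk_surjective
      (I := maximalIdeal C ^ n)), Ideal.map_quotient_self]
    rfl
  rw [Module.length_eq_of_surjective (S := C) (R := C ⧸ maximalIdeal C ^ n)
    Ideal.Quotient.mk_surjective]
  exact Module.length_ne_top

/-- From the exact sequence 0 → C/𝔪^n → C/𝔪^(n+1) → A/𝔪_A^(n+1) → 0 whose first map is
multiplication by x; `hn` is its injectivity. -/
theorem length_quotient_pow_succ {A : Type v} [CommRing A] [IsLocalRing A] {f : C →+* A}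
    (hf : Function.Surjective f) {x : C} (hk : RingHom.ker f = Ideal.span {x}) {n : ℕ}
    (hx : x ∈ maximalIdeal C)
    (hn : ∀ y, x * y ∈ maximalIdeal C ^ (n + 1) → y ∈ maximalIdeal C ^ n) :
    Module.length C (C ⧸ maximalIdeal C ^ (n + 1)) =
      Module.length C (C ⧸ maximalIdeal C ^ n) +
        Module.length A (A ⧸ maximalIdeal A ^ (n + 1)) := by
  have hmap : (maximalIdeal C ^ (n + 1) ⊔ Ideal.span {x}).map f = maximalIdeal A ^ (n + 1) := by
    rw [Ideal.map_sup, maximalIdeal_pow_map_of_surjective hf, ← hk, (Ideal.map_eq_bot_iff_le_ker f).2 le_rfl, sup_bot_eq]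
  rw [← hmap, ← length_quotient_eq_of_surjective hf (hk ▸ le_sup_right)]
  have hle : maximalIdeal C ^ n ≤
      Submodule.comap (LinearMap.lsmul C C x) (maximalIdeal C ^ (n + 1)) := by
    intro y hy
    change x * y ∈ maximalIdeal C ^ (n + 1)
    rw [pow_succ']
    exact Ideal.mul_mem_mul hx hy
  refine Module.length_eq_add_of_exact (Submodule.mapQ _ _ (LinearMap.lsmul C C x) hle)
    (Submodule.factor le_sup_left) ?_ (Submodule.factor_surjective _) ?_
  · rw [← LinearMap.ker_eq_bot, eq_bot_iff]
    intro y hy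
    obtain ⟨y, rfl⟩ := Submodule.Quotient.mk_surjective _ y
    exact (Submodule.Quotient.mk_eq_zero _).2 (hn y ((Submodule.Quotient.mk_eq_zero _).1 hy))
  · intro y
    obtain ⟨y, rfl⟩ := Submodule.Quotient.mk_surjective _ y
    constructor
    · intro hy
      have hy' : y ∈ maximalIdeal C ^ (n + 1) ⊔ Ideal.span {x} :=
        (Submodule.Quotient.mk_eq_zero _).1 hy
      obtain ⟨a, ha, b, hb, rfl⟩ := Submodule.mem_sup.1 hy'
      obtain ⟨z, rfl⟩ := Ideal.mem_span_singleton.1 hb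
      refine ⟨Submodule.Quotient.mk z, ?_⟩
      refine (Submodule.Quotient.eq _).2 ?_
      change x * z - (a + x * z) ∈ _
      rw [sub_add_cancel_right]
      exact neg_mem ha
    · rintro ⟨z, hz⟩
      obtain ⟨z, rfl⟩ := Submodule.Quotient.mk_surjective _ z
      rw [← hz]
      refine (Submodule.Quotient.mk_eq_zero _).2 (Ideal.mem_sup_right ?_)
      exact Ideal.mem_span_singleton.2 (dvd_mul_right _ _)

/-- A Cohen-Macaulay local ring with infinite residue field has a maximal regular sequence such
that the length of the quotient is the multiplicity. -/
theorem exists_isMaximalRegularSequence_tendsto_length (d : ℕ) (C : Type u) [CommRing C]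
    [IsLocalRing C] [IsNoetherianRing C] [Infinite (ResidueField C)] (hdim : ringKrullDim C = d)
    (hdepth : ringDepth C = d) :
    ∃ rs : List C, IsMaximalRegularSequence C rs ∧ rs.length = d ∧
      Module.length C (C ⧸ Ideal.ofList rs) ≠ ⊤ ∧
      Filter.Tendsto
        (fun n : ℕ =>
          (d.factorial : ℝ) * (Module.length C (C ⧸ maximalIdeal C ^ n)).toNat / (n : ℝ) ^ d)
        Filter.atTop (nhds ((Module.length C (C ⧸ Ideal.ofList rs)).toNat : ℝ)) := by
  induction d generalizing C with
  | zero =>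
    have hart : IsArtinianRing C := by
      rw [isArtinianRing_iff_isNoetherianRing_krullDimLE_zero]
      exact ⟨inferInstance, Ring.krullDimLE_iff.2 (by simp [hdim])⟩
    obtain ⟨N, hN⟩ := (isArtinianRing_iff_isNilpotent_maximalIdeal C).1 hart
    refine ⟨[], ringDepth_eq_zero_iff_isMaximalRegularSequence_nil.1 (by simpa using hdepth), rfl,
      Module.length_ne_top, ?_⟩
    refine tendsto_const_nhds.congr' ?_
    filter_upwards [Filter.eventually_ge_atTop N] with n hn
    have hbot : maximalIdeal C ^ n = Ideal.ofList [] := by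
      rw [Ideal.ofList_nil, eq_bot_iff]
      exact (Ideal.pow_le_pow_right hn).trans hN.le
    rw [hbot]
    simp
  | succ d ih =>
    obtain ⟨x, hx, hreg, -, N, hN⟩ := exists_superficial (C := C) (by
      rw [hdepth]
      exact_mod_cast d.succ_ne_zero)
    let A := C ⧸ Ideal.span {x}
    have hle : Ideal.span {x} ≤ maximalIdeal C := (Ideal.span_singleton_le_iff_mem _).2 hx
    have : IsLocalRing A := isLocalRing_quotient_of_le hle
    let f : C →+* A := Ideal.Quotient.mk _
    have hf : Function.Surjective f := Ideal.Quotient.mk_surjective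
    have hk : RingHom.ker f = Ideal.span {x} := Ideal.mk_ker
    have hloc : IsLocalHom f := .of_surjective f hf
    have : Infinite (ResidueField A) :=
      Infinite.of_injective (ResidueField.map f) (ResidueField.map f).injective
    have hdimA : ringKrullDim A = d := by
      have h1 := ringKrullDim_quotient_span_singleton_succ_eq_ringKrullDim hreg hx
      rw [hdim, Nat.cast_add] at h1
      exact ENat.WithBot.add_one_cancel.1 h1
    have hdepthA : ringDepth A = d := by
      have h1 := ringDepth_eq_add_one_of_ker hf hk hreg
      rw [hdepth, Nat.cast_add] at h1
      exact ENat.add_left_injective_of_ne_top ENat.one_ne_top h1.symm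
    obtain ⟨ys, hys, hlen, hfin, hlim⟩ := ih A hdimA hdepthA
    obtain ⟨zs, rfl⟩ := List.map_surjective_iff.2 hf ys
    have hker : RingHom.ker f = Ideal.ofList [x] := by rw [hk, Ideal.ofList_singleton]
    have hrs : IsMaximalRegularSequence C ([x] ++ zs) :=
      (isMaximalRegularSequence_append_iff_of_ker hf hker zs).2
        ⟨(RingTheory.Sequence.isWeaklyRegular_singleton_iff C x).2 hreg, hys⟩
    have hmapx : (Ideal.ofList ([x] ++ zs)).map f = Ideal.ofList (zs.map f) := by
      rw [Ideal.ofList_append, Ideal.map_sup, ← hker, (Ideal.map_eq_bot_iff_le_ker f).2 le_rfl,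
        bot_sup_eq, Ideal.map_ofList]
    have hlength : Module.length C (C ⧸ Ideal.ofList ([x] ++ zs)) =
        Module.length A (A ⧸ Ideal.ofList (zs.map f)) := by
      rw [length_quotient_eq_of_surjective hf, hmapx]
      rw [hker, Ideal.ofList_append]
      exact le_sup_left
    refine ⟨[x] ++ zs, hrs, by simpa using hlen, hlength ▸ hfin, ?_⟩
    rw [hlength]
    -- For large n the increments of the Hilbert-Samuel function of C are the values of that of A.
    refine tendsto_factorial_mul_div_pow_succ (N := N) (fun n hn => ?_) hlim
    rw [length_quotient_pow_succ hf hk hx (hN n hn), ENat.toNat_add (length_quotient_pow_ne_top n)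
      (length_quotient_pow_ne_top _), Nat.cast_add]

end Multiplicity

/-! ### Lower bounds in depth zero -/

section DepthZero

theorem ringDepth_eq_zero_of_isField {A : Type u} [CommRing A] [IsLocalRing A] [IsNoetherianRing A]
    (h : IsField A) : ringDepth A = 0 :=
  ringDepth_eq_zero_iff.2 ⟨1, one_ne_zero, fun a ha => by
    rw [isField_iff_maximalIdeal_eq.1 h] at ha
    simpa using ha⟩

theorem isField_iff_embDim_eq_zero {A : Type u} [CommRing A] [IsLocalRing A] [IsNoetherianRing A] :
    IsField A ↔ embDim A = 0 :=
  finrank_cotangentSpace_eq_zero_iff.symm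

variable {A : Type u} [CommRing A] [IsLocalRing A] [IsNoetherianRing A]

theorem embDim_le_burchIndexDepthZero (P : MinimalCohenPresentation (LocalCompletion A))
    {J : Ideal P.S} (hJ : J ≠ ⊥) (hJm : J ≤ maximalIdeal P.S)
    (hk : RingHom.ker P.map = J * maximalIdeal P.S) : (embDim A : ℕ∞) ≤ burchIndexDepthZero A := by
  refine le_iSup_of_le P ?_
  rw [hk, relBurchIndex_mul_maximalIdeal hJ hJm, P.embDim_eq]

/-- The completion of S presents the completion of A with kernel JŜ times the maximal ideal, and JŜ
≠ 0 by faithful flatness. -/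
theorem burchIndexDepthZero_eq_embDim_of_ker_eq {S : Type u} [CommRing S] [IsRegularLocalRing S]
    {f : S →+* A} (hf : Function.Surjective f) {J : Ideal S} (hJ : J ≠ ⊥)
    (hJm : J ≤ maximalIdeal S) (hk : RingHom.ker f = J * maximalIdeal S) :
    burchIndexDepthZero A = embDim A := by
  refine le_antisymm (burchIndexDepthZero_le_embDim A) ?_
  have hle : RingHom.ker f ≤ maximalIdeal S ^ 2 := by
    rw [hk, pow_two]
    exact Ideal.mul_mono_left hJm
  have hker : RingHom.ker (completionMap f hf) =
      J.map (algebraMap S (LocalCompletion S)) * maximalIdeal (LocalCompletion S) := by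
    rw [ker_completionMap, hk, Ideal.map_mul, AdicCompletion.maximalIdeal_eq_map]
  have hJ' : J.map (algebraMap S (LocalCompletion S)) ≠ ⊥ := by
    have hflat : Module.Flat S (LocalCompletion S) := inferInstance
    have hloc : IsLocalHom (algebraMap S (LocalCompletion S)) :=
      ((IsLocalRing.local_hom_TFAE (algebraMap S (LocalCompletion S))).out 0 2).2
        AdicCompletion.maximalIdeal_eq_map.symm.le
    have := Module.FaithfullyFlat.of_flat_of_isLocalHom (A := S) (B := LocalCompletion S)
    rwa [Ne, Ideal.map_eq_bot_iff_of_injective (FaithfulSMul.algebraMap_injective _ _)]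
  refine embDim_le_burchIndexDepthZero
    (minimalCohenPresentationOfSurjective hf (embDim_eq_of_ker_le_sq hf hle))
    (J := J.map (algebraMap S (LocalCompletion S))) ?_ ?_ hker
  · exact hJ'
  · change J.map (algebraMap S (LocalCompletion S)) ≤ maximalIdeal (LocalCompletion S)
    rw [AdicCompletion.maximalIdeal_eq_map]
    exact Ideal.map_mono hJm

theorem ringDepth_eq_zero_of_ker_eq {S : Type u} [CommRing S] [IsLocalRing S] [IsNoetherianRing S]
    {f : S →+* A} (hf : Function.Surjective f) {J : Ideal S} (hJ : J ≠ ⊥)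
    (hk : RingHom.ker f = J * maximalIdeal S) : ringDepth A = 0 := by
  obtain ⟨j, hj, hj'⟩ := mul_maximalIdeal_ne hJ
  refine ringDepth_eq_zero_iff.2 ⟨f j, ?_, fun a ha => ?_⟩
  · rwa [Ne, ← RingHom.mem_ker, hk]
  · obtain ⟨a, rfl⟩ := hf a
    rw [mem_maximalIdeal_iff_of_surjective hf] at ha
    rw [← map_mul, ← RingHom.mem_ker, hk]
    exact Ideal.mul_mem_mul hj ha

/-- The kernel of a presentation lies in 𝔫² by minimality and contains it because 𝔪² = 0, so it is
J𝔫 with J = 𝔫. If edim A = 0 this J vanishes, but the bound is trivial. -/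
theorem embDim_le_burchIndexDepthZero_of_sq_eq_bot (h : maximalIdeal A ^ 2 = ⊥) :
    (embDim A : ℕ∞) ≤ burchIndexDepthZero A := by
  have hart : IsArtinianRing A := (isArtinianRing_iff_isNilpotent_maximalIdeal A).2 ⟨2, h⟩
  obtain ⟨P⟩ := nonempty_minimalCohenPresentation A
  rcases Nat.eq_zero_or_pos (embDim A) with h0 | h0
  · simp [h0]
  refine embDim_le_burchIndexDepthZero P (J := maximalIdeal P.S) ?_ le_rfl ?_
  · rw [Ne, ← isField_iff_maximalIdeal_eq, isField_iff_embDim_eq_zero, P.embDim_eq]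
    exact h0.ne'
  · rw [← pow_two]
    refine le_antisymm P.ker_le fun s hs => ?_
    have h1 := Ideal.mem_map_of_mem P.map hs
    rw [maximalIdeal_pow_map_of_surjective P.surjective, AdicCompletion.maximalIdeal_eq_map,
      ← Ideal.map_pow, h, Ideal.map_bot] at h1
    exact h1

/-- Let 𝔪 = (t) with t not nilpotent. If s is in the socle and s = u·t^n, then u is no unit, because
u·t^(n+1) = st = 0. So s lies in every power of 𝔪 and is zero by Krull's intersection theorem. -/
theorem isArtinianRing_of_ringDepth_eq_zero_of_embDim_eq_one (hd : ringDepth A = 0)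
    (he : embDim A = 1) : IsArtinianRing A := by
  rw [isArtinianRing_iff_isNilpotent_maximalIdeal]
  obtain ⟨s, hs, hsm⟩ := ringDepth_eq_zero_iff.1 hd
  obtain ⟨a, ha⟩ := exists_span_range_eq_maximalIdeal A
  obtain ⟨t, ht⟩ : ∃ t, maximalIdeal A = Ideal.span {t} := by
    rw [← ha]
    have : Unique (Fin (embDim A)) := he ▸ inferInstanceAs (Unique (Fin 1))
    exact ⟨a default, by rw [Set.range_unique]⟩
  by_contra hnil
  have hmem : ∀ n, s ∈ maximalIdeal A ^ n := by
    intro n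
    induction n with
    | zero => simp
    | succ n ih =>
      rw [ht, Ideal.span_singleton_pow, Ideal.mem_span_singleton'] at ih
      obtain ⟨u, hu⟩ := ih
      have hum : u ∈ maximalIdeal A := by
        by_contra hu'
        have hunit : IsUnit u := by simpa using hu'
        refine hnil ⟨n + 1, ?_⟩
        rw [ht, Ideal.span_singleton_pow, Ideal.zero_eq_bot, Ideal.span_singleton_eq_bot, pow_succ]
        have h1 := hsm t (ht ▸ Ideal.mem_span_singleton_self t)
        rw [← hu, mul_assoc] at h1
        exact (hunit.mul_right_eq_zero).1 h1
      rw [pow_succ', ← hu]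
      refine Ideal.mul_mem_mul hum ?_
      exact Ideal.pow_mem_pow (ht ▸ Ideal.mem_span_singleton_self t) n
  refine hs ?_
  have := Ideal.iInf_pow_eq_bot_of_isLocalRing (maximalIdeal A) Ideal.IsPrime.ne_top'
  rw [← Ideal.mem_bot, ← this]
  exact Ideal.mem_iInf.2 hmem

/-- The presenting ring has 𝔫 = (t), so I = (I : t)𝔫. Here I ≠ 0 since the depths 0 and 1 differ,
and I : t is proper since I ⊆ 𝔫² ≠ 𝔫. -/
theorem one_le_burchIndexDepthZero (hd : ringDepth A = 0) (he : embDim A = 1) :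
    1 ≤ burchIndexDepthZero A := by
  have := isArtinianRing_of_ringDepth_eq_zero_of_embDim_eq_one hd he
  obtain ⟨P⟩ := nonempty_minimalCohenPresentation A
  have hN := P.isNoetherianRing
  have heP : embDim P.S = 1 := P.embDim_eq.trans he
  have hd' := IsRegularLocalRing.isDomain P.S
  obtain ⟨a, ha⟩ := exists_span_range_eq_maximalIdeal P.S
  obtain ⟨t, ht⟩ : ∃ t, maximalIdeal P.S = Ideal.span {t} := by
    rw [← ha]
    have : Unique (Fin (embDim P.S)) := heP ▸ inferInstanceAs (Unique (Fin 1))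
    exact ⟨a default, by rw [Set.range_unique]⟩
  set I := RingHom.ker P.map with hI
  have hIb : I ≠ ⊥ := by
    intro hb
    have e : P.S ≃+* LocalCompletion A :=
      RingEquiv.ofBijective P.map ⟨(RingHom.injective_iff_ker_eq_bot _).2 hb, P.surjective⟩
    have h1 := ringDepth_eq_of_ringEquiv e
    rw [ringDepth_localCompletion, hd, ringDepth_eq_embDim, heP] at h1
    exact absurd h1 (by simp)
  let J : Ideal P.S := I.colon {t}
  have hIJ : I = J * maximalIdeal P.S := by
    refine le_antisymm (fun i hi => ?_) (Ideal.mul_le.2 fun c hc b hb => ?_)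
    · have him : i ∈ maximalIdeal P.S := ker_le_maximalIdeal P.map hi
      rw [ht, Ideal.mem_span_singleton'] at him
      obtain ⟨c, rfl⟩ := him
      refine Ideal.mul_mem_mul ?_ (ht ▸ Ideal.mem_span_singleton_self t)
      exact Submodule.mem_colon_singleton.2 hi
    · rw [ht, Ideal.mem_span_singleton] at hb
      obtain ⟨b, rfl⟩ := hb
      have h1 : c * t ∈ I := Submodule.mem_colon_singleton.1 hc
      rw [← mul_assoc]
      exact Ideal.mul_mem_right _ _ h1
  have := embDim_le_burchIndexDepthZero P (J := J) (fun h => hIb (by rw [hIJ, h, Ideal.bot_mul]))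
    (le_maximalIdeal fun h => ?_) hIJ
  · rwa [he, Nat.cast_one] at this
  · rw [h, Ideal.top_mul] at hIJ
    have h1 : maximalIdeal P.S ≤ ⊥ :=
      maximalIdeal_le_of_le_sup_sq (by rw [bot_sup_eq]; exact hIJ ▸ P.ker_le)
    have h2 := isField_iff_embDim_eq_zero.1 (isField_iff_maximalIdeal_eq.2 (le_bot_iff.1 h1))
    omega

end DepthZero

/-! ### Regular sequences and embedding dimension -/

section RegularSequence

variable {C : Type u} [CommRing C] [IsLocalRing C] [IsNoetherianRing C]

theorem embDim_le_add_length_of_ker {A : Type u} [CommRing A] [IsLocalRing A] [IsNoetherianRing A]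
    {f : C →+* A} (hf : Function.Surjective f) {rs : List C}
    (hk : RingHom.ker f = Ideal.ofList rs) : embDim C ≤ embDim A + rs.length := by
  obtain ⟨y, hy⟩ := exists_span_range_eq_maximalIdeal A
  choose z hz using fun i => hf (y i)
  have hle : RingHom.ker f ≤ Ideal.span (Set.range (Fin.append z rs.get)) := by
    rw [hk]
    refine Ideal.span_mono fun r hr => ?_
    obtain ⟨i, rfl⟩ := List.get_of_mem hr
    exact ⟨Fin.natAdd _ i, by simp⟩
  refine embDim_le_of_span_range_eq (Fin.append z rs.get) (le_antisymm ?_ ?_)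
  · rw [Ideal.span_le]
    rintro _ ⟨i, rfl⟩
    refine Fin.addCases (fun i => ?_) (fun i => ?_) i
    · rw [Fin.append_left]
      rw [SetLike.mem_coe, ← mem_maximalIdeal_iff_of_surjective hf, hz, ← hy]
      exact Ideal.subset_span ⟨i, rfl⟩
    · rw [Fin.append_right]
      exact ker_le_maximalIdeal f (hk ▸ Ideal.subset_span (List.get_mem rs i))
  · intro c hc
    have h1 : f c ∈ (Ideal.span (Set.range (Fin.append z rs.get))).map f := by
      rw [← mem_maximalIdeal_iff_of_surjective hf, ← hy] at hc
      refine Ideal.span_le.2 ?_ hc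
      rintro _ ⟨i, rfl⟩
      rw [← hz]
      exact Ideal.mem_map_of_mem f (Ideal.subset_span ⟨Fin.castAdd _ i, by simp⟩)
    have h2 := mem_sup_ker_of_map_mem hf h1
    rwa [sup_eq_left.2 hle] at h2

/-- A regular sequence either is part of a minimal generating set of the maximal ideal, or its
quotient is a hypersurface section of a ring by a regular element of the square of the maximal
ideal. -/
theorem embDim_add_length_le_or_exists (rs : List C) (hrs : RingTheory.Sequence.IsRegular C rs)
    {A : Type u} [CommRing A] [IsLocalRing A] [IsNoetherianRing A] {f : C →+* A}
    (hf : Function.Surjective f) (hk : RingHom.ker f = Ideal.ofList rs) :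
    embDim A + rs.length ≤ embDim C ∨
      ∃ (B : Type u) (_ : CommRing B) (_ : IsLocalRing B) (_ : IsNoetherianRing B) (g : B →+* A)
        (x : B), Function.Surjective g ∧ RingHom.ker g = Ideal.span {x} ∧
          x ∈ maximalIdeal B ^ 2 ∧ IsSMulRegular B x ∧ embDim C + 1 ≤ embDim B + rs.length := by
  obtain ⟨n, hn⟩ : ∃ n, rs.length = n := ⟨_, rfl⟩
  induction n generalizing C with
  | zero =>
    left
    rw [hn]
    exact embDim_le_of_surjective hf
  | succ n ih =>
    obtain ⟨r, rs, rfl⟩ := List.exists_cons_of_length_eq_add_one hn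
    by_cases hr2 : r ∈ maximalIdeal C ^ 2
    · right
      -- Moved to the end, r is regular modulo the other members, whose quotient serves as B.
      have hperm : RingTheory.Sequence.IsRegular C (rs ++ [r]) :=
        IsLocalRing.isRegular_of_perm hrs (List.perm_append_singleton r rs).symm
      have hne : Ideal.ofList rs ≤ maximalIdeal C := by
        refine le_trans ?_ (hk ▸ ker_le_maximalIdeal f)
        rw [Ideal.ofList_cons]
        exact le_sup_right
      have hloc : IsLocalRing (C ⧸ Ideal.ofList rs) := isLocalRing_quotient_of_le hne
      let π : C →+* C ⧸ Ideal.ofList rs := Ideal.Quotient.mk _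
      have hπ : Function.Surjective π := Ideal.Quotient.mk_surjective
      have hkπ : RingHom.ker π = Ideal.ofList rs := Ideal.mk_ker
      have hle : Ideal.ofList rs ≤ RingHom.ker f := by
        rw [hk, Ideal.ofList_cons]
        exact le_sup_right
      refine ⟨C ⧸ Ideal.ofList rs, inferInstance, hloc, inferInstance,
        Ideal.Quotient.lift _ f fun a ha => hle ha, π r,
        Ideal.Quotient.lift_surjective_of_surjective _ _ hf, ?_, ?_, ?_, ?_⟩
      · rw [Ideal.ker_quotient_lift, hk, Ideal.ofList_cons, Ideal.map_sup, Ideal.map_quotient_self,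
          sup_bot_eq, Ideal.map_span, Set.image_singleton]
      · rw [← maximalIdeal_pow_map_of_surjective hπ]
        exact Ideal.mem_map_of_mem _ hr2
      · have := ((isRegular_append_iff_of_ker hπ hkπ [r]).1 hperm).2
        rw [List.map_singleton, isRegular_iff_isWeaklyRegular_and_mem,
          RingTheory.Sequence.isWeaklyRegular_singleton_iff] at this
        exact this.1
      · have := embDim_le_add_length_of_ker hπ hkπ
        rw [List.length_cons]
        omega
    · have hle : Ideal.span {r} ≤ RingHom.ker f := by
        rw [hk, Ideal.ofList_cons]
        exact le_sup_left
      have hloc : IsLocalRing (C ⧸ Ideal.span {r}) :=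
        isLocalRing_quotient_of_le (hle.trans (ker_le_maximalIdeal f))
      let π : C →+* C ⧸ Ideal.span {r} := Ideal.Quotient.mk _
      have hπ : Function.Surjective π := Ideal.Quotient.mk_surjective
      have hkπ : RingHom.ker π = Ideal.span {r} := Ideal.mk_ker
      have he := embDim_add_one_eq_of_ker_eq_span hπ hkπ hr2
      rcases ih (rs.map π) ((isRegular_cons_iff_of_ker hπ hkπ rs).1 hrs).2
        (f := Ideal.Quotient.lift _ f fun a ha => hle ha)
        (Ideal.Quotient.lift_surjective_of_surjective _ _ hf) (by
          rw [Ideal.ker_quotient_lift, hk, Ideal.ofList_cons, Ideal.map_sup,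
            Ideal.map_quotient_self, bot_sup_eq, Ideal.map_ofList])
        (by simpa using hn) with h | h
      · left
        rw [List.length_map] at h
        rw [List.length_cons]
        omega
      · right
        obtain ⟨B, i1, i2, i3, g, x, hg, hkg, hx, hxr, hB⟩ := h
        refine ⟨B, i1, i2, i3, g, x, hg, hkg, hx, hxr, ?_⟩
        rw [List.length_map] at hB
        rw [List.length_cons]
        omega

end RegularSequence

/-! ### Good maximal regular sequences -/

section CohenMacaulay

theorem IsMaximalRegularSequence.embDim_le_add_length {C : Type u} [CommRing C] [IsLocalRing C]
    [IsNoetherianRing C] {rs : List C} (hrs : IsMaximalRegularSequence C rs) :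
    haveI := hrs.isLocalRing_quotient
    embDim C ≤ embDim (C ⧸ Ideal.ofList rs) + rs.length :=
  have := hrs.isLocalRing_quotient
  embDim_le_add_length_of_ker (f := Ideal.Quotient.mk (Ideal.ofList rs))
    Ideal.Quotient.mk_surjective Ideal.mk_ker

/-- length A = length 𝔪² + edim A + 1, so 𝔪² has length zero. -/
theorem maximalIdeal_sq_eq_bot_of_length_le {A : Type u} [CommRing A] [IsLocalRing A]
    [IsNoetherianRing A] (h : Module.length A A ≤ embDim A + 1) : maximalIdeal A ^ 2 = ⊥ := by
  have h1 := Module.length_eq_add_of_exact (maximalIdeal A ^ 2).subtype (maximalIdeal A ^ 2).mkQ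
    (Submodule.injective_subtype _) (Submodule.mkQ_surjective _) (LinearMap.exact_subtype_mkQ _)
  rw [h1] at h
  change _ + Module.length A (A ⧸ maximalIdeal A ^ 2) ≤ _ at h
  rw [length_quotient_maximalIdeal_sq] at h
  have h2 : Module.length A (maximalIdeal A ^ 2 : Ideal A) = 0 := by
    refine nonpos_iff_eq_zero.1 ((ENat.add_le_add_iff_right (k := ((embDim A + 1 : ℕ) : ℕ∞))
      (ENat.natCast_ne_top _)).1 ?_)
    rw [zero_add, Nat.cast_add, Nat.cast_one]
    exact h
  rw [Module.length_eq_zero_iff] at h2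
  exact Submodule.subsingleton_iff_eq_bot.1 h2

/-- A Cohen-Macaulay local ring of minimal multiplicity with infinite residue field has a maximal
regular sequence modulo which the maximal ideal squares to zero. -/
theorem exists_isMaximalRegularSequence_sq_eq_bot {C : Type u} [CommRing C]
    [IsLocalRing C] [IsNoetherianRing C] [Infinite (ResidueField C)] {d : ℕ}
    (hdim : ringKrullDim C = d) (hdepth : ringDepth C = d)
    (hmult : Filter.Tendsto
      (fun n : ℕ =>
        (d.factorial : ℝ) * (Module.length C (C ⧸ maximalIdeal C ^ n)).toNat / (n : ℝ) ^ d)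
      Filter.atTop (nhds ((embDim C : ℝ) - d + 1))) :
    ∃ rs : List C, ∃ h : IsMaximalRegularSequence C rs, rs.length = d ∧
      haveI := h.isLocalRing_quotient
      maximalIdeal (C ⧸ Ideal.ofList rs) ^ 2 = ⊥ := by
  obtain ⟨rs, hrs, hlen, hfin, hlim⟩ := exists_isMaximalRegularSequence_tendsto_length d C hdim hdepth
  refine ⟨rs, hrs, hlen, ?_⟩
  have := hrs.isLocalRing_quotient
  -- The two limits agree, so the quotient has length edim C - d + 1, at most one more than its own
  -- embedding dimension.
  have heq := tendsto_nhds_unique hlim hmult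
  have he := hrs.embDim_le_add_length
  apply maximalIdeal_sq_eq_bot_of_length_le
  rw [← Module.length_eq_of_surjective (S := C) (R := C ⧸ Ideal.ofList rs)
    Ideal.Quotient.mk_surjective, ← ENat.natCast_toNat hfin]
  rw [hlen] at he
  have he' : (embDim C : ℝ) ≤ embDim (C ⧸ Ideal.ofList rs) + d := by exact_mod_cast he
  have h1 : ((Module.length C (C ⧸ Ideal.ofList rs)).toNat : ℝ) ≤
      ((embDim (C ⧸ Ideal.ofList rs) + 1 : ℕ) : ℝ) := by
    rw [heq]
    push_cast
    linarith
  exact_mod_cast Nat.cast_le.1 h1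

/-- Over an infinite residue field there is a maximal regular sequence which is part of a minimal
generating set of the maximal ideal. -/
theorem exists_isMaximalRegularSequence_embDim_add_eq (d : ℕ) (C : Type u) [CommRing C]
    [IsLocalRing C] [IsNoetherianRing C] [Infinite (ResidueField C)] (hdepth : ringDepth C = d) :
    ∃ rs : List C, ∃ h : IsMaximalRegularSequence C rs,
      haveI := h.isLocalRing_quotient
      embDim (C ⧸ Ideal.ofList rs) + d = embDim C := by
  induction d generalizing C with
  | zero =>
    have hnil := ringDepth_eq_zero_iff_isMaximalRegularSequence_nil.1 (by simpa using hdepth)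
    refine ⟨[], hnil, ?_⟩
    have := hnil.isLocalRing_quotient
    refine (embDim_eq_of_ker_le_sq (f := Ideal.Quotient.mk (Ideal.ofList []))
      Ideal.Quotient.mk_surjective ?_).symm
    rw [Ideal.mk_ker, Ideal.ofList_nil]
    exact bot_le
  | succ d ih =>
    obtain ⟨x, hx, hreg, hx2, -⟩ := exists_superficial (C := C) (by
      rw [hdepth]
      exact_mod_cast d.succ_ne_zero)
    have hloc : IsLocalRing (C ⧸ Ideal.span {x}) :=
      isLocalRing_quotient_of_le ((Ideal.span_singleton_le_iff_mem _).2 hx)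
    let f : C →+* C ⧸ Ideal.span {x} := Ideal.Quotient.mk _
    have hf : Function.Surjective f := Ideal.Quotient.mk_surjective
    have hk : RingHom.ker f = Ideal.span {x} := Ideal.mk_ker
    have hlocf : IsLocalHom f := .of_surjective f hf
    have hinf : Infinite (ResidueField (C ⧸ Ideal.span {x})) :=
      Infinite.of_injective (ResidueField.map f) (ResidueField.map f).injective
    have h1 := ringDepth_eq_add_one_of_ker hf hk hreg
    rw [hdepth, Nat.cast_add] at h1
    obtain ⟨ys, hys, he⟩ := ih (C ⧸ Ideal.span {x})
      (ENat.add_left_injective_of_ne_top ENat.one_ne_top h1.symm)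
    obtain ⟨zs, rfl⟩ := List.map_surjective_iff.2 hf ys
    have hker : RingHom.ker f = Ideal.ofList [x] := by rw [hk, Ideal.ofList_singleton]
    have hrs : IsMaximalRegularSequence C ([x] ++ zs) :=
      (isMaximalRegularSequence_append_iff_of_ker hf hker zs).2
        ⟨(RingTheory.Sequence.isWeaklyRegular_singleton_iff C x).2 hreg, hys⟩
    refine ⟨[x] ++ zs, hrs, ?_⟩
    have := hrs.isLocalRing_quotient
    have := hys.isLocalRing_quotient
    have hle : Ideal.ofList ([x] ++ zs) ≤
        (Ideal.ofList (zs.map f)).comap f := by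
      rw [← Ideal.map_le_iff_le_comap, Ideal.ofList_append, Ideal.map_sup, ← hker,
        (Ideal.map_eq_bot_iff_le_ker f).2 le_rfl, bot_sup_eq, Ideal.map_ofList]
    have h2 := embDim_le_of_surjective (f := Ideal.quotientMap _ f hle)
      (Ideal.quotientMap_surjective hf)
    have h3 := hrs.embDim_le_add_length
    have h4 := embDim_add_one_eq_of_ker_eq_span hf hk hx2
    have e : (C ⧸ Ideal.ofList ([x] ++ zs)) ≃+* (C ⧸ Ideal.span {x}) ⧸ Ideal.ofList (zs.map f) :=
      RingEquiv.ofBijective (Ideal.quotientMap _ f hle)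
        ⟨Ideal.quotientMap_injective' (by
          rw [← Ideal.map_ofList, Ideal.comap_map_of_surjective f hf, ← RingHom.ker_eq_comap_bot,
            hker, Ideal.ofList_append, sup_comm]), Ideal.quotientMap_surjective hf⟩
    have h5 := embDim_eq_of_ringEquiv e
    omega

end CohenMacaulay

/-! ### The Burch index -/

section BurchIndex

variable {R : Type u} [CommRing R] [IsLocalRing R] [IsNoetherianRing R]

theorem burchIndex_of_ringDepth_eq_zero (h : ringDepth R = 0) :
    burchIndex R = burchIndexDepthZero R := if_pos h

theorem le_burchIndex_of_isMaximalRegularSequence (h : ringDepth R ≠ 0)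
    {rs : List (GenericExtension R)} (hrs : IsMaximalRegularSequence (GenericExtension R) rs) :
    haveI := hrs.isLocalRing_quotient
    burchIndexDepthZero (GenericExtension R ⧸ Ideal.ofList rs) ≤ burchIndex R := by
  rw [burchIndex, if_neg h]
  exact le_iSup₂_of_le rs hrs le_rfl

/-- `embDim_add_length_le_or_exists` leaves two cases: the general depth-zero bound, or index zero.
In the second, edim B ≥ 2 because rs is shorter than edim C; otherwise dim C ≥ edim C and C would be
regular. -/
theorem burchIndexDepthZero_add_length_le {C : Type u} [CommRing C] [IsLocalRing C]
    [IsNoetherianRing C] (hC : ¬ IsRegularLocalRing C) {rs : List C}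
    (hrs : IsMaximalRegularSequence C rs) :
    haveI := hrs.isLocalRing_quotient
    burchIndexDepthZero (C ⧸ Ideal.ofList rs) + rs.length ≤ embDim C := by
  have := hrs.isLocalRing_quotient
  have hlt : rs.length < embDim C := by
    by_contra hlt
    refine hC (isRegularLocalRing_of_embDim_le ?_)
    refine le_trans ?_ (length_le_ringKrullDim hrs.isRegular)
    exact_mod_cast not_lt.1 hlt
  rcases embDim_add_length_le_or_exists rs hrs.isRegular
    (f := Ideal.Quotient.mk (Ideal.ofList rs)) Ideal.Quotient.mk_surjective Ideal.mk_ker with h | h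
  · refine (add_le_add_left (burchIndexDepthZero_le_embDim _) _).trans ?_
    exact_mod_cast h
  · obtain ⟨B, _, _, _, g, x, hg, hk, hx, hxr, hB⟩ := h
    have h0 : burchIndexDepthZero (C ⧸ Ideal.ofList rs) = 0 := by
      refine nonpos_iff_eq_zero.1 (iSup_le fun P => ?_)
      rw [relBurchIndex_eq_zero_of_ker_eq_span hg hk hx hxr ?_ P, Nat.cast_zero]
      intro m hm
      have h1 : embDim B ≤ 1 := embDim_le_of_span_range_eq (fun _ : Fin 1 => m) (by
        rw [Set.range_const, hm])
      omega
    rw [h0, zero_add]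
    exact_mod_cast hlt.le

theorem isRegularLocalRing_of_genericExtension (h : IsRegularLocalRing (GenericExtension R)) :
    IsRegularLocalRing R := by
  apply isRegularLocalRing_of_embDim_le
  rw [← embDim_genericExtension, ← ringKrullDim_genericExtension, ringKrullDim_eq_embDim]

theorem exists_ringDepth_eq_natCast : ∃ d : ℕ, ringDepth R = d := by
  obtain ⟨rs, hrs⟩ := exists_isMaximalRegularSequence R
  exact ⟨_, hrs.ringDepth_eq⟩

theorem burchIndex_add_ringDepth_le (hR : IsRegularLocalRing R → IsField R) :
    burchIndex R + ringDepth R ≤ embDim R := by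
  by_cases h0 : ringDepth R = 0
  · rw [burchIndex_of_ringDepth_eq_zero h0, h0, add_zero]
    exact burchIndexDepthZero_le_embDim R
  · have hC : ¬ IsRegularLocalRing (GenericExtension R) := fun h =>
      h0 (ringDepth_eq_zero_of_isField (hR (isRegularLocalRing_of_genericExtension h)))
    obtain ⟨d, hd⟩ := exists_ringDepth_eq_natCast (R := R)
    have hlen {rs : List (GenericExtension R)}
        (hrs : IsMaximalRegularSequence (GenericExtension R) rs) : (rs.length : ℕ∞) = d := by
      rw [← hrs.ringDepth_eq, ringDepth_genericExtension, hd]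
    have hle : (d : ℕ∞) ≤ embDim R := by
      obtain ⟨rs, hrs⟩ := exists_isMaximalRegularSequence (GenericExtension R)
      rw [← hlen hrs, ← embDim_genericExtension]
      exact le_trans le_add_self (burchIndexDepthZero_add_length_le hC hrs)
    have hsup : burchIndex R ≤ embDim R - d := by
      rw [burchIndex, if_neg h0]
      refine iSup₂_le fun rs hrs => ?_
      refine ENat.le_sub_of_add_le_right (ENat.natCast_ne_top d) ?_
      rw [← hlen hrs, ← embDim_genericExtension]
      exact burchIndexDepthZero_add_length_le hC hrs
    rw [hd]
    exact (add_le_add_left hsup _).trans (tsub_add_cancel_of_le hle).le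

theorem burchIndex_eq_ringKrullDim {S : Type u} [CommRing S] [IsRegularLocalRing S] {J : Ideal S}
    {f : S →+* R} (hf : Function.Surjective f) (hJ : J ≠ ⊥) (hJm : J ≤ maximalIdeal S)
    (hk : RingHom.ker f = J * maximalIdeal S) :
    (burchIndex R : WithBot ℕ∞) = ringKrullDim S := by
  rw [burchIndex_of_ringDepth_eq_zero (ringDepth_eq_zero_of_ker_eq hf hJ hk),
    burchIndexDepthZero_eq_embDim_of_ker_eq hf hJ hJm hk, ringKrullDim_eq_embDim S,
    embDim_eq_of_ker_le_sq hf]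
  · rfl
  · rw [hk, pow_two]
    exact Ideal.mul_mono_left hJm

/-- Modulo the chosen sequence 𝔪² = 0, so the index of the quotient is at least its embedding
dimension, and d elements lower the embedding dimension by at most d. -/
theorem embDim_le_burchIndex_add_ringDepth (hCM : IsCohenMacaulayLocal R)
    (hmult : HasMinimalMultiplicity R) : embDim R ≤ burchIndex R + ringDepth R := by
  obtain ⟨d, hdim, d', hdim', hlim⟩ := hmult
  obtain rfl : d = d' := by
    rw [hdim] at hdim'
    exact_mod_cast hdim'
  have hdepth : ringDepth R = d := by
    rw [IsCohenMacaulayLocal, hdim] at hCM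
    exact_mod_cast hCM
  obtain ⟨rs, hrs, hlen, hsq⟩ := exists_isMaximalRegularSequence_sq_eq_bot
    (C := GenericExtension R) ((ringKrullDim_genericExtension R).trans hdim)
    ((ringDepth_genericExtension R).trans hdepth) (by
      simpa only [length_genericExtension_quotient_pow, embDim_genericExtension] using hlim)
  have := hrs.isLocalRing_quotient
  -- In depth zero the index is computed on R itself, so 𝔪² = 0 is descended from the generic
  -- extension by faithful flatness.
  by_cases h0 : ringDepth R = 0
  · rw [burchIndex_of_ringDepth_eq_zero h0, h0, add_zero]
    apply embDim_le_burchIndexDepthZero_of_sq_eq_bot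
    have hd : d = 0 := by
      rw [hdepth] at h0
      exact_mod_cast h0
    obtain rfl := List.length_eq_zero_iff.1 (hlen.trans hd)
    have hloc : IsLocalHom (algebraMap R (GenericExtension R)) :=
      ((IsLocalRing.local_hom_TFAE (algebraMap R (GenericExtension R))).out 0 2).2
        (map_maximalIdeal_genericExtension R).le
    have hff := Module.FaithfullyFlat.of_flat_of_isLocalHom (A := R) (B := GenericExtension R)
    have hinj : Function.Injective (algebraMap R (GenericExtension R)) :=
      FaithfulSMul.algebraMap_injective _ _
    rw [← Ideal.map_eq_bot_iff_of_injective hinj, Ideal.map_pow,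
      map_maximalIdeal_genericExtension]
    rw [← maximalIdeal_pow_map_of_surjective
      (Ideal.Quotient.mk_surjective (I := Ideal.ofList ([] : List (GenericExtension R)))),
      Ideal.map_eq_bot_iff_le_ker, Ideal.mk_ker, Ideal.ofList_nil] at hsq
    exact le_bot_iff.1 hsq
  · have h1 := hrs.embDim_le_add_length
    rw [hlen, embDim_genericExtension] at h1
    rw [hdepth]
    refine le_trans (Nat.cast_le.2 h1) ?_
    rw [Nat.cast_add]
    exact add_le_add_left ((embDim_le_burchIndexDepthZero_of_sq_eq_bot hsq).trans
      (le_burchIndex_of_isMaximalRegularSequence h0 hrs)) _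

theorem isRegularLocalRing_of_localCompletion (h : IsRegularLocalRing (LocalCompletion R)) :
    IsRegularLocalRing R := by
  apply isRegularLocalRing_of_embDim_le
  refine le_trans ?_ (ringDepth_le_ringKrullDim (R := R))
  rw [← ringDepth_localCompletion, ringDepth_eq_embDim, embDim_completion]
  rfl

/-- f is nonzero and lies in 𝔫², since otherwise R̂ and hence R would be regular. So edim R̂ = edim
S = depth S = depth R̂ + 1. -/
theorem embDim_eq_ringDepth_add_one_of_isHypersurface (hR : IsHypersurface R)
    (hreg : ¬ IsRegularLocalRing R) : (embDim R : ℕ∞) = ringDepth R + 1 := by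
  obtain ⟨S, _, _, f, ⟨e⟩⟩ := hR
  have hd := IsRegularLocalRing.isDomain S
  let π : S →+* LocalCompletion R := (e.symm : _ →+* _).comp (Ideal.Quotient.mk (Ideal.span {f}))
  have hπ : Function.Surjective π := e.symm.surjective.comp Ideal.Quotient.mk_surjective
  have hk : RingHom.ker π = Ideal.span {f} := by
    ext s
    rw [RingHom.mem_ker]
    change e.symm _ = 0 ↔ _
    rw [map_eq_zero_iff _ e.symm.injective, Ideal.Quotient.eq_zero_iff_mem]
  have hf2 : f ∈ maximalIdeal S ^ 2 := by
    by_contra hf2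
    exact hreg (isRegularLocalRing_of_localCompletion (isRegularLocalRing_of_ker_eq_span hπ hk hf2))
  have hf0 : f ≠ 0 := by
    rintro rfl
    rw [Ideal.span_singleton_eq_bot.2 rfl] at hk
    have e' : S ≃+* LocalCompletion R :=
      RingEquiv.ofBijective π ⟨(RingHom.injective_iff_ker_eq_bot _).2 hk, hπ⟩
    refine hreg (isRegularLocalRing_of_localCompletion (isRegularLocalRing_of_embDim_le ?_))
    rw [← embDim_eq_of_ringEquiv e', ← ringKrullDim_eq_of_ringEquiv e', ringKrullDim_eq_embDim]
  have h1 := embDim_eq_of_ker_le_sq hπ (hk ▸ (Ideal.span_singleton_le_iff_mem _).2 hf2)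
  have h2 := ringDepth_eq_add_one_of_ker hπ hk
    (IsLeftRegular.isSMulRegular (IsRegular.of_ne_zero hf0).left)
  rw [ringDepth_eq_embDim, ringDepth_localCompletion, h1, embDim_completion] at h2
  exact h2

/-- The upper bound is edim - depth = 1. In positive depth the lower bound comes from a regular
sequence that is part of a minimal generating set of 𝔪: its quotient has depth 0 and embedding
dimension 1. -/
theorem burchIndex_eq_one_of_isHypersurface (hR : IsHypersurface R)
    (hreg : ¬ IsRegularLocalRing R) : burchIndex R = 1 := by
  obtain ⟨d, hd⟩ := exists_ringDepth_eq_natCast (R := R)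
  have he := embDim_eq_ringDepth_add_one_of_isHypersurface hR hreg
  refine le_antisymm ?_ ?_
  · have h1 := burchIndex_add_ringDepth_le fun h => absurd h hreg
    rw [he, add_comm, hd] at h1
    exact (ENat.add_le_add_iff_left (ENat.natCast_ne_top d)).1 h1
  · by_cases h0 : ringDepth R = 0
    · rw [burchIndex_of_ringDepth_eq_zero h0]
      refine one_le_burchIndexDepthZero h0 ?_
      rw [h0] at he
      exact_mod_cast he
    · obtain ⟨rs, hrs, hers⟩ := exists_isMaximalRegularSequence_embDim_add_eq d
        (GenericExtension R) ((ringDepth_genericExtension R).trans hd)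
      have := hrs.isLocalRing_quotient
      refine le_trans ?_ (le_burchIndex_of_isMaximalRegularSequence h0 hrs)
      refine one_le_burchIndexDepthZero ((isMaximalRegularSequence_iff_of_ker
        Ideal.Quotient.mk_surjective Ideal.mk_ker hrs.isRegular.toIsWeaklyRegular).1 hrs) ?_
      rw [hd] at he
      have he' : embDim R = d + 1 := by exact_mod_cast he
      rw [embDim_genericExtension] at hers
      omega

end BurchIndex

/-- Depth is added on the left because subtraction in `ℕ∞` truncates. A regular local ring has
dimension zero exactly when it is a field, which gives the form of the regularity hypotheses. -/
theorem proposition1p5 (R : Type u) [CommRing R] [IsLocalRing R] [IsNoetherianRing R] :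
    ((IsRegularLocalRing R → IsField R) →
      burchIndex R + ringDepth R ≤ (embDim R : ℕ∞)) ∧
    (∀ (S : Type u) [CommRing S] [IsRegularLocalRing S] (J : Ideal S) (f : S →+* R),
      J ≠ ⊥ → J ≤ maximalIdeal S → Function.Surjective f →
      RingHom.ker f = J * maximalIdeal S →
      (burchIndex R : WithBot ℕ∞) = ringKrullDim S) ∧
    ((IsRegularLocalRing R → IsField R) →
      IsCohenMacaulayLocal R → HasMinimalMultiplicity R →
      burchIndex R + ringDepth R = (embDim R : ℕ∞)) ∧
    (IsHypersurface R → ¬ IsRegularLocalRing R → burchIndex R = 1) :=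
  ⟨burchIndex_add_ringDepth_le, fun _ _ _ _ _ hJ hJm hf hk => burchIndex_eq_ringKrullDim hf hJ hJm hk,
    fun hR hCM hmult => le_antisymm (burchIndex_add_ringDepth_le hR)
      (embDim_le_burchIndex_add_ringDepth hCM hmult), burchIndex_eq_one_of_isHypersurface⟩
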